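/- **Setting.** Let $N\ge 1$ be an integer, $\Gamma\subset \mathrm{SL}_2(\mathbb Z)$ a congruence subgroup, $k\ge 0$ an integer, and write $e(w)=e^{2\pi i w}$. For $\kappa \in\mathbb Z$ let $\Delta_\kappa=-y^2\big(\partial_x^2+\partial_y^2\big)+i\kappa y\big(\partial_x+i\partial_y\big)$ and $\xi_\kappa G=2iy^\kappa\,\overline{\partial_{\bar z}G}$. The space $H_{2k+2}(\Gamma)$ of harmonic Maass forms consists of the smooth functions $G:\mathbb H\to\mathbb C$ with $G|_{2k+2}\gamma=G$ for $\gamma\in\Gamma$ and $\Delta_{2k+2}G=0$, which are of at most linear exponential growth at all cusps, i.e. for each $\sigma\in\mathrm{SL}_2(\mathbb Z)$ one has $(G|_{2k+2}\sigma)(z)=O(e^{Cy})$ as $y\to\infty$, uniformly in $x$, for some $C$. Let $V$ be the space of rational traceless $2\times 2$ matrices with $Q(X)=N\det X$, $(X,Y)=-N\,\mathrm{tr}(XY)$ and the action $\gamma X:=\gamma X\gamma^{-1}$, oriented by the basis $\left(\begin{smallmatrix}0&1\\-1&0\end{smallmatrix}\right),\left(\begin{smallmatrix}0&1\\1&0\end{smallmatrix}\right),\left(\begin{smallmatrix}1&0\\0&-1\end{smallmatrix}\right)$.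 Put $X_\infty=\left(\begin{smallmatrix}0&1\\0&0\end{smallmatrix}\right)$ and $\ell_\infty=\mathbb Q X_\infty$. For an isotropic line $\ell$ pick $\sigma_\ell\in\mathrm{SL}_2(\mathbb Z)$ with $\sigma_\ell\ell_\infty=\ell$; the positive multiples of $\sigma_\ell X_\infty$ are called positively oriented. Let $\alpha_\ell\geq 1$ be the width of the cusp $\ell$, i.e. the least positive integer with $\pm\sigma_\ell\left(\begin{smallmatrix}1&\alpha_\ell\\0&1\end{smallmatrix}\right)\sigma_\ell^{-1}\in\Gamma$ for some choice of sign. Put $G_\ell=G|_{2k+2}\sigma_\ell$, with Fourier expansion $$G_\ell(z)=\sum_{n\gg-\infty}a_\ell^+(n)e(nz)+a_\ell^-(0)y^{-1-2k}+\sum_{n\ll\infty,\,n\ne0}a_\ell^-(n)\,\mathcal E_{2k+2}(4\pi ny)\,e(nz),\qquad n\in\tfrac1{\alpha_\ell}\mathbb Z,$$ where for integers $\kappa\ge1$ and real $y \neq 0$ $$\mathcal E_\kappa(y)=\frac{(-1)^{\kappa+1}}{(\kappa-1)!}\Big(e^y\sum_{j=0}^{\kappa-2}y^{-j-1}j!-\mathrm{Ei}(y)\Big),\qquad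 \mathrm{Ei}(y)=-\mathrm{PV}\!\int_{-y}^\infty e^{-t}\frac{dt}t .$$ Let $a_{\xi_{2k+2}G,\ell}(0)$ be the constant Fourier coefficient of $(\xi_{2k+2}G)|_{-2k}\sigma_\ell$. Write $\Gamma(s,y)=\int_y^\infty e^{-t}t^{s-1}dt$ for integers $s\ge1$ and $y \in \mathbb{R}$, let $B_m$ be the Bernoulli polynomials, $\psi=\Gamma'/\Gamma$, and let $\psi^{(k)}$ be its $k$-th derivative. Let $X\in V$ with $m=Q(X)<0$ such that $|m|/4N$ is a rational square. Then $X$ is orthogonal to exactly two isotropic lines $\ell_X,\ell_{-X}$, labelled such that $(X,Y,\tilde Y)$ is a positively oriented basis for positively oriented $Y\in\ell_X$, $\tilde Y\in\ell_{-X}$. Let $Q_X(z)=N(x_3z^2-2x_2z-x_1)$ for $X=\left(\begin{smallmatrix}x_2&x_1\\x_3&-x_2\end{smallmatrix}\right)$, and define the rational numbers $r_{\ell_{\pm X}}$ by $\sigma_{\ell_{\pm X}}^{-1}(\pm X)=\sqrt{|m|/N}\left(\begin{smallmatrix}-1&2r_{\ell_{\pm X}}\\0&1\end{smallmatrix}\right)$.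 Let $c_+>0$ and $c_-=\mathrm{Im}\big(\sigma_{\ell_{-X}}^{-1}\sigma_{\ell_X}(r_{\ell_X}+ic_+)\big)$. Set $\lambda_k(T)=T^{-k}/k$ for $k>0$ and $\lambda_0(T)=-\log T$. For a line $\ell\in\{\ell_X,\ell_{-X}\}$ and $c,T>0$ put $$\begin{aligned}R_\ell(c,T)=&\int_c^TG_\ell(r_\ell+iy)y^kdy-a_\ell^+(0)\frac{T^{k+1}}{k+1}+\sum_{n\ne0}a_\ell^+(n)e(nr_\ell)\frac{\Gamma(k+1,2\pi nT)}{(2\pi n)^{k+1}}+a_\ell^-(0)\lambda_k(T)\\&+\sum_{n\ne0}a_\ell^-(n)e(nr_\ell)\Big(\mathcal E_{2k+2}(4\pi nT)\frac{\Gamma(k+1,2\pi nT)}{(2\pi n)^{k+1}}-\frac{2^{-2k-1}k!}{(2\pi n)^{k+1}}\sum_{j=0}^k\frac{(-1)^j}{j!}\mathcal E_{2k+2-j}(2\pi nT)\Big).\end{aligned}$$ The regularized cycle integral is defined, with arbitrary $S_+,S_->0$, by $$\frac1{(2\sqrt{|m|N}\,i)^k\,i}\int_{c(X)}^{\mathrm{reg}}G(z)Q_X^k(z)dz=R_{\ell_X}(c_+,S_+)+(-1)^{k+1}R_{\ell_{-X}}(c_-,S_-).$$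 **Proposition.** Let $G\in H_{2k+2}(\Gamma)$ and let $X$, $c_\pm$ be as above. For all $S_+,S_->0$ used in the definition of the regularized cycle integral, and for all $T_+,T_->0$, $$\frac1{(2\sqrt{|m|N}\,i)^k\,i}\int_{c(X)}^{\mathrm{reg}}G(z)Q_X^k(z)dz=A_{\ell_X}(c_+,T_+)+(-1)^{k+1}A_{\ell_{-X}}(c_-,T_-),$$ where, for $\ell\in\{\ell_X,\ell_{-X}\}$ and with $\alpha=\alpha_\ell$, $r=r_\ell$ and $z=x+iy$ in the line integrals over horizontal segments, $$\begin{aligned}A_\ell(c,T)=&\int_c^TG_\ell(r+iy)y^kdy\\ &+(-1)^k\frac{(i\alpha)^{k+1}}{k+1}\int_{iT/\alpha}^{iT/\alpha+1}\big(G_\ell(r+\alpha z)-a_\ell^-(0)(\alpha y)^{-1-2k}\big)B_{k+1}(z)\,dz\\ &-(-1)^k(i\alpha)^{-k}\frac{2^{2k-1}k!}{(2k+1)!}\overline{\int_{iT/\alpha}^{iT/\alpha+1}\big((\xi_{2k+2}G_\ell)(r+\alpha z)-a_{\xi_{2k+2}G,\ell}(0)\big)\big(\psi^{(k)}(z)+(-1)^k\psi^{(k)}(1-z)\big)dz}\\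 &-(-1)^k(i\alpha)^{-k}\frac{k!}{(2k+1)!}\sum_{d=0}^k\frac{(d+k)!}{(d+1)!}\sum_{j=0}^{k-d}\binom{2k+1}j\\ &\qquad\times\overline{\int_{iT/\alpha}^{iT/\alpha+1}\big((\xi_{2k+2}G_\ell)(r+\alpha z)-a_{\xi_{2k+2}G,\ell}(0)\big)B_{d+1}(x)(-iy)^{-k-d-1}dz}\\ &+a_\ell^-(0)\lambda_k(T).\end{aligned}$$ -/

import Mathlib

open scoped MatrixGroups ModularForm UpperHalfPlane ContDiff Topology

noncomputable section

namespace ShintaniCycle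

/-! ### Harmonic Maass forms -/

/-- Partial derivative in the direction of the real axis. -/
def dX (F : ℂ → ℂ) (z : ℂ) : ℂ := fderiv ℝ F z 1

/-- Partial derivative in the direction of the imaginary axis. -/
def dY (F : ℂ → ℂ) (z : ℂ) : ℂ := fderiv ℝ F z Complex.I

/-- The extension of a function on the upper half-plane to `ℂ` (arbitrary outside of it). -/
def ext (G : ℍ → ℂ) : ℂ → ℂ := fun z => G (UpperHalfPlane.ofComplex z)

/-- The weight `κ` Laplace operator
`-y² (∂²/∂x² + ∂²/∂y²) + i κ y (∂/∂x + i ∂/∂y)`. -/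
def laplace (κ : ℤ) (G : ℍ → ℂ) (z : ℍ) : ℂ :=
  -(z.im : ℂ) ^ 2 * (dX (dX (ext G)) z + dY (dY (ext G)) z)
    + Complex.I * κ * z.im * (dX (ext G) z + Complex.I * dY (ext G) z)

/-- The operator `ξ_κ G = 2 i y^κ conj (∂G/∂z̄)`, where `∂/∂z̄ = (∂/∂x + i ∂/∂y) / 2`. -/
def xi (κ : ℤ) (G : ℍ → ℂ) (z : ℍ) : ℂ :=
  2 * Complex.I * (z.im : ℂ) ^ κ *
    (starRingEnd ℂ) ((dX (ext G) z + Complex.I * dY (ext G) z) / 2)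

/-- Harmonic Maass forms of weight `κ` for `Γ`: smooth, modular of weight `κ`, harmonic for the
weight `κ` Laplace operator, and of at most linear exponential growth at all cusps. -/
structure IsHarmonicMaassForm (Γ : Subgroup SL(2, ℤ)) (κ : ℤ) (G : ℍ → ℂ) : Prop where
  smooth : ContDiffOn ℝ ∞ (ext G) {z : ℂ | 0 < z.im}
  slash_eq : ∀ γ ∈ Γ, G ∣[κ] γ = G
  harmonic : ∀ z : ℍ, laplace κ G z = 0
  growth : ∀ γ : SL(2, ℤ), ∃ A B C : ℝ, ∀ z : ℍ, A ≤ z.im →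
    ‖(G ∣[κ] γ) z‖ ≤ B * Real.exp (C * z.im)

/-! ### Special functions -/

/-- The exponential integral `Ei(y) = -∫_{-y}^∞ e^{-t} dt / t` for `y ≠ 0`, with the Cauchy
principal value at `t = 0` (relevant only if `y > 0`). -/
def expInt (y : ℝ) : ℝ :=
  Filter.limUnder (𝓝[>] (0 : ℝ)) fun ε : ℝ =>
    -∫ t in {t : ℝ | -y < t ∧ ε < |t|}, Real.exp (-t) / t

/-- The function `𝓔_κ(y)`, for `κ ≥ 1` and `y ≠ 0`. -/
def calE (κ : ℕ) (y : ℝ) : ℝ :=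
  (-1) ^ (κ + 1) / (κ - 1).factorial *
    (Real.exp y * ∑ j ∈ Finset.range (κ - 1), (y ^ (j + 1))⁻¹ * j.factorial - expInt y)

/-- The incomplete Gamma function `Γ(s, y) = ∫_y^∞ e^{-t} t^{s-1} dt` at integers `s ≥ 1`, for
every real `y`. -/
def incGamma (s : ℕ) (y : ℝ) : ℝ :=
  ∫ t in Set.Ioi y, Real.exp (-t) * t ^ (s - 1)

/-- The polygamma function `ψ^{(k)}`, the `k`-th derivative of `ψ = Γ' / Γ`. -/
def polygamma (k : ℕ) (z : ℂ) : ℂ := iteratedDeriv k Complex.digamma z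

/-- The Bernoulli polynomial `B_m` at a complex number. -/
def bernoulliPoly (m : ℕ) (z : ℂ) : ℂ := Polynomial.aeval z (Polynomial.bernoulli m)

/-- `e(w) = e^{2πiw}`. -/
def e (w : ℂ) : ℂ := Complex.exp (2 * Real.pi * Complex.I * w)

/-! ### Fourier coefficients -/

/-- `a` and `b` are the coefficients `a⁺` and `a⁻` of a Fourier expansion, of the shape which
harmonic Maass forms of weight `2k+2` have at a cusp of width `α`. The integer `n` belongs to the
frequency `n / α`. -/
structure IsFourierExpansion (k α : ℕ) (G : ℍ → ℂ) (a b : ℤ → ℂ) : Prop where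
  plus_eq_zero : ∃ M : ℤ, ∀ n < M, a n = 0
  minus_eq_zero : ∃ M : ℤ, ∀ n > M, b n = 0
  hasSum : ∀ z : ℍ, HasSum (fun n : ℤ =>
    (a n + b n * (if n = 0 then (z.im ^ (2 * k + 1))⁻¹
      else calE (2 * k + 2) (4 * Real.pi * (n / α) * z.im) : ℝ)) * e (n / α * z)) (G z)

open Classical in
/-- The coefficients `(a⁺, a⁻)` of the (unique) Fourier expansion of `G`. -/
def fourierCoeffs (k α : ℕ) (G : ℍ → ℂ) : (ℤ → ℂ) × (ℤ → ℂ) :=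
  if h : ∃ p : (ℤ → ℂ) × (ℤ → ℂ), IsFourierExpansion k α G p.1 p.2 then h.choose else 0

/-- The constant coefficient `(1/α) ∫_i^{i+α} F(z) dz` of an `α`-periodic holomorphic function
on the upper half-plane. -/
def constCoeff (α : ℕ) (F : ℍ → ℂ) : ℂ :=
  (α : ℂ)⁻¹ * ∫ x in (0 : ℝ)..α, ext F (x + Complex.I)

/-! ### The quadratic space of rational traceless `2 × 2` matrices -/

/-- The quadratic form `Q(X) = N det X`. -/
def Q (N : ℕ) (X : Matrix (Fin 2) (Fin 2) ℚ) : ℚ := N * X.det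

/-- The bilinear form `(X, Y) = -N tr(XY)`. -/
def bilin (N : ℕ) (X Y : Matrix (Fin 2) (Fin 2) ℚ) : ℚ := -N * (X * Y).trace

/-- The action `γ X γ⁻¹`. -/
def conj (γ : SL(2, ℤ)) (X : Matrix (Fin 2) (Fin 2) ℚ) : Matrix (Fin 2) (Fin 2) ℚ :=
  γ.1.map (Int.cast : ℤ → ℚ) * X * (γ⁻¹).1.map (Int.cast : ℤ → ℚ)

/-- The spanning vector `X_∞` of the isotropic line `ℓ_∞`. If `ℓ` is the isotropic line
`γ ℓ_∞`, then `γ X_∞` is a positively oriented element of `ℓ`. -/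
def Xinf : Matrix (Fin 2) (Fin 2) ℚ := !![0, 1; 0, 0]

/-- The determinant of three vectors with respect to the coordinates `(x₂, x₁, x₃)` of
`X = (x₂, x₁; x₃, -x₂)`. -/
def orientDet (X Y Z : Matrix (Fin 2) (Fin 2) ℚ) : ℚ :=
  Matrix.det !![X 0 0, X 0 1, X 1 0; Y 0 0, Y 0 1, Y 1 0; Z 0 0, Z 0 1, Z 1 0]

/-- The orienting basis `X₁(i), X₂(i), X₃(i)` of the quadratic space (up to positive scalars) has
a positive determinant, so a basis is positively oriented iff `orientDet` is positive. -/
theorem orientDet_std :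
    0 < orientDet !![0, 1; -1, 0] !![0, 1; 1, 0] !![1, 0; 0, -1] := by
  simp [orientDet, Matrix.det_fin_three]

/-- `σp ℓ_∞ = ℓ_X` and `σm ℓ_∞ = ℓ_{-X}`: both lines are orthogonal to `X`, and `X` together with
positively oriented elements of `ℓ_X` and `ℓ_{-X}` (in this order) is a positively oriented
basis. -/
structure IsCuspPair (N : ℕ) (X : Matrix (Fin 2) (Fin 2) ℚ) (σp σm : SL(2, ℤ)) : Prop where
  orth_plus : bilin N X (conj σp Xinf) = 0
  orth_minus : bilin N X (conj σm Xinf) = 0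
  oriented : 0 < orientDet X (conj σp Xinf) (conj σm Xinf)

/-- The real part `r` of the geodesic, `σ⁻¹ X = √(|Q(X)|/N) (-1, 2r; 0, 1)` where
`σ ℓ_∞ = ℓ_X`. -/
def realPart (N : ℕ) (X : Matrix (Fin 2) (Fin 2) ℚ) (σ : SL(2, ℤ)) : ℝ :=
  (conj σ⁻¹ X 0 1 : ℝ) / (2 * Real.sqrt ((|Q N X| : ℚ) / N))

/-- `c₋ = Im (σm⁻¹ σp (r + i c))`, where `r` is the real part of the geodesic at `ℓ_X`. -/
def cMinus (N : ℕ) (X : Matrix (Fin 2) (Fin 2) ℚ) (σp σm : SL(2, ℤ)) (c : ℝ) : ℝ :=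
  ((σm⁻¹ * σp) • UpperHalfPlane.ofComplex (realPart N X σp + c * Complex.I)).im

/-- The width of the cusp `σ ∞` of `Γ`: the least `n ≥ 1` such that `σ (1, n; 0, 1) σ⁻¹` lies in
`Γ` up to sign. -/
def cuspWidth (Γ : Subgroup SL(2, ℤ)) (σ : SL(2, ℤ)) : ℕ :=
  sInf {n : ℕ | 0 < n ∧ (σ * ModularGroup.T ^ n * σ⁻¹ ∈ Γ ∨ -(σ * ModularGroup.T ^ n * σ⁻¹) ∈ Γ)}

/-! ### Regularized cycle integrals -/

/-- `T^{-k} / k` for `k > 0`, and `-log T` for `k = 0`. -/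
def constGrowth (k : ℕ) (T : ℝ) : ℝ := if k = 0 then -Real.log T else (T ^ k)⁻¹ / k

/-- The contribution of the cusp `σ ∞` to the regularized cycle integral, where `r` is the real
part of the geodesic. -/
def regHalf (Γ : Subgroup SL(2, ℤ)) (k : ℕ) (G : ℍ → ℂ) (σ : SL(2, ℤ)) (r c T : ℝ) : ℂ :=
  let α : ℕ := cuspWidth Γ σ
  let Gσ : ℍ → ℂ := G ∣[(2 * k + 2 : ℤ)] σ
  let a : ℤ → ℂ := (fourierCoeffs k α Gσ).1
  let b : ℤ → ℂ := (fourierCoeffs k α Gσ).2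
  let w : ℤ → ℝ := fun n => 2 * Real.pi * (n / α)
  (∫ y in c..T, ext Gσ (r + y * Complex.I) * (y : ℂ) ^ k)
    - a 0 * (T ^ (k + 1) / (k + 1) : ℝ)
    + (∑' n : {n : ℤ // n ≠ 0}, a n * e (n / α * r) *
        (incGamma (k + 1) (w n * T) / w n ^ (k + 1) : ℝ))
    + b 0 * constGrowth k T
    + ∑' n : {n : ℤ // n ≠ 0}, b n * e (n / α * r) *
        (calE (2 * k + 2) (2 * (w n * T)) * (incGamma (k + 1) (w n * T) / w n ^ (k + 1))
          - k.factorial / (2 ^ (2 * k + 1) * w n ^ (k + 1)) *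
            ∑ j ∈ Finset.range (k + 1),
              (-1) ^ j / j.factorial * calE (2 * k + 2 - j) (w n * T) : ℝ)

/-- The factor `(2 √(|m| N) i)^k i`, where `m = Q(X)`. -/
def normFactor (N k : ℕ) (X : Matrix (Fin 2) (Fin 2) ℚ) : ℂ :=
  (2 * Real.sqrt ((|Q N X| : ℚ) * N) * Complex.I) ^ k * Complex.I

/-- The regularized cycle integral `∫_{c(X)}^{reg} G(z) Q_X(z)^k dz`, defined with auxiliary
positive numbers `c`, `Tp`, `Tm`. -/
def regCycleIntegral (N : ℕ) (Γ : Subgroup SL(2, ℤ)) (k : ℕ) (G : ℍ → ℂ)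
    (X : Matrix (Fin 2) (Fin 2) ℚ) (σp σm : SL(2, ℤ)) (c Tp Tm : ℝ) : ℂ :=
  normFactor N k X *
    (regHalf Γ k G σp (realPart N X σp) c Tp
      + (-1) ^ (k + 1) *
        regHalf Γ k G σm (realPart N (-X) σm) (cMinus N X σp σm c) Tm)

/-- The line integral `∫_{it}^{it+1} f(z) dz` over a horizontal segment. -/
def segInt (t : ℝ) (f : ℂ → ℂ) : ℂ := ∫ x in (0 : ℝ)..1, f (x + t * Complex.I)

/-- The contribution of the cusp `σ ∞` to the alternative formula for the regularized cycle
integral, where `r` is the real part of the geodesic. -/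
def altHalf (Γ : Subgroup SL(2, ℤ)) (k : ℕ) (G : ℍ → ℂ) (σ : SL(2, ℤ)) (r c T : ℝ) : ℂ :=
  let α : ℕ := cuspWidth Γ σ
  let Gσ : ℍ → ℂ := G ∣[(2 * k + 2 : ℤ)] σ
  let b₀ : ℂ := (fourierCoeffs k α Gσ).2 0
  let ξG : ℍ → ℂ := xi (2 * k + 2) Gσ
  let ξa₀ : ℂ := constCoeff α ((xi (2 * k + 2) G) ∣[(-(2 * k) : ℤ)] σ)
  (∫ y in c..T, ext Gσ (r + y * Complex.I) * (y : ℂ) ^ k)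
    + (-1) ^ k * ((Complex.I * α) ^ (k + 1) / (k + 1)) *
        segInt (T / α) (fun z =>
          (ext Gσ (r + α * z) - b₀ * (((α * z.im) ^ (2 * k + 1))⁻¹ : ℝ)) * bernoulliPoly (k + 1) z)
    - (-1) ^ k * ((Complex.I * α) ^ k)⁻¹ *
        ((2 : ℂ) ^ (2 * (k : ℤ) - 1) * k.factorial / (2 * k + 1).factorial) *
        (starRingEnd ℂ) (segInt (T / α) (fun z =>
          (ext ξG (r + α * z) - ξa₀) * (polygamma k z + (-1) ^ k * polygamma k (1 - z))))
    - (-1) ^ k * ((Complex.I * α) ^ k)⁻¹ * ((k.factorial : ℂ) / (2 * k + 1).factorial) *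
        ∑ d ∈ Finset.range (k + 1), ((d + k).factorial : ℂ) / (d + 1).factorial *
          (∑ j ∈ Finset.range (k - d + 1), ((2 * k + 1).choose j : ℂ)) *
          (starRingEnd ℂ) (segInt (T / α) (fun z =>
            (ext ξG (r + α * z) - ξa₀) * bernoulliPoly (d + 1) z.re *
              ((-Complex.I * z.im) ^ (k + d + 1))⁻¹))
    + b₀ * constGrowth k T

end ShintaniCycle

end

/-!
Write `H = G ∣ σ` and insert its Fourier expansion into the segment integrals of `altHalf`. The
integrals against Bernoulli polynomials give incomplete Gamma functions. By periodicity of `e(nz)`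
and the functional equation of `ψ`, the derivative in `t` of the integral of
`e(nz) (ψ⁽ᵏ⁾(z) + (-1)ᵏ ψ⁽ᵏ⁾(1 - z))` over the segment at height `t` is a boundary difference, an
elementary function of `nt`, so the integral is an exponential integral up to a constant. For
`n < 0` the constant vanishes by letting `t → ∞`; for `n > 0` it is found by comparing with `-n` as
`t → 0`, using the symmetry `z ↦ 1 - z`. Integration by parts in `k` then identifies `altHalf` at
`T` with `regHalf` at `T`, term by term.

The Fourier expansion itself comes from a first order differential equation for the Fourier
coefficients of `H` in terms of those of the holomorphic function `ξ H`, the growth condition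
bounding the frequencies on both sides. Differentiating term by term shows that `regHalf` does not
depend on `T`.
-/

namespace ShintaniCycle

open MeasureTheory Filter Set

/-! ### Special functions of a real variable -/

theorem continuous_dslope {𝕜 E : Type*} [NontriviallyNormedField 𝕜] [NormedAddCommGroup E]
    [NormedSpace 𝕜 E] {f : 𝕜 → E} (hf : Differentiable 𝕜 f) (a : 𝕜) : Continuous (dslope f a) :=
  continuousOn_univ.1 <|
    (continuousOn_dslope univ_mem).2 ⟨hf.continuous.continuousOn, hf a⟩

theorem hasDerivAt_integral_Ioi {E : Type*} [NormedAddCommGroup E] [NormedSpace ℝ E]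
    [CompleteSpace E] {f : ℝ → E} {a b : ℝ} (hab : a < b) (hf : ContinuousOn f (Ioi a))
    (hint : IntegrableOn f (Ioi a)) : HasDerivAt (fun x => ∫ t in Ioi x, f t) (-f b) b := by
  obtain ⟨c, hac, hcb⟩ := exists_between hab
  have hintc : IntegrableOn f (Ioi c) := hint.mono_set (Ioi_subset_Ioi hac.le)
  have hprim : HasDerivAt (fun x => ∫ t in c..x, f t) (f b) b := by
    refine intervalIntegral.integral_hasDerivAt_right (ContinuousOn.intervalIntegrable ?_)
      (hf.stronglyMeasurableAtFilter isOpen_Ioi b hab) (hf.continuousAt (Ioi_mem_nhds hab))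
    rw [uIcc_of_le hcb.le]
    exact hf.mono fun t ht => hac.trans_le ht.1
  refine (hprim.const_sub (∫ t in Ioi c, f t)).congr_of_eventuallyEq ?_
  filter_upwards [Ioi_mem_nhds hcb] with x hx
  rw [eq_sub_iff_add_eq', intervalIntegral.integral_interval_add_Ioi hintc
    (hintc.mono_set (Ioi_subset_Ioi (le_of_lt hx)))]

theorem nonneg_of_hasDerivAt_nonneg_of_tendsto_atBot {f f' : ℝ → ℝ} {y : ℝ}
    (hf : ∀ x ≤ y, HasDerivAt f (f' x) x) (hf' : ∀ x ≤ y, 0 ≤ f' x)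
    (hlim : Tendsto f atBot (𝓝 0)) : 0 ≤ f y := by
  have hmono : MonotoneOn f (Iic y) := monotoneOn_of_hasDerivWithinAt_nonneg (convex_Iic y)
    (fun x hx => (hf x hx).continuousAt.continuousWithinAt)
    (fun x hx => (hf x (interior_subset (s := Iic y) hx)).hasDerivWithinAt)
    (fun x hx => hf' x (interior_subset (s := Iic y) hx))
  exact le_of_tendsto hlim ((eventually_le_atBot y).mono fun x hx => hmono hx self_mem_Iic hx)

theorem continuousOn_exp_neg_div {s : Set ℝ} (hs : ∀ t ∈ s, t ≠ 0) :
    ContinuousOn (fun t : ℝ => Real.exp (-t) / t) s :=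
  ContinuousOn.div (by fun_prop) continuousOn_id hs

theorem integrableOn_exp_neg_div {a : ℝ} (ha : 0 < a) :
    IntegrableOn (fun t : ℝ => Real.exp (-t) / t) (Ioi a) := by
  refine ((integrableOn_exp_neg_Ioi a).const_mul a⁻¹).mono'
    ((continuousOn_exp_neg_div fun t ht => (ha.trans ht).ne').aestronglyMeasurable
      measurableSet_Ioi) <| (ae_restrict_iff' measurableSet_Ioi).2 (.of_forall fun t ht => ?_)
  have ht0 : 0 < t := ha.trans ht
  rw [Real.norm_of_nonneg (by positivity), div_eq_inv_mul]
  gcongr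
  exact le_of_lt ht

theorem expInt_of_neg {y : ℝ} (hy : y < 0) :
    expInt y = -∫ t in Ioi (-y), Real.exp (-t) / t := by
  refine Tendsto.limUnder_eq (tendsto_const_nhds.congr' ?_)
  filter_upwards [mem_nhdsWithin_of_mem_nhds (Iio_mem_nhds (neg_pos.2 hy))] with ε hε
  congr 3
  ext t
  exact ⟨fun ht => ⟨ht, hε.trans (ht.trans_le (le_abs_self t))⟩, fun ht => ht.1⟩

/-- The function `2 sinh s / s`, extended continuously to `s = 0`. It is the even part of the
integrand of the exponential integral, the only part which survives in the principal value. -/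
noncomputable def twoSinhc : ℝ → ℝ := dslope (fun s => Real.exp s - Real.exp (-s)) 0

theorem continuous_twoSinhc : Continuous twoSinhc :=
  continuous_dslope (by fun_prop) 0

theorem twoSinhc_of_ne {s : ℝ} (hs : s ≠ 0) :
    twoSinhc s = Real.exp s / s - Real.exp (-s) / s := by
  simp [twoSinhc, dslope_of_ne _ hs, slope_def_field, sub_div]

theorem setOf_neg_lt_and_lt_abs {ε y : ℝ} (hε : 0 < ε) (hy : 0 < y) :
    {t : ℝ | -y < t ∧ ε < |t|} = Ioo (-y) (-ε) ∪ Ioi ε := by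
  ext t
  simp only [mem_ofPred_eq, mem_union, mem_Ioo, mem_Ioi, lt_abs]
  constructor
  · rintro ⟨hyt, hεt | hεt⟩
    · exact Or.inr hεt
    · exact Or.inl ⟨hyt, by linarith⟩
  · rintro (⟨hyt, htε⟩ | hεt)
    · exact ⟨hyt, Or.inr (by linarith)⟩
    · exact ⟨by linarith, Or.inl hεt⟩

theorem integral_twoSinhc {ε y : ℝ} (hε : 0 < ε) (hεy : ε < y) :
    ∫ s in ε..y, twoSinhc s =
      -(∫ t in -y..-ε, Real.exp (-t) / t) - ∫ t in ε..y, Real.exp (-t) / t := by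
  have hne : ∀ s ∈ uIcc ε y, s ≠ 0 := fun s hs => by
    rw [uIcc_of_le hεy.le] at hs
    exact (hε.trans_le hs.1).ne'
  have hexp : ContinuousOn (fun s : ℝ => Real.exp s / s) (uIcc ε y) :=
    ContinuousOn.div (by fun_prop) continuousOn_id hne
  rw [← intervalIntegral.integral_comp_neg fun t => Real.exp (-t) / t,
    intervalIntegral.integral_congr fun s hs => twoSinhc_of_ne (hne s hs),
    intervalIntegral.integral_sub hexp.intervalIntegrable
      (continuousOn_exp_neg_div hne).intervalIntegrable]
  simp only [neg_neg, div_neg, intervalIntegral.integral_neg]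

theorem neg_integral_truncated_exp_neg_div {ε y : ℝ} (hε : 0 < ε) (hεy : ε < y) :
    -∫ t in {t : ℝ | -y < t ∧ ε < |t|}, Real.exp (-t) / t =
      expInt (-y) + ∫ s in ε..y, twoSinhc s := by
  have hy : 0 < y := hε.trans hεy
  have hleft : IntegrableOn (fun t : ℝ => Real.exp (-t) / t) (Ioo (-y) (-ε)) :=
    (continuousOn_exp_neg_div fun t ht => by linarith [ht.2]).integrableOn_Icc.mono_set
      Ioo_subset_Icc_self
  have hdisj : Disjoint (Ioo (-y) (-ε)) (Ioi ε) :=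
    Set.disjoint_left.2 fun t ht htε => by linarith [ht.2, mem_Ioi.1 htε]
  rw [setOf_neg_lt_and_lt_abs hε hy, setIntegral_union hdisj measurableSet_Ioi hleft
      (integrableOn_exp_neg_div hε), ← integral_Ioc_eq_integral_Ioo,
    ← intervalIntegral.integral_of_le (by linarith), integral_twoSinhc hε hεy,
    expInt_of_neg (neg_neg_of_pos hy), neg_neg,
    ← intervalIntegral.integral_interval_add_Ioi (integrableOn_exp_neg_div hε)
      (integrableOn_exp_neg_div hy)]
  ring

theorem expInt_of_pos {y : ℝ} (hy : 0 < y) :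
    expInt y = expInt (-y) + ∫ s in (0 : ℝ)..y, twoSinhc s := by
  have hcont : Continuous fun ε : ℝ => expInt (-y) + ∫ s in ε..y, twoSinhc s := by
    simp only [intervalIntegral.integral_symm y]
    exact continuous_const.add (intervalIntegral.continuous_primitive
      (fun a b => continuous_twoSinhc.intervalIntegrable a b) y).neg
  refine Tendsto.limUnder_eq (((hcont.tendsto 0).mono_left nhdsWithin_le_nhds).congr' ?_)
  filter_upwards [mem_nhdsWithin_of_mem_nhds (Iio_mem_nhds hy), self_mem_nhdsWithin]
    with ε hεy hε using (neg_integral_truncated_exp_neg_div hε hεy).symm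

theorem hasDerivAt_expInt_of_neg {y : ℝ} (hy : y < 0) :
    HasDerivAt expInt (Real.exp y / y) y := by
  have hy2 : 0 < -y / 2 := by linarith
  have htail := hasDerivAt_integral_Ioi (show -y / 2 < -y by linarith)
    (continuousOn_exp_neg_div fun t ht => (hy2.trans ht).ne') (integrableOn_exp_neg_div hy2)
  refine ((htail.scomp y (hasDerivAt_neg y)).neg.congr_deriv ?_).congr_of_eventuallyEq ?_
  · simp [div_neg]
  · filter_upwards [Iio_mem_nhds hy] with x hx using expInt_of_neg hx

theorem hasDerivAt_expInt {y : ℝ} (hy : y ≠ 0) : HasDerivAt expInt (Real.exp y / y) y := by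
  rcases hy.lt_or_gt with hneg | hpos
  · exact hasDerivAt_expInt_of_neg hneg
  · have hsum := ((hasDerivAt_expInt_of_neg (neg_neg_of_pos hpos)).scomp y (hasDerivAt_neg y)).add
      (continuous_twoSinhc.integral_hasStrictDerivAt 0 y).hasDerivAt
    refine (hsum.congr_deriv ?_).congr_of_eventuallyEq ?_
    · simp [twoSinhc_of_ne hy, div_neg]
    · filter_upwards [Ioi_mem_nhds hpos] with x hx using expInt_of_pos hx

theorem tendsto_expInt_atBot : Tendsto expInt atBot (𝓝 0) := by
  refine squeeze_zero_norm' ?_ Real.tendsto_exp_atBot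
  filter_upwards [Iic_mem_atBot (-1 : ℝ)] with y (hy : y ≤ -1)
  rw [expInt_of_neg (by linarith), norm_neg,
    show Real.exp y = ∫ t in Ioi (-y), Real.exp (-t) by rw [integral_exp_neg_Ioi, neg_neg]]
  refine norm_integral_le_of_norm_le (integrableOn_exp_neg_Ioi _)
    ((ae_restrict_iff' measurableSet_Ioi).2 (.of_forall fun t (ht : -y < t) => ?_))
  have ht1 : 1 ≤ t := by linarith
  rw [Real.norm_of_nonneg (by positivity)]
  exact div_le_self (Real.exp_pos _).le ht1

theorem tendsto_expInt_sub_expInt_neg :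
    Tendsto (fun y => expInt y - expInt (-y)) (𝓝[>] 0) (𝓝 0) := by
  have hprim : Tendsto (fun y : ℝ => ∫ s in (0 : ℝ)..y, twoSinhc s) (𝓝[>] 0) (𝓝 0) := by
    have hcont := intervalIntegral.continuous_primitive (μ := volume)
      (fun a b => continuous_twoSinhc.intervalIntegrable a b) 0
    simpa only [intervalIntegral.integral_same] using
      (hcont.tendsto 0).mono_left nhdsWithin_le_nhds
  refine hprim.congr' ?_
  filter_upwards [self_mem_nhdsWithin] with y hy
  rw [expInt_of_pos hy, add_sub_cancel_left]

theorem hasDerivAt_exp_mul_sum_inv_pow (n : ℕ) {y : ℝ} (hy : y ≠ 0) :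
    HasDerivAt (fun y => Real.exp y * ∑ j ∈ Finset.range n, (y ^ (j + 1))⁻¹ * j.factorial)
      (Real.exp y / y - Real.exp y * n.factorial * (y ^ (n + 1))⁻¹) y := by
  induction n with
  | zero =>
    simp only [Finset.range_zero, Finset.sum_empty, mul_zero]
    exact (hasDerivAt_const y (0 : ℝ)).congr_deriv (by simp [div_eq_mul_inv])
  | succ n ih =>
    simp only [Finset.sum_range_succ, mul_add]
    refine (ih.add ((Real.hasDerivAt_exp y).mul (((hasDerivAt_pow (n + 1) y).inv
      (pow_ne_zero _ hy)).mul_const (n.factorial : ℝ)))).congr_deriv ?_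
    rw [Nat.factorial_succ]
    push_cast [Pi.inv_apply]
    field_simp
    ring

theorem hasDerivAt_calE {κ : ℕ} (hκ : 1 ≤ κ) {y : ℝ} (hy : y ≠ 0) :
    HasDerivAt (calE κ) (Real.exp y / (-y) ^ κ) y := by
  obtain ⟨n, rfl⟩ : ∃ n, κ = n + 1 := ⟨κ - 1, by omega⟩
  refine (((hasDerivAt_exp_mul_sum_inv_pow n hy).sub (hasDerivAt_expInt hy)).const_mul
    ((-1 : ℝ) ^ (n + 1 + 1) / n.factorial)).congr_deriv ?_
  have hsign : ((-1 : ℝ) ^ n) ^ 2 = 1 := by rw [← pow_mul, mul_comm, pow_mul]; norm_num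
  rw [neg_pow y]
  field_simp
  linear_combination y * n.factorial * hsign

theorem tendsto_exp_mul_inv_pow_atBot {j : ℕ} (hj : j ≠ 0) :
    Tendsto (fun y : ℝ => Real.exp y * (y ^ j)⁻¹) atBot (𝓝 0) := by
  simpa [hj] using Real.tendsto_exp_atBot.mul (tendsto_inv_atBot_zero.pow j)

theorem tendsto_calE_atBot (κ : ℕ) : Tendsto (calE κ) atBot (𝓝 0) := by
  have hsum : Tendsto (fun y : ℝ => Real.exp y * ∑ j ∈ Finset.range (κ - 1),
      (y ^ (j + 1))⁻¹ * (j.factorial : ℝ)) atBot (𝓝 0) := by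
    simp only [Finset.mul_sum, ← mul_assoc]
    simpa using tendsto_finsetSum (Finset.range (κ - 1)) fun j _ =>
      (tendsto_exp_mul_inv_pow_atBot j.succ_ne_zero).mul_const (j.factorial : ℝ)
  have hdiff := (hsum.sub tendsto_expInt_atBot).const_mul ((-1 : ℝ) ^ (κ + 1) / (κ - 1).factorial)
  rwa [sub_zero, mul_zero] at hdiff

theorem calE_nonneg_of_neg {κ : ℕ} (hκ : 1 ≤ κ) {y : ℝ} (hy : y < 0) : 0 ≤ calE κ y :=
  nonneg_of_hasDerivAt_nonneg_of_tendsto_atBot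
    (fun _ hx => hasDerivAt_calE hκ (hx.trans_lt hy).ne)
    (fun x hx => div_nonneg (Real.exp_pos x).le (pow_nonneg (by linarith) κ))
    (tendsto_calE_atBot κ)

theorem calE_le_of_neg {κ : ℕ} (hκ : 1 ≤ κ) {y : ℝ} (hy : y < 0) :
    calE κ y ≤ Real.exp y / (-y) ^ κ := by
  rw [← sub_nonneg]
  refine nonneg_of_hasDerivAt_nonneg_of_tendsto_atBot
    (f := fun x => Real.exp x / (-x) ^ κ - calE κ x)
    (f' := fun x => κ * Real.exp x / (-x) ^ (κ + 1)) (fun x hx => ?_) (fun x hx => ?_) ?_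
  · have hx0 : -x ≠ 0 := by linarith
    have hpow : HasDerivAt (fun x : ℝ => (-x) ^ κ) (κ * (-x) ^ (κ - 1) * -1) x :=
      (hasDerivAt_neg x).pow κ
    refine (((Real.hasDerivAt_exp x).div hpow (pow_ne_zero _ hx0)).sub
      (hasDerivAt_calE hκ (neg_ne_zero.1 hx0))).congr_deriv ?_
    obtain ⟨n, rfl⟩ : ∃ n, κ = n + 1 := ⟨κ - 1, by omega⟩
    generalize -x = u at hx0 ⊢
    rw [Nat.add_sub_cancel]
    field_simp
    ring
  · have hx0 : 0 < -x := by linarith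
    positivity
  · have hpow : Tendsto (fun x : ℝ => (-x) ^ κ) atBot atTop :=
      (tendsto_pow_atTop (by omega)).comp tendsto_neg_atBot_atTop
    simpa using (Real.tendsto_exp_atBot.div_atTop hpow).sub (tendsto_calE_atBot κ)

theorem exp_sub_exp_one_div_pow_le_calE_sub {κ : ℕ} (hκ : 1 ≤ κ) {y : ℝ} (hy : 1 ≤ y) :
    (Real.exp y - Real.exp 1) / y ^ κ ≤ (-1) ^ κ * (calE κ y - calE κ 1) := by
  have hderiv : ∀ t ∈ Icc 1 y, HasDerivAt
      (fun t => (-1) ^ κ * calE κ t - Real.exp t / y ^ κ)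
      (Real.exp t / t ^ κ - Real.exp t / y ^ κ) t := fun t ht => by
    have ht0 : t ≠ 0 := by linarith [ht.1]
    refine (((hasDerivAt_calE hκ ht0).const_mul _).sub
      ((Real.hasDerivAt_exp t).div_const _)).congr_deriv ?_
    rw [neg_pow t, div_mul_eq_div_div_swap, mul_div_cancel₀ _ (by simp)]
  have hmono : MonotoneOn (fun t => (-1) ^ κ * calE κ t - Real.exp t / y ^ κ) (Icc 1 y) := by
    refine monotoneOn_of_hasDerivWithinAt_nonneg (convex_Icc 1 y)
      (fun t ht => (hderiv t ht).continuousAt.continuousWithinAt)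
      (fun t ht => (hderiv t (interior_subset ht)).hasDerivWithinAt) fun t ht => sub_nonneg.2 ?_
    have ht1 := interior_subset ht
    have ht0 : 0 < t := by linarith [ht1.1]
    gcongr
    exact ht1.2
  have hle := hmono (left_mem_Icc.2 hy) (right_mem_Icc.2 hy) hy
  rw [sub_div, mul_sub]
  linarith

theorem exp_div_pow_isBigO_calE {κ : ℕ} (hκ : 1 ≤ κ) :
    (fun y : ℝ => Real.exp y / y ^ κ) =O[atTop] calE κ := by
  refine Asymptotics.IsBigO.of_bound 2 ?_
  filter_upwards [eventually_ge_atTop 1, (Real.tendsto_exp_div_pow_atTop κ).eventually_ge_atTop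
    (2 * (Real.exp 1 + ‖calE κ 1‖))] with y hy hlarge
  have hlower := (exp_sub_exp_one_div_pow_le_calE_sub hκ hy).trans (Real.le_norm_self _)
  rw [norm_mul, norm_pow, norm_neg, norm_one, one_pow, one_mul, sub_div] at hlower
  have hone : Real.exp 1 / y ^ κ ≤ Real.exp 1 :=
    div_le_self (Real.exp_pos 1).le (one_le_pow₀ hy)
  rw [Real.norm_of_nonneg (by positivity)]
  linarith [norm_sub_le (calE κ y) (calE κ 1)]

theorem exp_mul_isLittleO_calE {κ : ℕ} (hκ : 1 ≤ κ) {δ : ℝ} (hδ : δ < 1) :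
    (fun y : ℝ => Real.exp (δ * y)) =o[atTop] calE κ := by
  refine Asymptotics.IsLittleO.trans_isBigO ?_ (exp_div_pow_isBigO_calE hκ)
  refine ((isLittleO_pow_exp_pos_mul_atTop κ (sub_pos.2 hδ)).mul_isBigO
    (Asymptotics.isBigO_refl (fun y : ℝ => Real.exp (δ * y) / y ^ κ) atTop)).congr' ?_ ?_
  · filter_upwards [eventually_ne_atTop 0] with y hy using mul_div_cancel₀ _ (pow_ne_zero κ hy)
  · filter_upwards with y
    rw [mul_div_assoc', ← Real.exp_add]
    ring_nf

theorem hasDerivAt_exp_neg_mul_sum (s : ℕ) (t : ℝ) :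
    HasDerivAt (fun t : ℝ => Real.exp (-t) * ∑ j ∈ Finset.range (s + 1), t ^ j / j.factorial)
      (-(Real.exp (-t) * t ^ s / s.factorial)) t := by
  have hexp : HasDerivAt (fun t : ℝ => Real.exp (-t)) (-Real.exp (-t)) t := by
    simpa using (hasDerivAt_neg t).exp
  induction s with
  | zero => simpa using hexp
  | succ s ih =>
    simp only [Finset.sum_range_succ _ (s + 1), mul_add]
    refine (ih.add (hexp.mul ((hasDerivAt_pow (s + 1) t).div_const _))).congr_deriv ?_
    rw [Nat.factorial_succ]
    push_cast
    field_simp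
    ring

theorem integrableOn_exp_neg_mul_pow (s : ℕ) (y : ℝ) :
    IntegrableOn (fun t : ℝ => Real.exp (-t) * t ^ s) (Ioi y) := by
  refine integrable_of_isBigO_exp_neg (b := 1 / 2) (by norm_num) (by fun_prop) ?_
  refine ((Asymptotics.isBigO_refl (fun t : ℝ => Real.exp (-t)) atTop).mul
    (isLittleO_pow_exp_pos_mul_atTop s one_half_pos).isBigO).congr_right fun t => ?_
  rw [← Real.exp_add]
  ring_nf

theorem tendsto_exp_neg_mul_sum_atTop (s : ℕ) :
    Tendsto (fun t : ℝ => Real.exp (-t) * ∑ j ∈ Finset.range s, t ^ j / j.factorial)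
      atTop (𝓝 0) := by
  simp only [Finset.mul_sum]
  rw [← Finset.sum_const_zero (s := Finset.range s)]
  refine tendsto_finsetSum _ fun j _ => ?_
  rw [← zero_div (j.factorial : ℝ)]
  refine ((Real.tendsto_pow_mul_exp_neg_atTop_nhds_zero j).div_const _).congr fun t => ?_
  rw [mul_comm, mul_div_assoc]

theorem incGamma_succ_eq (s : ℕ) (y : ℝ) : incGamma (s + 1) y =
    s.factorial * (Real.exp (-y) * ∑ j ∈ Finset.range (s + 1), y ^ j / j.factorial) := by
  have hprim : ∀ t : ℝ, HasDerivAt (fun t : ℝ => -(s.factorial *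
      (Real.exp (-t) * ∑ j ∈ Finset.range (s + 1), t ^ j / j.factorial)))
      (Real.exp (-t) * t ^ s) t := fun t =>
    ((hasDerivAt_exp_neg_mul_sum s t).const_mul (s.factorial : ℝ)).neg.congr_deriv
      (by field_simp)
  have hlim := ((tendsto_exp_neg_mul_sum_atTop (s + 1)).const_mul (s.factorial : ℝ)).neg
  rw [incGamma, Nat.add_sub_cancel, integral_Ioi_of_hasDerivAt_of_tendsto
    (hprim y).continuousAt.continuousWithinAt (fun t _ => hprim t)
    (integrableOn_exp_neg_mul_pow s y) hlim]
  ring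

theorem hasDerivAt_incGamma (s : ℕ) (y : ℝ) :
    HasDerivAt (incGamma s) (-(Real.exp (-y) * y ^ (s - 1))) y :=
  hasDerivAt_integral_Ioi (sub_one_lt y) (by fun_prop) (integrableOn_exp_neg_mul_pow (s - 1) _)

/-! ### The polygamma functions -/

theorem ne_neg_natCast_of_im_ne_zero {z : ℂ} (hz : z.im ≠ 0) (m : ℕ) : z ≠ -m := by
  rintro rfl
  simp at hz

theorem ne_neg_natCast_of_re_pos {z : ℂ} (hz : 0 < z.re) (m : ℕ) : z ≠ -m := by
  rintro rfl
  simp only [Complex.neg_re, Complex.natCast_re] at hz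
  linarith [m.cast_nonneg (α := ℝ)]

theorem eventually_ne_neg_natCast {z : ℂ} (hz : ∀ m : ℕ, z ≠ -m) :
    ∀ᶠ w : ℂ in 𝓝 z, ∀ m : ℕ, w ≠ -m := by
  filter_upwards [Complex.differentiable_one_div_Gamma.continuous.continuousAt.eventually_ne
    (inv_ne_zero (Complex.Gamma_ne_zero hz))] with w hw m hm
  exact hw (by rw [hm, Complex.Gamma_neg_nat_eq_zero, inv_zero])

theorem analyticAt_digamma {z : ℂ} (hz : ∀ m : ℕ, z ≠ -m) :
    AnalyticAt ℂ Complex.digamma z := by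
  have hΓ : AnalyticAt ℂ Complex.Gamma z :=
    ((Complex.differentiable_one_div_Gamma.analyticAt z).inv
      (inv_ne_zero (Complex.Gamma_ne_zero hz))).congr (.of_forall fun w => inv_inv _)
  exact hΓ.deriv.div hΓ (Complex.Gamma_ne_zero hz)

theorem analyticAt_polygamma (k : ℕ) {z : ℂ} (hz : ∀ m : ℕ, z ≠ -m) :
    AnalyticAt ℂ (polygamma k) z :=
  ((analyticAt_digamma hz).iterated_deriv k).congr
    (.of_forall fun w => by rw [← iteratedDeriv_eq_iterate, polygamma])

theorem hasDerivAt_polygamma (k : ℕ) {z : ℂ} (hz : ∀ m : ℕ, z ≠ -m) :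
    HasDerivAt (polygamma k) (polygamma (k + 1) z) z := by
  have hsucc : deriv (polygamma k) z = polygamma (k + 1) z :=
    (congrFun iteratedDeriv_succ z).symm
  exact hsucc ▸ (analyticAt_polygamma k hz).differentiableAt.hasDerivAt

theorem polygamma_zero : polygamma 0 = Complex.digamma := by
  funext z
  rw [polygamma, iteratedDeriv_zero]

theorem polygamma_add_one (k : ℕ) {z : ℂ} (hz : ∀ m : ℕ, z ≠ -m) :
    polygamma k (z + 1) = polygamma k z + (-1) ^ k * k.factorial * (z ^ (k + 1))⁻¹ := by
  induction k generalizing z with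
  | zero =>
    rw [polygamma_zero, Complex.digamma_apply_add_one z hz]
    simp
  | succ k ih =>
    have hz0 : z ≠ 0 := by simpa using hz 0
    have hz1 : ∀ m : ℕ, z + 1 ≠ -m := fun m hm => hz (m + 1) (by
      push_cast
      linear_combination hm)
    have hpow : HasDerivAt (fun z : ℂ => (z ^ (k + 1))⁻¹)
        (-((k + 1 : ℕ) * z ^ k) / (z ^ (k + 1)) ^ 2) z :=
      (hasDerivAt_pow (k + 1) z).inv (pow_ne_zero _ hz0)
    have hright := ((hasDerivAt_polygamma k hz).add
      (hpow.const_mul ((-1 : ℂ) ^ k * k.factorial))).congr_of_eventuallyEq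
        ((eventually_ne_neg_natCast hz).mono fun w hw => ih hw)
    rw [((hasDerivAt_polygamma k hz1).comp_add_const z 1).unique hright, Nat.factorial_succ]
    push_cast
    field_simp
    ring

/-- The function `ψ^{(k)}(z) + (-1)^k ψ^{(k)}(1 - z)`, whose Fourier coefficients are exponential
integrals. -/
noncomputable def symPolygamma (k : ℕ) (z : ℂ) : ℂ :=
  polygamma k z + (-1) ^ k * polygamma k (1 - z)

theorem hasDerivAt_symPolygamma (k : ℕ) {z : ℂ} (hz : z.im ≠ 0) :
    HasDerivAt (symPolygamma k) (symPolygamma (k + 1) z) z := by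
  have hz' : (1 - z).im ≠ 0 := by simpa using hz
  have hreflected := (hasDerivAt_polygamma k (ne_neg_natCast_of_im_ne_zero hz')).comp_const_sub 1 z
  refine ((hasDerivAt_polygamma k (ne_neg_natCast_of_im_ne_zero hz)).add
    (hreflected.const_mul ((-1) ^ k))).congr_deriv ?_
  rw [symPolygamma]
  ring

theorem symPolygamma_add_one (k : ℕ) {z : ℂ} (hz : z.im ≠ 0) :
    symPolygamma k (z + 1) =
      symPolygamma k z + 2 * ((-1) ^ k * k.factorial * (z ^ (k + 1))⁻¹) := by
  have hz' : (-z).im ≠ 0 := by simpa using hz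
  have hreflected := polygamma_add_one k (ne_neg_natCast_of_im_ne_zero hz')
  rw [neg_add_eq_sub, neg_pow z (k + 1), mul_inv, ← inv_pow (-1 : ℂ), inv_neg,
    inv_one] at hreflected
  rw [symPolygamma, symPolygamma, polygamma_add_one k (ne_neg_natCast_of_im_ne_zero hz),
    sub_add_cancel_right, hreflected]
  have hsign : (-1 : ℂ) ^ k * (-1) ^ k = 1 := by rw [← mul_pow]; simp
  linear_combination ((-1 : ℂ) ^ k * k.factorial * (z ^ (k + 1))⁻¹) * hsign

theorem differentiableOn_symPolygamma (k : ℕ) :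
    DifferentiableOn ℂ (symPolygamma k) {z | 0 < z.im} := fun _ hz =>
  (hasDerivAt_symPolygamma k (ne_of_gt hz)).differentiableAt.differentiableWithinAt

theorem continuousOn_symPolygamma (k : ℕ) {t : ℝ} (ht : t ≠ 0) :
    ContinuousOn (symPolygamma k) {z | z.im = t} := fun _ hz =>
  (hasDerivAt_symPolygamma k (hz.trans_ne ht)).continuousAt.continuousWithinAt

theorem norm_Gamma_le {z : ℂ} (hz : 0 < z.re) : ‖Complex.Gamma z‖ ≤ Real.Gamma z.re := by
  rw [Complex.Gamma_eq_integral hz, Real.Gamma_eq_integral hz, Complex.GammaIntegral]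
  refine norm_integral_le_of_norm_le (Real.GammaIntegral_convergent hz)
    ((ae_restrict_iff' measurableSet_Ioi).2 (.of_forall fun x hx => ?_))
  rw [norm_mul, Complex.norm_cpow_eq_rpow_re_of_pos hx, Complex.norm_real,
    Real.norm_of_nonneg (Real.exp_pos _).le, Complex.sub_re, Complex.one_re]

theorem exists_norm_Gamma_le {a : ℝ} (ha : 0 < a) (b : ℝ) :
    ∃ M : ℝ, 0 < M ∧ ∀ z : ℂ, z.re ∈ Icc a b → ‖Complex.Gamma z‖ ≤ M := by
  have hcont : ContinuousOn Real.Gamma (Icc a b) := fun x hx =>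
    (Real.differentiableAt_Gamma fun m hm => by
      linarith [hx.1, m.cast_nonneg (α := ℝ)]).continuousAt.continuousWithinAt
  obtain ⟨M, hM⟩ := isCompact_Icc.exists_bound_of_continuousOn hcont
  refine ⟨max M 1, by positivity, fun z hz => ?_⟩
  exact (norm_Gamma_le (ha.trans_le hz.1)).trans
    (le_max_of_le_left ((le_abs_self _).trans (hM z.re hz)))

theorem exists_norm_deriv_Gamma_le {a : ℝ} (ha : 0 < a) (b : ℝ) :
    ∃ M : ℝ, 0 < M ∧ ∀ z : ℂ, z.re ∈ Icc a b → ‖deriv Complex.Gamma z‖ ≤ M := by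
  obtain ⟨M, hM0, hM⟩ := exists_norm_Gamma_le (half_pos ha) (b + a / 2)
  refine ⟨M / (a / 2), by positivity, fun z hz => ?_⟩
  have hre : ∀ w ∈ Metric.closedBall z (a / 2), w.re ∈ Icc (a / 2) (b + a / 2) := fun w hw => by
    have hdist := (Complex.abs_re_le_norm (w - z)).trans (mem_closedBall_iff_norm.1 hw)
    rw [Complex.sub_re, abs_le] at hdist
    constructor <;> linarith [hz.1, hz.2]
  refine Complex.norm_deriv_le_of_forall_mem_sphere_norm_le (half_pos ha) ?_ fun w hw =>
    hM w (hre w (Metric.sphere_subset_closedBall hw))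
  refine DifferentiableOn.diffContOnCl_ball (fun w hw => ?_) subset_rfl
  exact (Complex.differentiableAt_Gamma w (ne_neg_natCast_of_re_pos
    (by linarith [(hre w hw).1]))).differentiableWithinAt

theorem norm_Gamma_le_norm_Gamma_add_one {z : ℂ} (hz : 1 ≤ ‖z‖) :
    ‖Complex.Gamma z‖ ≤ ‖Complex.Gamma (z + 1)‖ := by
  rw [Complex.Gamma_add_one z (norm_pos_iff.1 (one_pos.trans_le hz)), norm_mul]
  exact le_mul_of_one_le_left (norm_nonneg _) hz

theorem norm_sin_le (z : ℂ) : ‖Complex.sin z‖ ≤ Real.exp |z.im| := by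
  have hneg : ‖Complex.exp (-z * Complex.I)‖ ≤ Real.exp |z.im| := by
    simp [Complex.norm_exp, le_abs_self]
  have hpos : ‖Complex.exp (z * Complex.I)‖ ≤ Real.exp |z.im| := by
    simp [Complex.norm_exp, neg_le_abs]
  rw [Complex.sin, norm_div, norm_mul, Complex.norm_I, mul_one, Complex.norm_two,
    div_le_iff₀ two_pos]
  linarith [norm_sub_le (Complex.exp (-z * Complex.I)) (Complex.exp (z * Complex.I))]

theorem inv_Gamma_eq_sin_mul_Gamma_one_sub {z : ℂ} (hz : ∀ m : ℕ, 1 - z ≠ -m) :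
    (Complex.Gamma z)⁻¹ = Complex.sin (Real.pi * z) * Complex.Gamma (1 - z) / Real.pi := by
  have hΓ : Complex.Gamma (1 - z) ≠ 0 := Complex.Gamma_ne_zero hz
  have hreflection := Complex.Gamma_mul_Gamma_one_sub z
  rw [← eq_div_iff hΓ] at hreflection
  rw [hreflection, div_div, inv_div, mul_comm]

theorem exists_norm_inv_Gamma_le :
    ∃ C : ℝ, 0 < C ∧ ∀ z : ℂ, z.re ∈ Icc 1 2 → 1 ≤ |z.im| →
      ‖(Complex.Gamma z)⁻¹‖ ≤ C * Real.exp (Real.pi * |z.im|) := by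
  obtain ⟨M, hM0, hM⟩ := exists_norm_Gamma_le one_pos 2
  refine ⟨M / Real.pi, by positivity, fun z hz him => ?_⟩
  have him0 : (1 - z).im ≠ 0 := by
    rw [Complex.sub_im, Complex.one_im, zero_sub, neg_ne_zero]
    exact abs_pos.1 (one_pos.trans_le him)
  have hnorm : ∀ w : ℂ, w.im = -z.im → 1 ≤ ‖w‖ := fun w hw =>
    him.trans (by rw [← abs_neg, ← hw]; exact Complex.abs_im_le_norm w)
  have hΓ : ‖Complex.Gamma (1 - z)‖ ≤ M := calc
    ‖Complex.Gamma (1 - z)‖ ≤ ‖Complex.Gamma (1 - z + 1)‖ :=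
      norm_Gamma_le_norm_Gamma_add_one (hnorm _ (by simp))
    _ ≤ ‖Complex.Gamma (1 - z + 1 + 1)‖ := norm_Gamma_le_norm_Gamma_add_one (hnorm _ (by simp))
    _ ≤ M := hM _ (by constructor <;> simp <;> linarith [hz.1, hz.2])
  have hsin : ‖Complex.sin (Real.pi * z)‖ ≤ Real.exp (Real.pi * |z.im|) := by
    refine (norm_sin_le _).trans_eq ?_
    rw [Complex.im_ofReal_mul, abs_mul, abs_of_pos Real.pi_pos]
  rw [inv_Gamma_eq_sin_mul_Gamma_one_sub (ne_neg_natCast_of_im_ne_zero him0), norm_div, norm_mul,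
    Complex.norm_real, Real.norm_of_nonneg Real.pi_pos.le, div_mul_eq_mul_div]
  rw [mul_comm M]
  gcongr

theorem exists_norm_digamma_le_of_one_le_re :
    ∃ C : ℝ, 0 < C ∧ ∀ z : ℂ, z.re ∈ Icc 1 2 → 1 ≤ |z.im| →
      ‖Complex.digamma z‖ ≤ C * Real.exp (Real.pi * |z.im|) := by
  obtain ⟨M, hM0, hM⟩ := exists_norm_deriv_Gamma_le one_pos 2
  obtain ⟨C, hC0, hC⟩ := exists_norm_inv_Gamma_le
  refine ⟨M * C, by positivity, fun z hz him => ?_⟩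
  rw [Complex.digamma_def, logDeriv_apply, div_eq_mul_inv, norm_mul, mul_assoc]
  exact mul_le_mul (hM z hz) (hC z hz him) (norm_nonneg _) hM0.le

theorem exists_norm_digamma_le :
    ∃ C : ℝ, 0 < C ∧ ∀ z : ℂ, z.re ∈ Icc 0 1 → 1 ≤ |z.im| →
      ‖Complex.digamma z‖ ≤ C * Real.exp (Real.pi * |z.im|) := by
  obtain ⟨C, hC0, hC⟩ := exists_norm_digamma_le_of_one_le_re
  refine ⟨C + 1, by positivity, fun z hz him => ?_⟩
  have hshift := Complex.digamma_apply_add_one z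
    (ne_neg_natCast_of_im_ne_zero (abs_pos.1 (one_pos.trans_le him)))
  have hadd : ‖Complex.digamma (z + 1)‖ ≤ C * Real.exp (Real.pi * |z.im|) := by
    have h := hC (z + 1) (by constructor <;> simp <;> linarith [hz.1, hz.2])
    simp only [Complex.add_im, Complex.one_im, add_zero] at h
    exact h him
  have hinv : ‖z⁻¹‖ ≤ Real.exp (Real.pi * |z.im|) := by
    rw [norm_inv]
    exact (inv_le_one_of_one_le₀ (him.trans (Complex.abs_im_le_norm z))).trans
      (Real.one_le_exp (by positivity))
  rw [eq_sub_of_add_eq hshift.symm, add_mul, one_mul]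
  exact (norm_sub_le _ _).trans (add_le_add hadd hinv)

theorem exists_norm_symPolygamma_zero_le :
    ∃ C : ℝ, 0 < C ∧ ∀ z : ℂ, z.re ∈ Icc 0 1 → 1 ≤ |z.im| →
      ‖symPolygamma 0 z‖ ≤ C * Real.exp (Real.pi * |z.im|) := by
  obtain ⟨C, hC0, hC⟩ := exists_norm_digamma_le
  refine ⟨2 * C, by positivity, fun z hz him => ?_⟩
  have hreflected := hC (1 - z) (by constructor <;> simp <;> linarith [hz.1, hz.2])
  simp only [Complex.sub_im, Complex.one_im, zero_sub, abs_neg] at hreflected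
  rw [symPolygamma, pow_zero, one_mul, polygamma_zero, two_mul, add_mul]
  exact (norm_add_le _ _).trans (add_le_add (hC z hz him) (hreflected him))

/-! ### Integrals over horizontal segments -/

theorem e_add (z w : ℂ) : e (z + w) = e z * e w := by
  rw [e, e, e, ← Complex.exp_add, mul_add]

theorem e_zero : e 0 = 1 := by rw [e, mul_zero, Complex.exp_zero]

theorem e_intCast (n : ℤ) : e n = 1 := by
  rw [e, mul_comm, Complex.exp_int_mul_two_pi_mul_I]

theorem e_add_intCast (z : ℂ) (n : ℤ) : e (z + n) = e z := by
  rw [e_add, e_intCast, mul_one]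

theorem norm_e (z : ℂ) : ‖e z‖ = Real.exp (-(2 * Real.pi * z.im)) := by
  rw [e, Complex.norm_exp]
  congr 1
  simp [Complex.mul_re, Complex.mul_im]

theorem continuous_e : Continuous e := by
  unfold e
  fun_prop

theorem hasDerivAt_e_mul (c z : ℂ) :
    HasDerivAt (fun z => e (c * z)) (2 * Real.pi * Complex.I * c * e (c * z)) z := by
  have h := (((hasDerivAt_id z).const_mul c).const_mul (2 * Real.pi * Complex.I)).cexp
  exact h.congr_deriv (by simp only [e, id_eq]; ring)

theorem conj_e (z : ℂ) : (starRingEnd ℂ) (e z) = e (-(starRingEnd ℂ) z) := by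
  rw [e, e, ← Complex.exp_conj]
  congr 1
  simp only [map_mul, Complex.conj_ofReal, Complex.conj_I, map_ofNat]
  ring

theorem e_mul_ofReal_mul_I (c y : ℝ) :
    e (c * (y * Complex.I)) = (Real.exp (-(2 * Real.pi * c * y)) : ℝ) := by
  rw [e, Complex.ofReal_exp]
  congr 1
  push_cast
  linear_combination (2 * Real.pi * c * y : ℂ) * Complex.I_mul_I

theorem re_ofReal_add_mul_I (x t : ℝ) : ((x : ℂ) + t * Complex.I).re = x := by simp

theorem im_ofReal_add_mul_I (x t : ℝ) : ((x : ℂ) + t * Complex.I).im = t := by simp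

theorem continuous_comp_horizontal {t : ℝ} {f : ℂ → ℂ} (hf : ContinuousOn f {z | z.im = t}) :
    Continuous fun x : ℝ => f (x + t * Complex.I) :=
  hf.comp_continuous (by fun_prop) fun x => im_ofReal_add_mul_I x t

theorem segInt_congr {t : ℝ} {f g : ℂ → ℂ} (h : ∀ z, z.im = t → f z = g z) :
    segInt t f = segInt t g :=
  intervalIntegral.integral_congr fun x _ => h _ (im_ofReal_add_mul_I x t)

theorem segInt_const_mul (t : ℝ) (c : ℂ) (f : ℂ → ℂ) :
    segInt t (fun z => c * f z) = c * segInt t f :=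
  intervalIntegral.integral_const_mul _ _

theorem segInt_add {t : ℝ} {f g : ℂ → ℂ} (hf : ContinuousOn f {z | z.im = t})
    (hg : ContinuousOn g {z | z.im = t}) :
    segInt t (fun z => f z + g z) = segInt t f + segInt t g :=
  intervalIntegral.integral_add ((continuous_comp_horizontal hf).intervalIntegrable _ _)
    ((continuous_comp_horizontal hg).intervalIntegrable _ _)

theorem segInt_sub {t : ℝ} {f g : ℂ → ℂ} (hf : ContinuousOn f {z | z.im = t})
    (hg : ContinuousOn g {z | z.im = t}) :
    segInt t (fun z => f z - g z) = segInt t f - segInt t g :=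
  intervalIntegral.integral_sub ((continuous_comp_horizontal hf).intervalIntegrable _ _)
    ((continuous_comp_horizontal hg).intervalIntegrable _ _)

theorem segInt_sub_segInt {s t : ℝ} (hs : 0 < s) (ht : 0 < t) {F : ℂ → ℂ}
    (hF : DifferentiableOn ℂ F {z | 0 < z.im}) :
    segInt t F - segInt s F =
      Complex.I * ∫ y in s..t, (F (1 + y * Complex.I) - F (y * Complex.I)) := by
  have hboundary := Complex.integral_boundary_rect_eq_zero_of_differentiableOn F (s * Complex.I)
    (1 + t * Complex.I) (hF.mono fun z hz => by
      have him : z.im ∈ uIcc s t := by simpa using hz.2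
      exact (lt_min hs ht).trans_le him.1)
  have hvertical : ∀ x : ℝ, IntervalIntegrable (fun y : ℝ => F (x + y * Complex.I)) volume s t :=
    fun x => ContinuousOn.intervalIntegrable <| hF.continuousOn.comp (by fun_prop) fun y hy => by
      simp only [mem_ofPred_eq, im_ofReal_add_mul_I]
      exact (lt_min hs ht).trans_le hy.1
  have hright := hvertical 1
  have hleft := hvertical 0
  simp only [Complex.ofReal_one, Complex.ofReal_zero, zero_add] at hright hleft
  rw [intervalIntegral.integral_sub hright hleft]
  simp only [segInt, Complex.mul_re, Complex.ofReal_re, Complex.I_re, mul_zero, Complex.ofReal_im,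
    Complex.I_im, mul_one, sub_self, Complex.add_re, Complex.one_re, add_zero, Complex.mul_im,
    Complex.add_im, Complex.one_im, zero_add, smul_eq_mul, Complex.ofReal_one,
    Complex.ofReal_zero] at hboundary ⊢
  linear_combination -hboundary

theorem segInt_eq_sub_of_hasDerivAt {t : ℝ} {F F' : ℂ → ℂ}
    (hF : ∀ z, z.im = t → HasDerivAt F (F' z) z) (hF' : ContinuousOn F' {z | z.im = t}) :
    segInt t F' = F (t * Complex.I + 1) - F (t * Complex.I) := by
  have hderiv (x : ℝ) :
      HasDerivAt (fun x : ℝ => F (x + t * Complex.I)) (F' (x + t * Complex.I)) x :=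
    ((hF _ (im_ofReal_add_mul_I x t)).comp_add_const (x : ℂ) (t * Complex.I)).comp_ofReal
  simpa [segInt, add_comm] using
    intervalIntegral.integral_eq_sub_of_hasDerivAt (a := 0) (b := 1) (fun x _ => hderiv x)
      ((continuous_comp_horizontal hF').intervalIntegrable _ _)

theorem segInt_e_mul_of_hasDerivAt {c : ℂ} (hc : e c = 1) {t : ℝ} {F F' : ℂ → ℂ}
    (hF : ∀ z, z.im = t → HasDerivAt F (F' z) z) (hF' : ContinuousOn F' {z | z.im = t}) :
    segInt t (fun z => e (c * z) * F' z) =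
      e (c * (t * Complex.I)) * (F (t * Complex.I + 1) - F (t * Complex.I)) -
        2 * Real.pi * Complex.I * c * segInt t (fun z => e (c * z) * F z) := by
  have he : ContinuousOn (fun z => e (c * z)) {z | z.im = t} :=
    (continuous_e.comp (continuous_const_mul c)).continuousOn
  have hcont : ContinuousOn (fun z => 2 * Real.pi * Complex.I * c * (e (c * z) * F z))
      {z | z.im = t} :=
    continuousOn_const.mul (he.mul fun z hz => (hF z hz).continuousAt.continuousWithinAt)
  have hcont' : ContinuousOn (fun z => e (c * z) * F' z) {z | z.im = t} := he.mul hF'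
  have hparts := segInt_eq_sub_of_hasDerivAt
    (fun z hz => ((hasDerivAt_e_mul c z).mul (hF z hz)).congr_deriv
      (congrArg (· + _) (mul_assoc _ _ _))) (hcont.add hcont')
  rw [segInt_add hcont hcont', segInt_const_mul] at hparts
  simp only [Pi.mul_apply, mul_add c, mul_one, e_add, hc] at hparts
  linear_combination hparts

/-! ### Fourier coefficients of symmetrized polygamma functions -/

/-- The `n`-th Fourier coefficient of `symPolygamma k` along the horizontal segment at height `t`.
The function is not periodic, so this depends on the base point `it` of the segment. -/
noncomputable def symPolygammaCoeff (k : ℕ) (n : ℤ) (t : ℝ) : ℂ :=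
  segInt t fun z => e (-n * z) * symPolygamma k z

theorem e_neg_mul_ofReal_mul_I (n : ℤ) (t : ℝ) :
    e (-n * (t * Complex.I)) = (Real.exp (2 * Real.pi * n * t) : ℝ) := by
  have h := e_mul_ofReal_mul_I (-n) t
  rw [mul_neg, neg_mul, neg_neg] at h
  exact_mod_cast h

theorem e_neg_mul_add_one (n : ℤ) (z : ℂ) : e (-n * (z + 1)) = e (-n * z) := by
  rw [mul_add, mul_one]
  exact_mod_cast e_add_intCast (-n * z) (-n)

theorem continuousOn_e_mul_symPolygamma (c : ℂ) (k : ℕ) {t : ℝ} (ht : t ≠ 0) :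
    ContinuousOn (fun z => e (c * z) * symPolygamma k z) {z | z.im = t} :=
  (continuous_e.comp (continuous_const_mul c)).continuousOn.mul (continuousOn_symPolygamma k ht)

theorem e_mul_symPolygamma_add_one_sub (k : ℕ) (n : ℤ) {t : ℝ} (ht : t ≠ 0) :
    e (-n * (t * Complex.I + 1)) * symPolygamma k (t * Complex.I + 1) -
        e (-n * (t * Complex.I)) * symPolygamma k (t * Complex.I) =
      2 * (Real.exp (2 * Real.pi * n * t) *
        ((-1) ^ k * k.factorial * ((t * Complex.I) ^ (k + 1))⁻¹)) := by
  rw [e_neg_mul_add_one, symPolygamma_add_one k (by simpa using ht), e_neg_mul_ofReal_mul_I]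
  ring

theorem hasDerivAt_expInt_mul {c y : ℝ} (hc : c ≠ 0) (hy : y ≠ 0) :
    HasDerivAt (fun y => expInt (c * y)) (Real.exp (c * y) / y) y := by
  refine ((hasDerivAt_expInt (mul_ne_zero hc hy)).comp y
    ((hasDerivAt_id y).const_mul c)).congr_deriv ?_
  field_simp

theorem symPolygammaCoeff_zero_sub {n : ℤ} (hn : n ≠ 0) {s t : ℝ} (hs : 0 < s) (ht : 0 < t) :
    symPolygammaCoeff 0 n t - symPolygammaCoeff 0 n s =
      2 * expInt (2 * Real.pi * n * t) - 2 * expInt (2 * Real.pi * n * s) := by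
  have hpos : ∀ y ∈ uIcc s t, 0 < y := fun y hy => (lt_min hs ht).trans_le hy.1
  have hc : 2 * Real.pi * (n : ℝ) ≠ 0 :=
    mul_ne_zero (mul_ne_zero two_ne_zero Real.pi_ne_zero) (Int.cast_ne_zero.2 hn)
  have hexpInt : ∫ y in s..t, Real.exp (2 * Real.pi * n * y) / y =
      expInt (2 * Real.pi * n * t) - expInt (2 * Real.pi * n * s) :=
    intervalIntegral.integral_eq_sub_of_hasDerivAt
      (fun y hy => hasDerivAt_expInt_mul hc (hpos y hy).ne')
      (ContinuousOn.intervalIntegrable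
        (ContinuousOn.div (by fun_prop) continuousOn_id fun y hy => (hpos y hy).ne'))
  have hdiff : DifferentiableOn ℂ (fun z => e (-n * z) * symPolygamma 0 z) {z | 0 < z.im} :=
    DifferentiableOn.mul (fun z _ => (hasDerivAt_e_mul _ z).differentiableAt.differentiableWithinAt)
      (differentiableOn_symPolygamma 0)
  rw [symPolygammaCoeff, symPolygammaCoeff, segInt_sub_segInt hs ht hdiff, ← mul_sub,
    ← Complex.ofReal_sub, ← hexpInt, ← intervalIntegral.integral_ofReal,
    ← intervalIntegral.integral_const_mul, ← intervalIntegral.integral_const_mul]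
  refine intervalIntegral.integral_congr fun y hy => ?_
  simp only [add_comm (1 : ℂ)]
  rw [e_mul_symPolygamma_add_one_sub 0 n (hpos y hy).ne']
  simp only [pow_zero, Nat.factorial_zero, Nat.cast_one, one_mul, zero_add, pow_one, mul_inv,
    Complex.inv_I, Complex.ofReal_div]
  linear_combination -2 * (Real.exp (2 * Real.pi * n * y) : ℂ) * (y : ℂ)⁻¹ * Complex.I_mul_I

theorem symPolygammaCoeff_zero_of_tendsto {n : ℤ} (hn : n ≠ 0) {l : Filter ℝ} [l.NeBot]
    (hpos : ∀ᶠ s in l, 0 < s)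
    (hlim : Tendsto (fun s => symPolygammaCoeff 0 n s - 2 * expInt (2 * Real.pi * n * s)) l (𝓝 0))
    {t : ℝ} (ht : 0 < t) : symPolygammaCoeff 0 n t = 2 * expInt (2 * Real.pi * n * t) := by
  refine sub_eq_zero.1 (tendsto_nhds_unique (tendsto_const_nhds.congr' ?_) hlim)
  filter_upwards [hpos] with s hs
  linear_combination symPolygammaCoeff_zero_sub hn hs ht

theorem exists_norm_symPolygammaCoeff_zero_le :
    ∃ C : ℝ, 0 < C ∧ ∀ (n : ℤ) (t : ℝ), 1 ≤ t →
      ‖symPolygammaCoeff 0 n t‖ ≤ C * Real.exp (2 * Real.pi * n * t + Real.pi * t) := by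
  obtain ⟨C, hC0, hC⟩ := exists_norm_symPolygamma_zero_le
  refine ⟨C, hC0, fun n t ht => ?_⟩
  have habs : |t| = t := abs_of_nonneg (zero_le_one.trans ht)
  have hbound : ∀ x ∈ uIoc (0 : ℝ) 1, ‖e (-n * (x + t * Complex.I)) *
      symPolygamma 0 (x + t * Complex.I)‖ ≤
        C * Real.exp (2 * Real.pi * n * t + Real.pi * t) := fun x hx => by
    rw [uIoc_of_le zero_le_one] at hx
    have hsym := hC (x + t * Complex.I) (by simpa using ⟨hx.1.le, hx.2⟩) (by simpa [habs] using ht)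
    rw [im_ofReal_add_mul_I, habs] at hsym
    have him : -(2 * Real.pi * (-n * (x + t * Complex.I) : ℂ).im) = 2 * Real.pi * n * t := by
      simp [mul_assoc]
    rw [norm_mul, norm_e, him, Real.exp_add, mul_left_comm]
    gcongr
  simpa [symPolygammaCoeff, segInt] using
    intervalIntegral.norm_integral_le_of_norm_le_const hbound

theorem symPolygammaCoeff_zero_of_neg {n : ℤ} (hn : n < 0) {t : ℝ} (ht : 0 < t) :
    symPolygammaCoeff 0 n t = 2 * expInt (2 * Real.pi * n * t) := by
  have hn' : (n : ℝ) ≤ -1 := by exact_mod_cast Int.le_sub_one_iff.2 hn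
  have hexpInt : Tendsto (fun s : ℝ => expInt (2 * Real.pi * n * s)) atTop (𝓝 0) :=
    tendsto_expInt_atBot.comp (tendsto_id.const_mul_atTop_of_neg
      (mul_neg_of_pos_of_neg Real.two_pi_pos (by linarith)))
  have hcoeff : Tendsto (symPolygammaCoeff 0 n) atTop (𝓝 0) := by
    obtain ⟨C, hC0, hC⟩ := exists_norm_symPolygammaCoeff_zero_le
    have hdecay : Tendsto (fun t : ℝ => C * Real.exp (-(Real.pi * t))) atTop (𝓝 (C * 0)) :=
      (Real.tendsto_exp_neg_atTop_nhds_zero.comp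
        (tendsto_id.const_mul_atTop Real.pi_pos)).const_mul C
    rw [mul_zero] at hdecay
    refine squeeze_zero_norm' ?_ hdecay
    filter_upwards [eventually_ge_atTop 1] with t ht
    refine (hC n t ht).trans ?_
    gcongr
    nlinarith [mul_pos Real.pi_pos (one_pos.trans_le ht)]
  refine symPolygammaCoeff_zero_of_tendsto hn.ne (eventually_gt_atTop 0) ?_ ht
  simpa using hcoeff.sub ((Complex.continuous_ofReal.tendsto _).comp hexpInt |>.const_mul 2)

/-- The function `e(-nz) - e(nz)`, odd under `z ↦ 1 - z`. -/
noncomputable def eDiff (n : ℤ) (z : ℂ) : ℂ := e (-n * z) - e (n * z)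

theorem differentiable_eDiff (n : ℤ) : Differentiable ℂ (eDiff n) := fun z =>
  ((hasDerivAt_e_mul _ z).sub (hasDerivAt_e_mul _ z)).differentiableAt

theorem eDiff_one_sub (n : ℤ) (z : ℂ) : eDiff n (1 - z) = -eDiff n z := by
  have hneg : -(n : ℂ) * (1 - z) = n * z + (-n : ℤ) := by push_cast; ring
  have hpos : (n : ℂ) * (1 - z) = -n * z + n := by ring
  rw [eDiff, hneg, hpos, e_add_intCast, e_add_intCast, eDiff, neg_sub]

theorem eDiff_zero (n : ℤ) : eDiff n 0 = 0 := by simp [eDiff]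

theorem eDiff_one (n : ℤ) : eDiff n 1 = 0 := by
  simpa [eDiff_zero] using eDiff_one_sub n 0

/-- The continuous extension of `(e(-nz) - e(nz)) (ψ(z) + ψ(1 - z))` to the closed strip
`0 ≤ Re z ≤ 1`; the two divided differences absorb the poles of `ψ(z)` at `0` and `ψ(1 - z)`
at `1`. -/
noncomputable def eDiffDigamma (n : ℤ) (z : ℂ) : ℂ :=
  eDiff n z * (Complex.digamma (z + 1) + Complex.digamma (2 - z)) - dslope (eDiff n) 0 z +
    dslope (eDiff n) 1 z

theorem continuousAt_eDiffDigamma (n : ℤ) {z : ℂ} (hz : z.re ∈ Icc 0 1) :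
    ContinuousAt (eDiffDigamma n) z := by
  have hleft : ContinuousAt (fun z : ℂ => Complex.digamma (z + 1)) z :=
    ContinuousAt.comp (f := fun z : ℂ => z + 1) (analyticAt_digamma
      (ne_neg_natCast_of_re_pos (by simp; linarith [hz.1]))).continuousAt (by fun_prop)
  have hright : ContinuousAt (fun z : ℂ => Complex.digamma (2 - z)) z :=
    ContinuousAt.comp (f := fun z : ℂ => 2 - z) (analyticAt_digamma
      (ne_neg_natCast_of_re_pos (by simp; linarith [hz.2]))).continuousAt (by fun_prop)
  have hdiff := differentiable_eDiff n
  exact ((hdiff.continuous.continuousAt.mul (hleft.add hright)).sub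
    (continuous_dslope hdiff 0).continuousAt).add (continuous_dslope hdiff 1).continuousAt

theorem eDiffDigamma_of_ne (n : ℤ) {z : ℂ} (hz : ∀ m : ℕ, z ≠ -m) (hz' : ∀ m : ℕ, 1 - z ≠ -m) :
    eDiffDigamma n z = eDiff n z * symPolygamma 0 z := by
  have hz0 : z ≠ 0 := by simpa using hz 0
  have hz1 : z ≠ 1 := fun h => hz' 0 (by simp [h])
  have hshift : Complex.digamma (2 - z) = Complex.digamma (1 - z) + (1 - z)⁻¹ := by
    rw [← Complex.digamma_apply_add_one (1 - z) hz']
    ring_nf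
  rw [eDiffDigamma, Complex.digamma_apply_add_one z hz, hshift, dslope_of_ne _ hz0,
    dslope_of_ne _ hz1, slope_def_field, slope_def_field, eDiff_zero, eDiff_one, symPolygamma,
    polygamma_zero, sub_zero, sub_zero, ← neg_sub z 1, inv_neg, pow_zero]
  ring

theorem eDiffDigamma_one_sub (n : ℤ) {z : ℂ} (hz : ∀ m : ℕ, z ≠ -m)
    (hz' : ∀ m : ℕ, 1 - z ≠ -m) : eDiffDigamma n (1 - z) = -eDiffDigamma n z := by
  rw [eDiffDigamma_of_ne n hz hz', eDiffDigamma_of_ne n hz' (by simpa using hz), eDiff_one_sub,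
    symPolygamma, symPolygamma, sub_sub_cancel, pow_zero]
  ring

theorem integral_eDiffDigamma (n : ℤ) : ∫ x in (0 : ℝ)..1, eDiffDigamma n x = 0 := by
  have hreflect : ∫ x in (0 : ℝ)..1, eDiffDigamma n ((1 - x : ℝ) : ℂ) =
      ∫ x in (0 : ℝ)..1, -eDiffDigamma n x := by
    rw [intervalIntegral.integral_of_le zero_le_one, intervalIntegral.integral_of_le zero_le_one,
      integral_Ioc_eq_integral_Ioo, integral_Ioc_eq_integral_Ioo]
    refine setIntegral_congr_fun measurableSet_Ioo fun x hx => ?_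
    simp only [Complex.ofReal_sub, Complex.ofReal_one]
    exact eDiffDigamma_one_sub n (ne_neg_natCast_of_re_pos (by simpa using hx.1))
      (ne_neg_natCast_of_re_pos (by simpa using hx.2))
  rw [intervalIntegral.integral_comp_sub_left (fun x : ℝ => eDiffDigamma n x) 1, sub_self,
    sub_zero, intervalIntegral.integral_neg] at hreflect
  exact self_eq_neg.1 hreflect

theorem tendsto_segInt_eDiffDigamma (n : ℤ) :
    Tendsto (fun t => segInt t (eDiffDigamma n)) (𝓝 0) (𝓝 0) := by
  let clamp (x : ℝ) : ℝ := projIcc 0 1 zero_le_one x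
  have hcont : Continuous fun q : ℝ × ℝ => eDiffDigamma n (clamp q.2 + q.1 * Complex.I) := by
    refine continuous_iff_continuousAt.2 fun q => ContinuousAt.comp
      (f := fun q : ℝ × ℝ => (clamp q.2 : ℂ) + q.1 * Complex.I)
      (continuousAt_eDiffDigamma n ?_) (by fun_prop)
    rw [re_ofReal_add_mul_I]
    exact (projIcc 0 1 zero_le_one q.2).2
  have hclamp (t : ℝ) : segInt t (eDiffDigamma n) =
      ∫ x in (0 : ℝ)..1, eDiffDigamma n (clamp x + t * Complex.I) :=
    intervalIntegral.integral_congr fun x hx => by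
      rw [uIcc_of_le zero_le_one] at hx
      simp only [clamp, projIcc_of_mem zero_le_one hx]
  have hsegInt : Continuous fun t => segInt t (eDiffDigamma n) := by
    simp only [hclamp]
    exact intervalIntegral.continuous_parametric_intervalIntegral_of_continuous'
      (f := fun t x : ℝ => eDiffDigamma n (clamp x + t * Complex.I)) hcont 0 1
  simpa [segInt, integral_eDiffDigamma] using hsegInt.tendsto 0

theorem segInt_eDiffDigamma (n : ℤ) {t : ℝ} (ht : t ≠ 0) :
    segInt t (eDiffDigamma n) = symPolygammaCoeff 0 n t - symPolygammaCoeff 0 (-n) t := by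
  rw [symPolygammaCoeff, symPolygammaCoeff, ← segInt_sub (continuousOn_e_mul_symPolygamma _ 0 ht)
    (continuousOn_e_mul_symPolygamma _ 0 ht)]
  refine segInt_congr fun z hz => ?_
  have him : z.im ≠ 0 := hz.trans_ne ht
  rw [eDiffDigamma_of_ne n (ne_neg_natCast_of_im_ne_zero him)
    (ne_neg_natCast_of_im_ne_zero (by simpa using him)), eDiff, sub_mul, Int.cast_neg, neg_neg]

theorem symPolygammaCoeff_zero {n : ℤ} (hn : n ≠ 0) {t : ℝ} (ht : 0 < t) :
    symPolygammaCoeff 0 n t = 2 * expInt (2 * Real.pi * n * t) := by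
  rcases hn.lt_or_gt with hneg | hpos
  · exact symPolygammaCoeff_zero_of_neg hneg ht
  have hc : 0 < 2 * Real.pi * (n : ℝ) := mul_pos Real.two_pi_pos (Int.cast_pos.2 hpos)
  have hscale : Tendsto (fun s : ℝ => 2 * Real.pi * n * s) (𝓝[>] 0) (𝓝[>] 0) := by
    refine tendsto_nhdsWithin_iff.2 ⟨?_, ?_⟩
    · simpa using ((continuous_const_mul (2 * Real.pi * (n : ℝ))).tendsto 0).mono_left
        nhdsWithin_le_nhds
    · filter_upwards [self_mem_nhdsWithin] with s hs using mul_pos hc hs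
  have hexpInt := (Complex.continuous_ofReal.tendsto _).comp
    (tendsto_expInt_sub_expInt_neg.comp hscale) |>.const_mul 2
  have hlim := ((tendsto_segInt_eDiffDigamma n).mono_left
    (nhdsWithin_le_nhds (s := Ioi 0))).sub hexpInt
  rw [Complex.ofReal_zero, mul_zero, sub_zero] at hlim
  refine symPolygammaCoeff_zero_of_tendsto (l := 𝓝[>] 0) hn self_mem_nhdsWithin (hlim.congr' ?_) ht
  filter_upwards [self_mem_nhdsWithin] with s hs
  rw [segInt_eDiffDigamma n (ne_of_gt hs), symPolygammaCoeff_zero_of_neg (neg_neg_of_pos hpos) hs]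
  simp only [Function.comp_apply, Int.cast_neg, mul_neg, neg_mul]
  push_cast
  ring

theorem symPolygammaCoeff_succ (k : ℕ) (n : ℤ) {t : ℝ} (ht : t ≠ 0) :
    symPolygammaCoeff (k + 1) n t = 2 * Real.pi * Complex.I * n * symPolygammaCoeff k n t +
      2 * (Real.exp (2 * Real.pi * n * t) *
        ((-1) ^ k * k.factorial * ((t * Complex.I) ^ (k + 1))⁻¹)) := by
  have hperiod : e (-n) = 1 := by exact_mod_cast e_intCast (-n)
  rw [symPolygammaCoeff, segInt_e_mul_of_hasDerivAt hperiod
    (fun z hz => hasDerivAt_symPolygamma k (hz.trans_ne ht)) (continuousOn_symPolygamma _ ht),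
    symPolygamma_add_one k (by simpa using ht), e_neg_mul_ofReal_mul_I, symPolygammaCoeff]
  ring

theorem neg_one_pow_mul_inv_ofReal_mul_I_pow {n : ℤ} (hn : n ≠ 0) {t : ℝ} (ht : t ≠ 0) (k : ℕ) :
    (-1 : ℂ) ^ k * ((t * Complex.I) ^ (k + 1))⁻¹ =
      -((2 * Real.pi * Complex.I * n) ^ (k + 1) * ((2 * Real.pi * n * t : ℂ) ^ (k + 1))⁻¹) := by
  have hquot : 2 * Real.pi * Complex.I * n * (2 * Real.pi * n * t : ℂ)⁻¹ =
      -(t * Complex.I)⁻¹ := by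
    have hn' : (n : ℂ) ≠ 0 := Int.cast_ne_zero.2 hn
    have ht' : (t : ℂ) ≠ 0 := Complex.ofReal_ne_zero.2 ht
    have hpi : (Real.pi : ℂ) ≠ 0 := Complex.ofReal_ne_zero.2 Real.pi_ne_zero
    field_simp
    simp
  rw [← inv_pow (2 * Real.pi * n * t : ℂ), ← mul_pow, hquot, neg_pow (t * Complex.I : ℂ)⁻¹, inv_pow,
    pow_succ (-1 : ℂ)]
  ring

theorem symPolygammaCoeff_eq (k : ℕ) {n : ℤ} (hn : n ≠ 0) {t : ℝ} (ht : 0 < t) :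
    symPolygammaCoeff k n t =
      (2 * Real.pi * Complex.I * n) ^ k * (2 * (expInt (2 * Real.pi * n * t) -
        Real.exp (2 * Real.pi * n * t) * ∑ j ∈ Finset.range k,
          ((2 * Real.pi * n * t) ^ (j + 1))⁻¹ * j.factorial : ℝ)) := by
  induction k with
  | zero => simp [symPolygammaCoeff_zero hn ht]
  | succ k ih =>
    have hpow := neg_one_pow_mul_inv_ofReal_mul_I_pow hn ht.ne' k
    rw [symPolygammaCoeff_succ k n ht.ne', ih, Finset.sum_range_succ]
    push_cast
    linear_combination 2 * Complex.exp (2 * Real.pi * n * t) * k.factorial * hpow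

/-! ### Fourier coefficients of Bernoulli polynomials -/

theorem hasDerivAt_bernoulliPoly_succ (m : ℕ) (z : ℂ) :
    HasDerivAt (bernoulliPoly (m + 1)) ((m + 1) * bernoulliPoly m z) z := by
  have hderiv := (Polynomial.bernoulli (m + 1)).hasDerivAt_aeval z
  rw [Polynomial.derivative_bernoulli_add_one] at hderiv
  exact hderiv.congr_deriv (by simp [bernoulliPoly])

theorem continuous_bernoulliPoly (m : ℕ) : Continuous (bernoulliPoly m) :=
  Polynomial.continuous_aeval _

theorem bernoulliPoly_zero (z : ℂ) : bernoulliPoly 0 z = 1 := by simp [bernoulliPoly]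

theorem bernoulliPoly_succ_add_one (m : ℕ) (z : ℂ) :
    bernoulliPoly (m + 1) (z + 1) = bernoulliPoly (m + 1) z + (m + 1) * z ^ m := by
  have heval := congrArg (Polynomial.aeval z) (Polynomial.bernoulli_comp_one_add_X (m + 1))
  rw [Polynomial.aeval_comp] at heval
  simpa [bernoulliPoly, add_comm (1 : ℂ)] using heval

theorem segInt_bernoulliPoly (m : ℕ) (t : ℝ) :
    segInt t (bernoulliPoly m) = (t * Complex.I) ^ m := by
  have hm : (m + 1 : ℂ) ≠ 0 := Nat.cast_add_one_ne_zero m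
  have hprimitive := segInt_eq_sub_of_hasDerivAt (t := t)
    (fun z _ => hasDerivAt_bernoulliPoly_succ m z)
    (continuous_const.mul (continuous_bernoulliPoly m)).continuousOn
  rw [segInt_const_mul, bernoulliPoly_succ_add_one, add_sub_cancel_left] at hprimitive
  exact mul_left_cancel₀ hm hprimitive

theorem segInt_e_intCast_mul {n : ℤ} (hn : n ≠ 0) (t : ℝ) : segInt t (fun z => e (n * z)) = 0 := by
  have hconst := segInt_e_mul_of_hasDerivAt (e_intCast n) (t := t)
    (fun z _ => hasDerivAt_const z (1 : ℂ)) continuousOn_const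
  simpa [hn, segInt] using hconst

theorem segInt_e_mul_bernoulliPoly_succ (m : ℕ) (n : ℤ) (t : ℝ) :
    2 * Real.pi * Complex.I * n * segInt t (fun z => e (n * z) * bernoulliPoly (m + 1) z) =
      (m + 1) * (Real.exp (-(2 * Real.pi * n * t)) * (t * Complex.I) ^ m -
        segInt t fun z => e (n * z) * bernoulliPoly m z) := by
  have hparts := segInt_e_mul_of_hasDerivAt (e_intCast n) (t := t)
    (fun z _ => hasDerivAt_bernoulliPoly_succ m z)
    (continuous_const.mul (continuous_bernoulliPoly m)).continuousOn
  have hexp := e_mul_ofReal_mul_I n t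
  simp only [mul_left_comm (e _)] at hparts
  rw [segInt_const_mul, bernoulliPoly_succ_add_one] at hparts
  rw [Complex.ofReal_intCast] at hexp
  rw [hexp] at hparts
  linear_combination hparts

theorem incGamma_succ_zero (s : ℕ) : incGamma (s + 1) 0 = s.factorial := by
  simp [incGamma_succ_eq, Finset.sum_range_succ']

theorem incGamma_add_two (s : ℕ) (u : ℝ) :
    incGamma (s + 2) u = (s + 1) * incGamma (s + 1) u + Real.exp (-u) * u ^ (s + 1) := by
  have hs : (s.factorial : ℝ) ≠ 0 := by positivity
  rw [incGamma_succ_eq, incGamma_succ_eq, Finset.sum_range_succ _ (s + 1), Nat.factorial_succ]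
  push_cast
  field_simp

theorem segInt_e_mul_bernoulliPoly (k : ℕ) {n : ℤ} (hn : n ≠ 0) (t : ℝ) :
    segInt t (fun z => e (n * z) * bernoulliPoly (k + 1) z) =
      -((k + 1) * Complex.I ^ (k + 1) *
        (incGamma (k + 1) (2 * Real.pi * n * t) / (2 * Real.pi * n) ^ (k + 1) : ℝ)) := by
  have hn' : (n : ℂ) ≠ 0 := Int.cast_ne_zero.2 hn
  have hc : 2 * Real.pi * Complex.I * (n : ℂ) ≠ 0 :=
    mul_ne_zero Complex.two_pi_I_ne_zero hn'
  refine mul_left_cancel₀ hc ?_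
  induction k with
  | zero =>
    rw [segInt_e_mul_bernoulliPoly_succ]
    simp only [bernoulliPoly_zero, mul_one, segInt_e_intCast_mul hn, zero_add, incGamma_succ_eq,
      Finset.sum_range_one, pow_zero, Nat.factorial_zero, Nat.cast_one, div_one, one_mul, pow_one]
    push_cast
    field_simp
    simp
  | succ k ih =>
    rw [segInt_e_mul_bernoulliPoly_succ, mul_left_cancel₀ hc ih, incGamma_add_two]
    have hI : Complex.I ^ (k + 2) = -Complex.I ^ k := by simp [pow_add]
    push_cast
    rw [hI]
    field_simp
    ring

theorem segInt_zero_e_neg_mul_bernoulliPoly (d : ℕ) {n : ℤ} (hn : n ≠ 0) :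
    segInt 0 (fun z => e (-n * z) * bernoulliPoly (d + 1) z) =
      -((d + 1).factorial * (Complex.I / -(2 * Real.pi * n)) ^ (d + 1)) := by
  have hcoeff := segInt_e_mul_bernoulliPoly d (neg_ne_zero.2 hn) 0
  rw [mul_zero, incGamma_succ_zero] at hcoeff
  push_cast at hcoeff
  rw [hcoeff, Nat.factorial_succ, div_pow]
  push_cast
  ring

theorem conj_segInt_e_neg_mul_bernoulliPoly_re (k d : ℕ) {n : ℤ} (hn : n ≠ 0) {t : ℝ}
    (ht : t ≠ 0) :
    (starRingEnd ℂ) (segInt t fun z => e (-n * z) * bernoulliPoly (d + 1) z.re *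
        ((-Complex.I * z.im) ^ (k + d + 1))⁻¹) =
      -((-Complex.I) ^ k * ((2 * Real.pi * n) ^ k * (Real.exp (2 * Real.pi * n * t) *
        ((2 * Real.pi * n * t) ^ (k + d + 1))⁻¹ * (d + 1).factorial) : ℝ)) := by
  have hsegInt : segInt t (fun z => e (-n * z) * bernoulliPoly (d + 1) z.re *
        ((-Complex.I * z.im) ^ (k + d + 1))⁻¹) =
      Real.exp (2 * Real.pi * n * t) * ((-Complex.I * t) ^ (k + d + 1))⁻¹ *
        segInt 0 (fun z => e (-n * z) * bernoulliPoly (d + 1) z) := by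
    rw [segInt, segInt, ← intervalIntegral.integral_const_mul]
    refine intervalIntegral.integral_congr fun x _ => ?_
    simp only [re_ofReal_add_mul_I, im_ofReal_add_mul_I, Complex.ofReal_zero, zero_mul, add_zero]
    rw [mul_add, e_add, e_neg_mul_ofReal_mul_I]
    ring
  have hn' : (n : ℂ) ≠ 0 := Int.cast_ne_zero.2 hn
  have ht' : (t : ℂ) ≠ 0 := Complex.ofReal_ne_zero.2 ht
  have hI : Complex.I * -Complex.I = 1 := by simp
  have hpow : (2 * Real.pi * n * t : ℂ) ^ (k + d + 1) =
      (2 * Real.pi * n) ^ k * (2 * Real.pi * n) ^ (d + 1) * t ^ (k + d + 1) := by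
    rw [← pow_add, ← add_assoc, mul_pow]
  have hIpow : Complex.I ^ (k + d + 1) * (-Complex.I) ^ k = Complex.I ^ (d + 1) := by
    rw [add_assoc, pow_add, mul_right_comm, ← mul_pow, hI, one_pow, one_mul]
  rw [hsegInt, segInt_zero_e_neg_mul_bernoulliPoly d hn]
  simp only [map_neg, map_mul, map_pow, map_inv₀, map_div₀, Complex.conj_ofReal, Complex.conj_I,
    map_ofNat, map_intCast, map_natCast, neg_neg, neg_div_neg_eq]
  push_cast
  rw [hpow, mul_pow Complex.I, div_pow, ← hIpow]
  field_simp

theorem conj_symPolygammaCoeff (k : ℕ) {n : ℤ} (hn : n ≠ 0) {t : ℝ} (ht : 0 < t) :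
    (starRingEnd ℂ) (symPolygammaCoeff k n t) =
      (-Complex.I) ^ k * ((2 * Real.pi * n) ^ k * (2 * (expInt (2 * Real.pi * n * t) -
        Real.exp (2 * Real.pi * n * t) * ∑ j ∈ Finset.range k,
          ((2 * Real.pi * n * t) ^ (j + 1))⁻¹ * j.factorial)) : ℝ) := by
  rw [symPolygammaCoeff_eq k hn ht]
  simp only [map_mul, map_pow, Complex.conj_ofReal, Complex.conj_I, map_ofNat, map_intCast]
  rw [show (2 * Real.pi * -Complex.I * n : ℂ) = -Complex.I * (2 * Real.pi * n) by ring, mul_pow]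
  push_cast
  ring

/-! ### A linear relation between exponential integrals -/

theorem sum_range_sub_comm {R M : Type*} [Semiring R] [AddCommMonoid M] [Module R M] (k : ℕ)
    (C : ℕ → R) (g : ℕ → M) :
    ∑ j ∈ Finset.range (k + 1), C j • ∑ i ∈ Finset.range (2 * k + 1 - j), g i =
      (∑ j ∈ Finset.range (k + 1), C j) • ∑ i ∈ Finset.range k, g i +
        ∑ d ∈ Finset.range (k + 1), (∑ j ∈ Finset.range (k - d + 1), C j) • g (k + d) := by
  have hsplit : ∀ j ∈ Finset.range (k + 1), C j • ∑ i ∈ Finset.range (2 * k + 1 - j), g i =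
      C j • ∑ i ∈ Finset.range k, g i +
        ∑ d ∈ Finset.range (k + 1 - j), C j • g (k + d) := fun j hj => by
    rw [show 2 * k + 1 - j = k + (k + 1 - j) by grind, Finset.sum_range_add, smul_add,
      Finset.smul_sum (s := Finset.range (k + 1 - j))]
  rw [Finset.sum_congr rfl hsplit, Finset.sum_add_distrib, ← Finset.sum_smul]
  simp only [Finset.sum_smul]
  congr 1
  exact Finset.sum_comm' fun j d => by grind

theorem neg_one_pow_div_factorial_mul_calE {n j : ℕ} (hj : j ≤ n) (u : ℝ) :
    (-1) ^ j / j.factorial * calE (n + 1 - j) u =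
      (-1) ^ n / n.factorial * (n.choose j * (Real.exp u * ∑ i ∈ Finset.range (n - j),
        (u ^ (i + 1))⁻¹ * i.factorial - expInt u)) := by
  have hsign : (-1 : ℝ) ^ j * (-1) ^ (n + 1 - j + 1) = (-1) ^ n := by
    rw [← pow_add, show j + (n + 1 - j + 1) = n + 2 by omega, pow_add]
    norm_num
  rw [calE, show n + 1 - j - 1 = n - j by omega, Nat.cast_choose ℝ hj, ← hsign]
  field_simp

theorem sum_calE_eq (k : ℕ) (u : ℝ) :
    ∑ j ∈ Finset.range (k + 1), (-1) ^ j / j.factorial * calE (2 * k + 2 - j) u =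
      (4 ^ k * (expInt u - Real.exp u * ∑ j ∈ Finset.range k, (u ^ (j + 1))⁻¹ * j.factorial) -
        Real.exp u * ∑ d ∈ Finset.range (k + 1), (d + k).factorial *
          (∑ j ∈ Finset.range (k - d + 1), ((2 * k + 1).choose j : ℝ)) *
            (u ^ (k + d + 1))⁻¹) / (2 * k + 1).factorial := by
  have hchoose : ∑ j ∈ Finset.range (k + 1), ((2 * k + 1).choose j : ℝ) = 4 ^ k := by
    exact_mod_cast Nat.sum_range_choose_halfway k
  have hcomm := sum_range_sub_comm k (fun j => ((2 * k + 1).choose j : ℝ))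
    fun i => (u ^ (i + 1))⁻¹ * i.factorial
  simp only [smul_eq_mul, hchoose] at hcomm
  have hsign : (-1 : ℝ) ^ (2 * k + 1) = -1 := Odd.neg_one_pow ⟨k, rfl⟩
  have hterm : ∀ j ∈ Finset.range (k + 1), (-1) ^ j / j.factorial * calE (2 * k + 2 - j) u = _ :=
    fun j hj => neg_one_pow_div_factorial_mul_calE (n := 2 * k + 1) (by grind) u
  rw [Finset.sum_congr rfl hterm, ← Finset.mul_sum, hsign]
  simp only [mul_sub, mul_left_comm _ (Real.exp u), Finset.sum_sub_distrib]
  rw [← Finset.mul_sum, ← Finset.sum_mul, hcomm, hchoose]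
  have hreorder (d : ℕ) (S x : ℝ) :
      (d + k).factorial * S * x = S * (x * (k + d).factorial) := by
    rw [add_comm d k]
    ring
  simp only [hreorder]
  ring

/-! ### Termwise integration of Fourier series -/

theorem norm_e_intCast_mul (n : ℤ) (z : ℂ) :
    ‖e (n * z)‖ = Real.exp (-(2 * Real.pi * (n * z.im))) := by
  simp [norm_e]

theorem hasSum_segInt {ι : Type*} [Countable ι] {t : ℝ} {c : ι → ℂ} {ν : ι → ℤ} {F φ : ℂ → ℂ}
    (hF : ∀ z : ℂ, z.im = t → HasSum (fun i => c i * e (ν i * z)) (F z))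
    (hφ : ContinuousOn φ {z | z.im = t}) :
    HasSum (fun i => c i * segInt t fun z => e (ν i * z) * φ z) (segInt t fun z => F z * φ z) := by
  have hφ' := continuous_comp_horizontal hφ
  obtain ⟨M, hM⟩ := isCompact_Icc.exists_bound_of_continuousOn (s := Icc (0 : ℝ) 1)
    hφ'.continuousOn
  have hnorm (i : ι) (x : ℝ) : ‖c i * e (ν i * (x + t * Complex.I))‖ =
      ‖c i * e (ν i * (t * Complex.I))‖ := by
    simp [norm_e_intCast_mul]
  have hsummable : Summable fun i => ‖c i * e (ν i * (t * Complex.I))‖ :=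
    (hF (t * Complex.I) (by simp)).summable.norm
  have hsum := intervalIntegral.hasSum_integral_of_dominated_convergence (a := 0) (b := 1)
    (μ := volume) (fun i _ => ‖c i * e (ν i * (t * Complex.I))‖ * M)
    (F := fun i (x : ℝ) => c i * e (ν i * (x + t * Complex.I)) * φ (x + t * Complex.I))
    (fun i => (Continuous.aestronglyMeasurable
      ((continuous_const.mul (continuous_e.comp (by fun_prop))).mul hφ')))
    (fun i => Eventually.of_forall fun x hx => ?_)
    (Eventually.of_forall fun x _ => hsummable.mul_right M) intervalIntegrable_const
    (Eventually.of_forall fun x _ => (hF _ (im_ofReal_add_mul_I x t)).mul_right _)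
  · simpa only [segInt, ← intervalIntegral.integral_const_mul, ← mul_assoc] using hsum
  · rw [uIoc_of_le zero_le_one] at hx
    rw [norm_mul, hnorm]
    gcongr
    exact hM x ⟨hx.1.le, hx.2⟩

theorem summable_of_add_of_finite {ι : Type*} {u v : ι → ℂ} (h : Summable fun i => u i + v i)
    (hfin : {i | u i ≠ 0 ∧ v i ≠ 0}.Finite) : Summable u := by
  refine (h.indicator {i | u i ≠ 0}).congr_cofinite ?_
  rw [EventuallyEq, eventually_cofinite]
  refine hfin.subset fun i hi => ?_
  by_contra hi'
  refine hi ?_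
  by_cases hu : u i = 0
  · rw [indicator_of_notMem (by simpa using hu), hu]
  · have hv : v i = 0 := by_contra fun hv => hi' ⟨hu, hv⟩
    rw [indicator_of_mem (by simpa using hu), hv, add_zero]

/-! ### The contribution of a single frequency -/

/-- The angular frequency `2πn/α` of the Fourier mode `e(nz/α)`. -/
noncomputable def angularFreq (α : ℕ) (n : ℤ) : ℝ := 2 * Real.pi * (n / α)

theorem angularFreq_ne_zero {α : ℕ} (hα : α ≠ 0) {n : ℤ} (hn : n ≠ 0) : angularFreq α n ≠ 0 :=
  mul_ne_zero Real.two_pi_pos.ne' (div_ne_zero (Int.cast_ne_zero.2 hn) (Nat.cast_ne_zero.2 hα))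

theorem four_pi_mul_eq_two_mul_angularFreq (α : ℕ) (n : ℤ) (y : ℝ) :
    4 * Real.pi * (n / α) * y = 2 * (angularFreq α n * y) := by
  rw [angularFreq]; ring

/-- The moment `∫_T^∞ e^{-wy} y^k dy` for `w > 0`, continued to all `w ≠ 0` through the incomplete
Gamma function. -/
noncomputable def expMoment (k : ℕ) (w T : ℝ) : ℝ := incGamma (k + 1) (w * T) / w ^ (k + 1)

/-- The part of the regularization of `∫_T^∞ 𝓔_{2k+2}(2wy) e^{-wy} y^k dy` which is a combination of
exponential integrals. -/
noncomputable def regTail (k : ℕ) (w T : ℝ) : ℝ :=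
  k.factorial / (2 ^ (2 * k + 1) * w ^ (k + 1)) *
    ∑ j ∈ Finset.range (k + 1), (-1) ^ j / j.factorial * calE (2 * k + 2 - j) (w * T)

/-- The Bernoulli integral in the alternative formula, as a functional of the function `φ` that is
integrated against `B_{k+1}` at height `T / α`. -/
noncomputable def bernoulliPart (k α : ℕ) (T : ℝ) (φ : ℂ → ℂ) : ℂ :=
  (-1) ^ k * ((Complex.I * α) ^ (k + 1) / (k + 1)) *
    segInt (T / α) fun z => φ z * bernoulliPoly (k + 1) z

/-- The two contributions of `ξ_{2k+2} G` to the alternative formula, as a functional of the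
function `φ` that takes the place of `ξ_{2k+2} G` without its constant term. -/
noncomputable def xiPart (k α : ℕ) (T : ℝ) (φ : ℂ → ℂ) : ℂ :=
  (-1) ^ k * ((Complex.I * α) ^ k)⁻¹ * (k.factorial / (2 * k + 1).factorial) *
    ((2 : ℂ) ^ (2 * (k : ℤ) - 1) *
        (starRingEnd ℂ) (segInt (T / α) fun z => φ z * symPolygamma k z) +
      ∑ d ∈ Finset.range (k + 1), ((d + k).factorial : ℂ) / (d + 1).factorial *
        (∑ j ∈ Finset.range (k - d + 1), ((2 * k + 1).choose j : ℂ)) *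
        (starRingEnd ℂ) (segInt (T / α) fun z =>
          φ z * bernoulliPoly (d + 1) z.re * ((-Complex.I * z.im) ^ (k + d + 1))⁻¹))

theorem neg_one_pow_mul_I_mul_pow_succ_mul_I_pow_succ (k : ℕ) (x : ℂ) :
    (-1) ^ k * (Complex.I * x) ^ (k + 1) * Complex.I ^ (k + 1) = -x ^ (k + 1) := by
  rw [mul_assoc, ← mul_pow, show Complex.I * x * Complex.I = -1 * x by
    rw [mul_right_comm, Complex.I_mul_I], mul_pow, pow_succ (-1 : ℂ), ← mul_assoc, ← mul_assoc,
    ← mul_pow]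
  simp

theorem bernoulliPart_one (k : ℕ) {α : ℕ} (hα : α ≠ 0) (T : ℝ) :
    bernoulliPart k α T (fun _ => 1) = -(T ^ (k + 1) / (k + 1) : ℝ) := by
  have : (α : ℂ) ≠ 0 := Nat.cast_ne_zero.2 hα
  simp only [bernoulliPart, one_mul, segInt_bernoulliPoly, mul_pow (_ : ℂ) Complex.I]
  push_cast
  rw [div_pow]
  field_simp
  linear_combination (T : ℂ) ^ (k + 1) *
    neg_one_pow_mul_I_mul_pow_succ_mul_I_pow_succ k (α : ℂ)

theorem bernoulliPart_e (k : ℕ) {α : ℕ} (hα : α ≠ 0) {n : ℤ} (hn : n ≠ 0) (T : ℝ) :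
    bernoulliPart k α T (fun z => e (n * z)) = expMoment k (angularFreq α n) T := by
  have hk : (k + 1 : ℂ) ≠ 0 := Nat.cast_add_one_ne_zero k
  have : (α : ℝ) ≠ 0 := Nat.cast_ne_zero.2 hα
  have hscale : expMoment k (angularFreq α n) T = (α : ℝ) ^ (k + 1) *
      (incGamma (k + 1) (2 * Real.pi * n * (T / α)) / (2 * Real.pi * n) ^ (k + 1)) := by
    rw [expMoment, angularFreq, ← mul_div_assoc, div_pow, div_mul_eq_mul_div, mul_div_assoc _ T]
    field_simp
  rw [bernoulliPart, segInt_e_mul_bernoulliPoly k hn, hscale]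
  generalize incGamma (k + 1) _ / _ = J
  push_cast
  field_simp
  linear_combination (-(J : ℂ)) * neg_one_pow_mul_I_mul_pow_succ_mul_I_pow_succ k (α : ℂ)

theorem conj_symPolygammaCoeff_add_sum_eq (k : ℕ) {n : ℤ} (hn : n ≠ 0) {t : ℝ} (ht : 0 < t) :
    4 ^ k / 2 * (starRingEnd ℂ) (segInt t fun z => e (-n * z) * symPolygamma k z) +
      ∑ d ∈ Finset.range (k + 1), ((d + k).factorial : ℂ) / (d + 1).factorial *
        (∑ j ∈ Finset.range (k - d + 1), ((2 * k + 1).choose j : ℂ)) *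
        (starRingEnd ℂ) (segInt t fun z => e (-n * z) * bernoulliPoly (d + 1) z.re *
          ((-Complex.I * z.im) ^ (k + d + 1))⁻¹) =
      (-Complex.I) ^ k * ((2 * Real.pi * n) ^ k * ((2 * k + 1).factorial *
        ∑ j ∈ Finset.range (k + 1),
          (-1) ^ j / j.factorial * calE (2 * k + 2 - j) (2 * Real.pi * n * t)) : ℝ) := by
  have hpolygamma := conj_symPolygammaCoeff k hn ht
  have hbernoulli (d : ℕ) := conj_segInt_e_neg_mul_bernoulliPoly_re k d hn ht.ne'
  rw [symPolygammaCoeff] at hpolygamma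
  rw [hpolygamma, sum_calE_eq, mul_div_cancel₀ _ (Nat.cast_ne_zero.2 (Nat.factorial_ne_zero _))]
  simp only [hbernoulli]
  push_cast
  have hterm (d : ℕ) (c E v : ℂ) : ((d + k).factorial : ℂ) / (d + 1).factorial * c *
      -((-Complex.I) ^ k * ((2 * Real.pi * n) ^ k * (E * v * (d + 1).factorial))) =
      -((-Complex.I) ^ k * (2 * Real.pi * n) ^ k * E * ((d + k).factorial * c * v)) := by
    have : ((d + 1).factorial : ℂ) ≠ 0 := Nat.cast_ne_zero.2 (Nat.factorial_ne_zero _)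
    field_simp
  simp only [hterm, Finset.sum_neg_distrib, ← Finset.mul_sum (s := Finset.range (k + 1))]
  ring

theorem xiPart_e (k : ℕ) {α : ℕ} (hα : 0 < α) {n : ℤ} (hn : n ≠ 0) {T : ℝ} (hT : 0 < T) :
    xiPart k α T (fun z => e (-n * z)) =
      ((2 * angularFreq α n) ^ (2 * k + 1) * regTail k (angularFreq α n) T : ℝ) := by
  have hαR : (0 : ℝ) < α := Nat.cast_pos.2 hα
  have hw : angularFreq α n ≠ 0 := angularFreq_ne_zero hα.ne' hn
  have hfreq : 2 * Real.pi * n = α * angularFreq α n := by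
    rw [angularFreq]; field_simp
  have hheight : α * angularFreq α n * (T / α) = angularFreq α n * T := by field_simp
  have hzpow : (2 : ℂ) ^ (2 * (k : ℤ) - 1) = 4 ^ k / 2 := by
    rw [zpow_sub₀ two_ne_zero, zpow_mul, zpow_natCast, zpow_ofNat, zpow_one]
    norm_num
  have hunit : (-1 : ℂ) ^ k * (-Complex.I) ^ k = Complex.I ^ k := by
    rw [← mul_pow, neg_one_mul, neg_neg]
  rw [xiPart, hzpow, conj_symPolygammaCoeff_add_sum_eq k hn (div_pos hT hαR), hfreq, hheight,
    regTail]
  generalize (∑ j ∈ Finset.range (k + 1), _ : ℝ) = E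
  have : (α : ℂ) ≠ 0 := Nat.cast_ne_zero.2 hα.ne'
  have hfactorial : ((2 * k + 1).factorial : ℂ) ≠ 0 :=
    Nat.cast_ne_zero.2 (Nat.factorial_ne_zero _)
  have : (angularFreq α n : ℂ) ≠ 0 := Complex.ofReal_ne_zero.2 hw
  push_cast
  rw [mul_pow, mul_inv, mul_pow (α : ℂ), mul_pow 2 (angularFreq α n : ℂ),
    show (angularFreq α n : ℂ) ^ (2 * k + 1) = angularFreq α n ^ k * angularFreq α n ^ (k + 1) by
      ring]
  generalize ((2 * k + 1).factorial : ℂ) = c at hfactorial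
  field_simp
  linear_combination k.factorial * (E : ℂ) * hunit

theorem hasSum_bernoulliPart {ι : Type*} [Countable ι] (k : ℕ) {α : ℕ} {T : ℝ} {c : ι → ℂ}
    {ν : ι → ℤ} {F : ℂ → ℂ}
    (hF : ∀ z : ℂ, z.im = T / α → HasSum (fun i => c i * e (ν i * z)) (F z)) :
    HasSum (fun i => c i * bernoulliPart k α T fun z => e (ν i * z)) (bernoulliPart k α T F) :=
  ((hasSum_segInt hF (continuous_bernoulliPoly (k + 1)).continuousOn).mul_left _).congr_fun
    fun _ => mul_left_comm _ _ _

theorem continuousOn_bernoulliPoly_re_mul (d m : ℕ) {t : ℝ} (ht : t ≠ 0) :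
    ContinuousOn (fun z : ℂ => bernoulliPoly d z.re * ((-Complex.I * z.im) ^ m)⁻¹)
      {z | z.im = t} := by
  refine ContinuousOn.mul ?_ (ContinuousOn.inv₀ (by fun_prop) fun z hz => ?_)
  · exact ((continuous_bernoulliPoly _).comp
      (Complex.continuous_ofReal.comp Complex.continuous_re)).continuousOn
  · rw [show z.im = t from hz]
    exact pow_ne_zero _
      (mul_ne_zero (neg_ne_zero.2 Complex.I_ne_zero) (Complex.ofReal_ne_zero.2 ht))

theorem hasSum_xiPart {ι : Type*} [Countable ι] (k : ℕ) {α : ℕ} {T : ℝ} (ht : T / α ≠ 0)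
    {c : ι → ℂ} {ν : ι → ℤ} {F : ℂ → ℂ}
    (hF : ∀ z : ℂ, z.im = T / α → HasSum (fun i => c i * e (ν i * z)) (F z)) :
    HasSum (fun i => (starRingEnd ℂ) (c i) * xiPart k α T fun z => e (ν i * z))
      (xiPart k α T F) := by
  have hpolygamma := hasSum_segInt hF (continuousOn_symPolygamma k ht)
  have hbernoulli (d : ℕ) :=
    hasSum_segInt hF (continuousOn_bernoulliPoly_re_mul (d + 1) (k + d + 1) ht)
  simp only [← mul_assoc (F _), ← mul_assoc (e _)] at hbernoulli
  have hsum := ((Complex.hasSum_conj'.2 hpolygamma).mul_left ((2 : ℂ) ^ (2 * (k : ℤ) - 1))).add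
    (hasSum_sum fun d (_ : d ∈ Finset.range (k + 1)) =>
      (Complex.hasSum_conj'.2 (hbernoulli d)).mul_left
        (((d + k).factorial : ℂ) / (d + 1).factorial *
          ∑ j ∈ Finset.range (k - d + 1), ((2 * k + 1).choose j : ℂ)))
  refine (hsum.mul_left _).congr_fun fun i => ?_
  simp only [xiPart, map_mul, mul_left_comm _ ((starRingEnd ℂ) (c i)), mul_add, Finset.mul_sum]

theorem hasSum_ne_zero {f : ℤ → ℂ} {s : ℂ} (h : HasSum f s) :
    HasSum (fun n : {n : ℤ // n ≠ 0} => f n) (s - f 0) := by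
  have hsupport : Function.support (fun n => f n - if n = 0 then f 0 else 0) ⊆ {n | n ≠ 0} :=
    fun n hn hzero => hn (by simp only [hzero, if_true, sub_self])
  refine ((hasSum_subtype_iff_of_support_subset hsupport).2
    (h.sub (hasSum_ite_eq 0 (f 0)))).congr_fun fun n => ?_
  rw [Function.comp_apply, if_neg n.2, sub_zero]

/-! ### Summation over the frequencies -/

theorem ext_of_im_pos (F : ℍ → ℂ) {z : ℂ} (hz : 0 < z.im) : ext F z = F ⟨z, hz⟩ := by
  rw [ext, UpperHalfPlane.ofComplex_apply_of_im_pos hz]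

theorem im_ofReal_add_natCast_mul {α : ℕ} (hα : α ≠ 0) (r T : ℝ) {z : ℂ} (hz : z.im = T / α) :
    ((r : ℂ) + α * z).im = T := by
  have himul : ((α : ℂ) * z).im = α * z.im := by simp
  rw [Complex.add_im, Complex.ofReal_im, zero_add, himul, hz,
    mul_div_cancel₀ _ (Nat.cast_ne_zero.2 hα)]

theorem e_div_mul_add {α : ℕ} (hα : α ≠ 0) (n : ℤ) (r z : ℂ) :
    e (n / α * (r + α * z)) = e (n / α * r) * e (n * z) := by
  have : (α : ℂ) ≠ 0 := Nat.cast_ne_zero.2 hα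
  rw [← e_add]
  congr 1
  field_simp

/-- The `n`-th Fourier coefficient, at height `y`, of a function with expansion coefficients `a`
and `b`, after removal of the term `b 0 * y^{-1-2k}`. -/
noncomputable def coeffAt (k α : ℕ) (a b : ℤ → ℂ) (n : ℤ) (y : ℝ) : ℂ :=
  a n + if n = 0 then 0 else b n * calE (2 * k + 2) (2 * (angularFreq α n * y))

theorem IsFourierExpansion.hasSum_coeffAt {k α : ℕ} {g : ℍ → ℂ} {a b : ℤ → ℂ}
    (h : IsFourierExpansion k α g a b) {z : ℂ} (hz : 0 < z.im) :
    HasSum (fun n : ℤ => coeffAt k α a b n z.im * e (n / α * z))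
      (ext g z - b 0 * ((z.im ^ (2 * k + 1))⁻¹ : ℝ)) := by
  have hsum := (h.hasSum ⟨z, hz⟩).sub
    (hasSum_ite_eq (0 : ℤ) (b 0 * ((z.im ^ (2 * k + 1))⁻¹ : ℝ)))
  rw [ext_of_im_pos g hz]
  refine hsum.congr_fun fun n => ?_
  change _ = (a n + b n * (if n = 0 then (z.im ^ (2 * k + 1))⁻¹
      else calE (2 * k + 2) (4 * Real.pi * (n / α) * z.im) : ℝ)) * e (n / α * z) - _
  rw [coeffAt, four_pi_mul_eq_two_mul_angularFreq]
  rcases eq_or_ne n 0 with rfl | hn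
  · simp [e_zero]
  · simp only [if_neg hn, sub_zero]

theorem IsFourierExpansion.hasSum_expMoment {k α : ℕ} (hα : 0 < α) {g : ℍ → ℂ} {a b : ℤ → ℂ}
    (h : IsFourierExpansion k α g a b) (r : ℝ) {T : ℝ} (hT : 0 < T) :
    HasSum (fun n : {n : ℤ // n ≠ 0} =>
        coeffAt k α a b n T * e ((n : ℤ) / α * r) * expMoment k (angularFreq α n) T)
      (bernoulliPart k α T (fun z =>
          ext g (r + α * z) - b 0 * (((α * z.im) ^ (2 * k + 1))⁻¹ : ℝ)) +
        a 0 * (T ^ (k + 1) / (k + 1) : ℝ)) := by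
  have hsegment (z : ℂ) (hz : z.im = T / α) :
      HasSum (fun n : ℤ => coeffAt k α a b n T * e (n / α * r) * e (n * z))
        (ext g (r + α * z) - b 0 * (((α * z.im) ^ (2 * k + 1))⁻¹ : ℝ)) := by
    have him := im_ofReal_add_natCast_mul hα.ne' r T hz
    have hsum := h.hasSum_coeffAt (hT.trans_eq him.symm)
    rw [him] at hsum
    rw [hz, mul_div_cancel₀ _ (Nat.cast_ne_zero.2 hα.ne')]
    simpa only [e_div_mul_add hα.ne', ← mul_assoc] using hsum
  have hzero : coeffAt k α a b 0 T * e ((0 : ℤ) / α * r) *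
      bernoulliPart k α T (fun z => e ((0 : ℤ) * z)) = -(a 0 * (T ^ (k + 1) / (k + 1) : ℝ)) := by
    simp only [coeffAt, Int.cast_zero, zero_div, zero_mul, e_zero, if_true, add_zero, mul_one,
      bernoulliPart_one k hα.ne', mul_neg]
  have hsum := hasSum_ne_zero (hasSum_bernoulliPart k hsegment)
  rw [hzero, sub_neg_eq_add] at hsum
  exact hsum.congr_fun fun n => by rw [bernoulliPart_e k hα.ne' n.2]

/-- The coefficients of the expansion of `ξ_{2k+2} G` without its constant term. -/
noncomputable def xiCoeff (k α : ℕ) (b : ℤ → ℂ) (n : ℤ) : ℂ :=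
  if n = 0 then 0 else (((2 * angularFreq α n) ^ (2 * k + 1))⁻¹ : ℝ) * (starRingEnd ℂ) (b n)

/-- `F` has the expansion `ξa₀ + ∑ (4πn/α)^{-1-2k} conj(a⁻(n)) e(-nz/α)`. -/
def IsXiExpansion (k α : ℕ) (b : ℤ → ℂ) (ξa₀ : ℂ) (F : ℍ → ℂ) : Prop :=
  ∀ z : ℍ, HasSum (fun n : ℤ => xiCoeff k α b n * e (-(n / α * z))) (F z - ξa₀)

theorem conj_xiCoeff_mul_e (k : ℕ) {α : ℕ} (b : ℤ → ℂ) {n : ℤ} (hn : n ≠ 0) (r : ℝ) :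
    (starRingEnd ℂ) (xiCoeff k α b n * e (-(n / α * r))) =
      (((2 * angularFreq α n) ^ (2 * k + 1))⁻¹ : ℝ) * (b n * e (n / α * r)) := by
  rw [xiCoeff, if_neg hn, map_mul, map_mul, Complex.conj_ofReal, Complex.conj_conj, conj_e,
    mul_assoc]
  simp

theorem IsXiExpansion.hasSum_regTail {k α : ℕ} (hα : 0 < α) {b : ℤ → ℂ} {ξa₀ : ℂ} {F : ℍ → ℂ}
    (h : IsXiExpansion k α b ξa₀ F) (r : ℝ) {T : ℝ} (hT : 0 < T) :
    HasSum (fun n : {n : ℤ // n ≠ 0} =>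
        b n * e ((n : ℤ) / α * r) * regTail k (angularFreq α n) T)
      (xiPart k α T fun z => ext F (r + α * z) - ξa₀) := by
  have hsegment (z : ℂ) (hz : z.im = T / α) :
      HasSum (fun n : ℤ => xiCoeff k α b n * e (-(n / α * r)) * e ((-n : ℤ) * z))
        (ext F (r + α * z) - ξa₀) := by
    have him : 0 < ((r : ℂ) + α * z).im := by
      rwa [im_ofReal_add_natCast_mul hα.ne' r T hz]
    have hsplit (n : ℤ) := e_div_mul_add hα.ne' (-n) r z
    simp only [Int.cast_neg, neg_div, neg_mul] at hsplit
    rw [ext_of_im_pos F him]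
    refine (h ⟨_, him⟩).congr_fun fun n => ?_
    rw [Int.cast_neg, neg_mul, mul_assoc, ← hsplit]
  have hsum := hasSum_ne_zero (hasSum_xiPart k
    (div_pos hT (Nat.cast_pos.2 hα)).ne' hsegment)
  have hzero : xiCoeff k α b 0 = 0 := if_pos rfl
  rw [hzero, zero_mul, map_zero, zero_mul, sub_zero] at hsum
  refine hsum.congr_fun fun n => ?_
  have : ((angularFreq α n : ℝ) : ℂ) ≠ 0 :=
    Complex.ofReal_ne_zero.2 (angularFreq_ne_zero hα.ne' n.2)
  rw [conj_xiCoeff_mul_e k b n.2, Int.cast_neg, xiPart_e k hα n.2 hT]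
  push_cast
  field_simp

/-- The contribution of the frequency `n / α` to the regularization. -/
noncomputable def regTerm (k α : ℕ) (a b : ℤ → ℂ) (r : ℝ) (n : ℤ) (T : ℝ) : ℂ :=
  coeffAt k α a b n T * e (n / α * r) * expMoment k (angularFreq α n) T -
    b n * e (n / α * r) * regTail k (angularFreq α n) T

theorem hasSum_regTerm {k α : ℕ} (hα : 0 < α) {g F : ℍ → ℂ} {a b : ℤ → ℂ} {ξa₀ : ℂ}
    (h : IsFourierExpansion k α g a b) (hξ : IsXiExpansion k α b ξa₀ F)
    (r : ℝ) {T : ℝ} (hT : 0 < T) :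
    HasSum (fun n : {n : ℤ // n ≠ 0} => regTerm k α a b r n T)
      (bernoulliPart k α T (fun z =>
          ext g (r + α * z) - b 0 * (((α * z.im) ^ (2 * k + 1))⁻¹ : ℝ)) +
        a 0 * (T ^ (k + 1) / (k + 1) : ℝ) -
        xiPart k α T (fun z => ext F (r + α * z) - ξa₀)) :=
  (h.hasSum_expMoment hα r hT).sub (hξ.hasSum_regTail hα r hT)

theorem IsFourierExpansion.finite_ne_zero {k α : ℕ} {g : ℍ → ℂ} {a b : ℤ → ℂ}
    (h : IsFourierExpansion k α g a b) : {n | a n ≠ 0 ∧ b n ≠ 0}.Finite := by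
  obtain ⟨M, hM⟩ := h.plus_eq_zero
  obtain ⟨M', hM'⟩ := h.minus_eq_zero
  exact (finite_Icc M M').subset fun n hn =>
    ⟨not_lt.1 fun hlt => hn.1 (hM n hlt), not_lt.1 fun hlt => hn.2 (hM' n hlt)⟩

theorem IsFourierExpansion.tsum_add_tsum_eq_tsum_regTerm {k α : ℕ} (hα : 0 < α) {g F : ℍ → ℂ}
    {a b : ℤ → ℂ} {ξa₀ : ℂ} (h : IsFourierExpansion k α g a b) (hξ : IsXiExpansion k α b ξa₀ F)
    (r : ℝ) {T : ℝ} (hT : 0 < T) :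
    (∑' n : {n : ℤ // n ≠ 0}, a n * e ((n : ℤ) / α * r) * expMoment k (angularFreq α n) T) +
      ∑' n : {n : ℤ // n ≠ 0}, b n * e ((n : ℤ) / α * r) *
        (calE (2 * k + 2) (2 * (angularFreq α n * T)) * expMoment k (angularFreq α n) T -
          regTail k (angularFreq α n) T : ℝ) =
      ∑' n : {n : ℤ // n ≠ 0}, regTerm k α a b r n T := by
  set u : {n : ℤ // n ≠ 0} → ℂ := fun n =>
    a n * e ((n : ℤ) / α * r) * expMoment k (angularFreq α n) T
  set v : {n : ℤ // n ≠ 0} → ℂ := fun n => b n * e ((n : ℤ) / α * r) *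
    (calE (2 * k + 2) (2 * (angularFreq α n * T)) * expMoment k (angularFreq α n) T -
      regTail k (angularFreq α n) T : ℝ)
  have hadd (n : {n : ℤ // n ≠ 0}) : u n + v n = regTerm k α a b r n T := by
    simp only [u, v, regTerm, coeffAt, if_neg n.2]
    push_cast
    ring
  have huv : Summable fun n => u n + v n := by
    simpa only [hadd] using (hasSum_regTerm hα h hξ r hT).summable
  have hfin : {n | u n ≠ 0 ∧ v n ≠ 0}.Finite :=
    (h.finite_ne_zero.preimage Subtype.val_injective.injOn).subset fun n hn =>
      ⟨left_ne_zero_of_mul (left_ne_zero_of_mul hn.1),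
        left_ne_zero_of_mul (left_ne_zero_of_mul hn.2)⟩
  have hu := summable_of_add_of_finite huv hfin
  have hv : Summable v := by simpa only [add_sub_cancel_left] using huv.sub hu
  rw [← hu.tsum_add hv]
  exact tsum_congr hadd

/-! ### Independence of the height of truncation -/

theorem monotoneOn_calE_mul_exp_neg_half {κ : ℕ} (hκ : 1 ≤ κ) :
    MonotoneOn (fun x => calE κ x * Real.exp (-(x / 2))) (Iio 0) := by
  have hderiv {x : ℝ} (hx : x < 0) : HasDerivAt (fun x => calE κ x * Real.exp (-(x / 2)))
      ((Real.exp x / (-x) ^ κ - calE κ x / 2) * Real.exp (-(x / 2))) x := by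
    refine ((hasDerivAt_calE hκ hx.ne).mul
      ((hasDerivAt_id' x).div_const 2).fun_neg.exp).congr_deriv ?_
    ring
  refine monotoneOn_of_deriv_nonneg (convex_Iio 0)
    (fun x hx => (hderiv hx).continuousAt.continuousWithinAt) ?_ ?_ <;>
    rw [interior_Iio] <;> intro x hx
  · exact (hderiv hx).differentiableAt.differentiableWithinAt
  · rw [(hderiv hx).deriv]
    refine mul_nonneg ?_ (Real.exp_pos _).le
    linarith [calE_nonneg_of_neg hκ hx, calE_le_of_neg hκ hx]

/-- The value on the line of real part `r` of the summand of frequency `n / α` in a Fourier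
expansion. -/
noncomputable def verticalTerm (k α : ℕ) (a b : ℤ → ℂ) (r : ℝ) (n : ℤ) (y : ℝ) : ℂ :=
  coeffAt k α a b n y * e (n / α * r) * (Real.exp (-(angularFreq α n * y)) : ℝ)

theorem e_div_mul_add_mul_I (α : ℕ) (n : ℤ) (r y : ℝ) :
    e (n / α * (r + y * Complex.I)) =
      e (n / α * r) * (Real.exp (-(angularFreq α n * y)) : ℝ) := by
  have hsplit := e_mul_ofReal_mul_I (n / α) y
  rw [← mul_assoc] at hsplit
  rw [mul_add, e_add, angularFreq, ← hsplit]
  push_cast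
  rw [mul_assoc]

theorem IsFourierExpansion.hasSum_verticalTerm {k α : ℕ} {g : ℍ → ℂ} {a b : ℤ → ℂ}
    (h : IsFourierExpansion k α g a b) (r : ℝ) {y : ℝ} (hy : 0 < y) :
    HasSum (fun n : ℤ => verticalTerm k α a b r n y)
      (ext g (r + y * Complex.I) - b 0 * ((y ^ (2 * k + 1))⁻¹ : ℝ)) := by
  have hsum := h.hasSum_coeffAt (z := r + y * Complex.I) (by rwa [im_ofReal_add_mul_I])
  rw [im_ofReal_add_mul_I] at hsum
  exact hsum.congr_fun fun n => by rw [verticalTerm, mul_assoc, e_div_mul_add_mul_I]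

theorem norm_verticalTerm {α : ℕ} (k : ℕ) (a b : ℤ → ℂ) (r : ℝ) (n : ℤ) (y : ℝ) :
    ‖verticalTerm k α a b r n y‖ =
      ‖coeffAt k α a b n y‖ * Real.exp (-(angularFreq α n * y)) := by
  have hreal : (n : ℂ) / α * r = ((n / α * r : ℝ) : ℂ) := by push_cast; rfl
  rw [verticalTerm, norm_mul, norm_mul, Complex.norm_real, Real.norm_of_nonneg (Real.exp_pos _).le,
    norm_e, hreal, Complex.ofReal_im, mul_zero, neg_zero, Real.exp_zero, mul_one]

theorem antitoneOn_norm_verticalTerm_of_minus_eq_zero {k α : ℕ} {a b : ℤ → ℂ} (r : ℝ) {n : ℤ}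
    (hn : 0 ≤ n) (hb : b n = 0) :
    AntitoneOn (fun y => ‖verticalTerm k α a b r n y‖) (Ioi 0) := by
  intro y₁ _ y₂ _ hle
  have hw : 0 ≤ angularFreq α n :=
    mul_nonneg Real.two_pi_pos.le (div_nonneg (Int.cast_nonneg hn) (Nat.cast_nonneg α))
  simp only [norm_verticalTerm, coeffAt, hb, zero_mul, ite_self]
  gcongr

theorem antitoneOn_norm_verticalTerm_of_plus_eq_zero {k α : ℕ} (hα : 0 < α) {a b : ℤ → ℂ} (r : ℝ)
    {n : ℤ} (hn : n < 0) (ha : a n = 0) :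
    AntitoneOn (fun y => ‖verticalTerm k α a b r n y‖) (Ioi 0) := by
  have hw : angularFreq α n < 0 := mul_neg_of_pos_of_neg Real.two_pi_pos
    (div_neg_of_neg_of_pos (Int.cast_lt_zero.2 hn) (Nat.cast_pos.2 hα))
  have hneg {y : ℝ} (hy : 0 < y) : 2 * (angularFreq α n * y) < 0 :=
    mul_neg_of_pos_of_neg two_pos (mul_neg_of_neg_of_pos hw hy)
  have hnorm {y : ℝ} (hy : 0 < y) : ‖verticalTerm k α a b r n y‖ =
      ‖b n‖ * (calE (2 * k + 2) (2 * (angularFreq α n * y)) *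
        Real.exp (-(2 * (angularFreq α n * y) / 2))) := by
    rw [norm_verticalTerm, coeffAt, ha, zero_add, if_neg hn.ne, norm_mul, Complex.norm_real,
      Real.norm_of_nonneg (calE_nonneg_of_neg (by omega) (hneg hy)), mul_assoc,
      mul_div_cancel_left₀ _ two_ne_zero]
  intro y₁ hy₁ y₂ hy₂ hle
  simp only [hnorm hy₁, hnorm hy₂]
  refine mul_le_mul_of_nonneg_left ?_ (norm_nonneg _)
  exact monotoneOn_calE_mul_exp_neg_half (by omega) (hneg hy₂) (hneg hy₁)
    (mul_le_mul_of_nonneg_left (mul_le_mul_of_nonpos_left hle hw.le) two_pos.le)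

theorem IsFourierExpansion.eventually_antitoneOn_norm_verticalTerm {k α : ℕ} (hα : 0 < α)
    {g : ℍ → ℂ} {a b : ℤ → ℂ} (h : IsFourierExpansion k α g a b) (r : ℝ) :
    ∀ᶠ n in cofinite, AntitoneOn (fun y => ‖verticalTerm k α a b r n y‖) (Ioi 0) := by
  obtain ⟨M, hM⟩ := h.plus_eq_zero
  obtain ⟨M', hM'⟩ := h.minus_eq_zero
  refine (finite_Icc (min M 0) (max M' 0)).subset fun n hn => ?_
  by_contra hnot
  rcases not_and_or.1 hnot with hlt | hgt
  · have hlt := lt_min_iff.1 (not_le.1 hlt)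
    exact hn (antitoneOn_norm_verticalTerm_of_plus_eq_zero hα r hlt.2 (hM n hlt.1))
  · have hgt := max_lt_iff.1 (not_le.1 hgt)
    exact hn (antitoneOn_norm_verticalTerm_of_minus_eq_zero r hgt.2.le (hM' n hgt.1))

theorem hasDerivAt_calE_mul {k : ℕ} {w y : ℝ} (hw : w ≠ 0) (hy : y ≠ 0) :
    HasDerivAt (fun y => calE (2 * k + 2) (2 * (w * y)))
      (Real.exp (2 * (w * y)) / (2 * (w * y)) ^ (2 * k + 2) * (2 * w)) y := by
  refine ((hasDerivAt_calE (κ := 2 * k + 2) (by omega) (mul_ne_zero two_ne_zero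
    (mul_ne_zero hw hy))).comp y ((hasDerivAt_const_mul w).const_mul 2)).congr_deriv ?_
  rw [Even.neg_pow ⟨k + 1, by ring⟩]

theorem hasDerivAt_coeffAt {k α : ℕ} (hα : 0 < α) (a b : ℤ → ℂ) {n : ℤ} (hn : n ≠ 0) {y : ℝ}
    (hy : y ≠ 0) :
    HasDerivAt (coeffAt k α a b n) (b n * (Real.exp (2 * (angularFreq α n * y)) /
      (2 * (angularFreq α n * y)) ^ (2 * k + 2) * (2 * angularFreq α n) : ℝ)) y := by
  have hcoeff : coeffAt k α a b n =
      fun y => a n + b n * calE (2 * k + 2) (2 * (angularFreq α n * y)) := by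
    funext y
    rw [coeffAt, if_neg hn]
  rw [hcoeff]
  exact ((hasDerivAt_calE_mul (angularFreq_ne_zero hα.ne' hn) hy).ofReal_comp.const_mul _).const_add
    _

theorem continuousOn_verticalTerm {k α : ℕ} (hα : 0 < α) (a b : ℤ → ℂ) (r : ℝ) (n : ℤ) :
    ContinuousOn (verticalTerm k α a b r n) (Ioi 0) := by
  have hcoeff : ContinuousOn (coeffAt k α a b n) (Ioi 0) := by
    rcases eq_or_ne n 0 with rfl | hn
    · exact (continuousOn_const (c := a 0)).congr fun y _ => by
        rw [coeffAt, if_pos rfl, add_zero]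
    · exact fun y hy =>
        (hasDerivAt_coeffAt hα a b hn (ne_of_gt hy)).continuousAt.continuousWithinAt
  exact (hcoeff.mul continuousOn_const).mul (by fun_prop)

theorem exists_summable_bound {ι X E : Type*} [SeminormedAddCommGroup E] {f : ι → X → E}
    {s : Set X} {B : ι → ℝ} (hB : Summable B) (hbounded : ∀ i, ∃ K, ∀ x ∈ s, ‖f i x‖ ≤ K)
    (hf : ∀ᶠ i in cofinite, ∀ x ∈ s, ‖f i x‖ ≤ B i) :
    ∃ B' : ι → ℝ, Summable B' ∧ ∀ i, ∀ x ∈ s, ‖f i x‖ ≤ B' i := by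
  classical
  choose K hK using hbounded
  refine ⟨fun i => if ∀ x ∈ s, ‖f i x‖ ≤ B i then B i else K i,
    hB.congr_cofinite (hf.mono fun i hi => (if_pos hi).symm), fun i => ?_⟩
  by_cases hi : ∀ x ∈ s, ‖f i x‖ ≤ B i
  · simpa only [if_pos hi] using hi
  · simpa only [if_neg hi] using hK i

theorem IsFourierExpansion.exists_summable_bound_verticalTerm {k α : ℕ} (hα : 0 < α) {g : ℍ → ℂ}
    {a b : ℤ → ℂ} (h : IsFourierExpansion k α g a b) (r : ℝ) {y₁ : ℝ} (hy₁ : 0 < y₁) (y₂ : ℝ) :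
    ∃ B : ℤ → ℝ, Summable B ∧ ∀ n, ∀ y ∈ Icc y₁ y₂, ‖verticalTerm k α a b r n y‖ ≤ B n := by
  have hsub : Icc y₁ y₂ ⊆ Ioi 0 := fun y hy => hy₁.trans_le hy.1
  refine exists_summable_bound (h.hasSum_verticalTerm r hy₁).summable.norm (fun n => ?_)
    ((h.eventually_antitoneOn_norm_verticalTerm hα r).mono fun n hn y hy =>
      hn hy₁ (hsub hy) hy.1)
  exact isCompact_Icc.exists_bound_of_continuousOn
    ((continuousOn_verticalTerm hα a b r n).mono hsub)

theorem hasDerivAt_expMoment (k : ℕ) {w : ℝ} (hw : w ≠ 0) (y : ℝ) :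
    HasDerivAt (expMoment k w) (-(Real.exp (-(w * y)) * y ^ k)) y := by
  refine (((hasDerivAt_incGamma (k + 1) (w * y)).comp y
    (hasDerivAt_const_mul w)).div_const _).congr_deriv ?_
  rw [Nat.add_sub_cancel, mul_pow]
  field_simp
  ring

theorem hasDerivAt_regTail (k : ℕ) {w y : ℝ} (hw : w ≠ 0) (hy : y ≠ 0) :
    HasDerivAt (regTail k w)
      (Real.exp (2 * (w * y)) / (2 * (w * y)) ^ (2 * k + 2) * (2 * w) * expMoment k w y) y := by
  have hwy : w * y ≠ 0 := mul_ne_zero hw hy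
  have hsum : HasDerivAt (fun y : ℝ => ∑ j ∈ Finset.range (k + 1),
        (-1) ^ j / j.factorial * calE (2 * k + 2 - j) (w * y))
      (∑ j ∈ Finset.range (k + 1), Real.exp (w * y) / (w * y) ^ (2 * k + 2) * w *
        ((w * y) ^ j / j.factorial)) y := by
    refine HasDerivAt.fun_sum fun j hj => ?_
    have hj : j ≤ k := Finset.mem_range_succ_iff.1 hj
    refine (((hasDerivAt_calE (κ := 2 * k + 2 - j) (by omega) hwy).comp y
      (hasDerivAt_const_mul w)).const_mul _).congr_deriv ?_
    have hpow : (w * y) ^ (2 * k + 2) = (-(w * y)) ^ j * (-(w * y)) ^ (2 * k + 2 - j) := by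
      rw [← pow_add, Nat.add_sub_cancel' (by omega), Even.neg_pow ⟨k + 1, by ring⟩]
    rw [hpow, neg_pow (w * y) j]
    have : (w * y) ^ j ≠ 0 := pow_ne_zero _ hwy
    have : (-(w * y)) ^ (2 * k + 2 - j) ≠ 0 := pow_ne_zero _ (neg_ne_zero.2 hwy)
    have hsign : ((-1 : ℝ) ^ j) * (-1) ^ j = 1 := by rw [← mul_pow]; norm_num
    generalize (w * y) ^ j = P at *
    field_simp
    linear_combination hsign
  refine (hsum.const_mul (k.factorial / (2 ^ (2 * k + 1) * w ^ (k + 1)) : ℝ)).congr_deriv ?_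
  have hexp : Real.exp (2 * (w * y)) * Real.exp (-(w * y)) = Real.exp (w * y) := by
    rw [← Real.exp_add]
    ring_nf
  rw [← Finset.mul_sum, expMoment, incGamma_succ_eq, ← hexp, mul_pow 2 (w * y)]
  have : (w * y) ^ (2 * k + 2) ≠ 0 := pow_ne_zero _ hwy
  generalize (w * y) ^ (2 * k + 2) = P at *
  field_simp
  ring

theorem hasDerivAt_regTerm {k α : ℕ} (hα : 0 < α) (a b : ℤ → ℂ) (r : ℝ) {n : ℤ} (hn : n ≠ 0)
    {y : ℝ} (hy : y ≠ 0) :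
    HasDerivAt (regTerm k α a b r n) (-(verticalTerm k α a b r n y * (y : ℂ) ^ k)) y := by
  have hw := angularFreq_ne_zero hα.ne' hn
  refine ((((hasDerivAt_coeffAt hα a b hn hy).mul_const (e (n / α * r))).mul
    (hasDerivAt_expMoment k hw y).ofReal_comp).sub
    ((hasDerivAt_regTail k hw hy).ofReal_comp.const_mul (b n * e (n / α * r)))).congr_deriv ?_
  rw [verticalTerm]
  push_cast
  ring

theorem IsFourierExpansion.hasSum_integral_verticalTerm {k α : ℕ} (hα : 0 < α) {g : ℍ → ℂ}
    {a b : ℤ → ℂ} (h : IsFourierExpansion k α g a b) (r : ℝ) {S T : ℝ} (hS : 0 < S) (hT : 0 < T) :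
    HasSum (fun n : {n : ℤ // n ≠ 0} => ∫ y in T..S, verticalTerm k α a b r n y * (y : ℂ) ^ k)
      (∫ y in T..S, (ext g (r + y * Complex.I) - (a 0 + b 0 * ((y ^ (2 * k + 1))⁻¹ : ℝ))) *
        (y : ℂ) ^ k) := by
  have hpos {y : ℝ} (hy : y ∈ uIcc T S) : 0 < y := (lt_min hT hS).trans_le hy.1
  obtain ⟨B, hB, hle⟩ := h.exists_summable_bound_verticalTerm hα r (lt_min hT hS) (max T S)
  refine intervalIntegral.hasSum_integral_of_dominated_convergence
    (fun n _ => B n * (max T S) ^ k) (fun n => ?_)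
    (fun n => Eventually.of_forall fun y hy => ?_)
    (Eventually.of_forall fun y _ => (hB.comp_injective Subtype.val_injective).mul_right _)
    intervalIntegrable_const (Eventually.of_forall fun y hy => ?_)
  · have hcont : ContinuousOn (fun y : ℝ => verticalTerm k α a b r n y * (y : ℂ) ^ k) (uIcc T S) :=
      ((continuousOn_verticalTerm hα a b r n).mono fun y hy => hpos hy).mul (by fun_prop)
    exact (hcont.mono uIoc_subset_uIcc).aestronglyMeasurable measurableSet_uIoc
  · have hy := uIoc_subset_uIcc hy
    rw [norm_mul, norm_pow, Complex.norm_real, Real.norm_of_nonneg (hpos hy).le]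
    exact mul_le_mul (hle n y hy) (pow_le_pow_left₀ (hpos hy).le hy.2 k)
      (pow_nonneg (hpos hy).le k) ((norm_nonneg _).trans (hle n y hy))
  · have hsum := hasSum_ne_zero (h.hasSum_verticalTerm r (hpos (uIoc_subset_uIcc hy)))
    have hzero : verticalTerm k α a b r 0 y = a 0 := by
      simp [verticalTerm, coeffAt, angularFreq, e_zero]
    rw [hzero, sub_sub, add_comm (b 0 * _)] at hsum
    exact hsum.mul_right _

theorem IsFourierExpansion.hasSum_regTerm_sub {k α : ℕ} (hα : 0 < α) {g : ℍ → ℂ} {a b : ℤ → ℂ}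
    (h : IsFourierExpansion k α g a b) (r : ℝ) {S T : ℝ} (hS : 0 < S) (hT : 0 < T) :
    HasSum (fun n : {n : ℤ // n ≠ 0} => regTerm k α a b r n T - regTerm k α a b r n S)
      (∫ y in T..S, (ext g (r + y * Complex.I) - (a 0 + b 0 * ((y ^ (2 * k + 1))⁻¹ : ℝ))) *
        (y : ℂ) ^ k) := by
  have hpos {y : ℝ} (hy : y ∈ uIcc T S) : 0 < y := (lt_min hT hS).trans_le hy.1
  refine (h.hasSum_integral_verticalTerm hα r hS hT).congr_fun fun n => ?_
  have hcont : ContinuousOn (fun y : ℝ => verticalTerm k α a b r n y * (y : ℂ) ^ k) (uIcc T S) :=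
    ((continuousOn_verticalTerm hα a b r n).mono fun y hy => hpos hy).mul (by fun_prop)
  have hftc := intervalIntegral.integral_eq_sub_of_hasDerivAt
    (fun y hy => hasDerivAt_regTerm (k := k) hα a b r n.2 (hpos hy).ne')
    hcont.intervalIntegrable.neg
  rw [intervalIntegral.integral_neg] at hftc
  linear_combination hftc

theorem hasDerivAt_constGrowth (k : ℕ) {y : ℝ} (hy : y ≠ 0) :
    HasDerivAt (constGrowth k) (-(y ^ (k + 1))⁻¹) y := by
  rcases k with _ | m
  · have hlog : constGrowth 0 = fun y => -Real.log y := funext fun y => if_pos rfl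
    rw [hlog, zero_add, pow_one]
    exact (Real.hasDerivAt_log hy).neg
  · have hpow : constGrowth (m + 1) = fun y : ℝ => (y ^ (m + 1))⁻¹ / (m + 1 : ℕ) :=
      funext fun y => if_neg m.succ_ne_zero
    have : ((m + 1 : ℕ) : ℝ) ≠ 0 := Nat.cast_ne_zero.2 m.succ_ne_zero
    rw [hpow]
    refine (((hasDerivAt_pow (m + 1) y).inv (pow_ne_zero _ hy)).div_const _).congr_deriv ?_
    rw [Nat.add_sub_cancel]
    field_simp
    ring

theorem intervalIntegrable_const_add_inv_pow_mul_pow (k : ℕ) (a₀ b₀ : ℂ) {S T : ℝ} (hS : 0 < S)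
    (hT : 0 < T) :
    IntervalIntegrable (fun y : ℝ => (a₀ + b₀ * ((y ^ (2 * k + 1))⁻¹ : ℝ)) * (y : ℂ) ^ k)
      volume T S := by
  refine ContinuousOn.intervalIntegrable
    (ContinuousOn.mul (continuousOn_const.add (continuousOn_const.mul ?_)) (by fun_prop))
  refine Complex.continuous_ofReal.comp_continuousOn (ContinuousOn.inv₀ (by fun_prop) ?_)
  exact fun y hy => pow_ne_zero _ ((lt_min hT hS).trans_le hy.1).ne'

theorem integral_const_add_inv_pow_mul_pow (k : ℕ) (a₀ b₀ : ℂ) {S T : ℝ} (hS : 0 < S)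
    (hT : 0 < T) :
    ∫ y in T..S, (a₀ + b₀ * ((y ^ (2 * k + 1))⁻¹ : ℝ)) * (y : ℂ) ^ k =
      (a₀ * (S ^ (k + 1) / (k + 1) : ℝ) - b₀ * constGrowth k S) -
        (a₀ * (T ^ (k + 1) / (k + 1) : ℝ) - b₀ * constGrowth k T) := by
  refine intervalIntegral.integral_eq_sub_of_hasDerivAt
    (f := fun y : ℝ => a₀ * (y ^ (k + 1) / (k + 1) : ℝ) - b₀ * constGrowth k y) (fun y hy => ?_)
    (intervalIntegrable_const_add_inv_pow_mul_pow k a₀ b₀ hS hT)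
  have hy : y ≠ 0 := ((lt_min hT hS).trans_le hy.1).ne'
  have hpow : HasDerivAt (fun y : ℝ => y ^ (k + 1) / ((k : ℝ) + 1)) (y ^ k) y := by
    refine ((hasDerivAt_pow (k + 1) y).div_const _).congr_deriv ?_
    rw [Nat.cast_add_one, Nat.add_sub_cancel, mul_div_cancel_left₀ _ (Nat.cast_add_one_ne_zero k)]
  refine ((hpow.ofReal_comp.const_mul a₀).sub
    ((hasDerivAt_constGrowth k hy).ofReal_comp.const_mul b₀)).congr_deriv ?_
  have : (y : ℂ) ≠ 0 := Complex.ofReal_ne_zero.2 hy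
  push_cast
  field_simp
  ring

theorem regHalf_eq_altHalf {Γ : Subgroup SL(2, ℤ)} {k : ℕ} {G : ℍ → ℂ} {σ : SL(2, ℤ)}
    (hα : 0 < cuspWidth Γ σ)
    (hexp : IsFourierExpansion k (cuspWidth Γ σ) (G ∣[(2 * k + 2 : ℤ)] σ)
      (fourierCoeffs k (cuspWidth Γ σ) (G ∣[(2 * k + 2 : ℤ)] σ)).1
      (fourierCoeffs k (cuspWidth Γ σ) (G ∣[(2 * k + 2 : ℤ)] σ)).2)
    (hξ : IsXiExpansion k (cuspWidth Γ σ)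
      (fourierCoeffs k (cuspWidth Γ σ) (G ∣[(2 * k + 2 : ℤ)] σ)).2
      (constCoeff (cuspWidth Γ σ) ((xi (2 * k + 2) G) ∣[(-(2 * k) : ℤ)] σ))
      (xi (2 * k + 2) (G ∣[(2 * k + 2 : ℤ)] σ)))
    (hcont : ContinuousOn (ext (G ∣[(2 * k + 2 : ℤ)] σ)) {z | 0 < z.im})
    (r : ℝ) {c S T : ℝ} (hc : 0 < c) (hS : 0 < S) (hT : 0 < T) :
    regHalf Γ k G σ r c S = altHalf Γ k G σ r c T := by
  have hint {x y : ℝ} (hx : 0 < x) (hy : 0 < y) : IntervalIntegrable (fun y : ℝ =>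
      ext (G ∣[(2 * k + 2 : ℤ)] σ) (r + y * Complex.I) * (y : ℂ) ^ k) volume x y := by
    refine ContinuousOn.intervalIntegrable
      (ContinuousOn.mul (hcont.comp (by fun_prop) fun t ht => ?_) (by fun_prop))
    rw [mem_ofPred_eq, im_ofReal_add_mul_I]
    exact (lt_min hx hy).trans_le ht.1
  have hregS := hexp.tsum_add_tsum_eq_tsum_regTerm hα hξ r hS
  have hregT := hasSum_regTerm hα hexp hξ r hT
  have hdiff := (hexp.hasSum_regTerm_sub hα r hS hT).tsum_eq
  have hadjacent := intervalIntegral.integral_add_adjacent_intervals (hint hc hT) (hint hT hS)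
  rw [hregT.summable.tsum_sub (hasSum_regTerm hα hexp hξ r hS).summable, hregT.tsum_eq] at hdiff
  simp only [sub_mul] at hdiff
  rw [intervalIntegral.integral_sub (hint hT hS)
    (intervalIntegrable_const_add_inv_pow_mul_pow k _ _ hS hT),
    integral_const_add_inv_pow_mul_pow k _ _ hS hT] at hdiff
  simp only [bernoulliPart, xiPart, symPolygamma] at hdiff
  simp only [expMoment, regTail, angularFreq] at hregS
  simp only [regHalf, altHalf]
  linear_combination hregS - hadjacent - hdiff

/-! ### Fourier series on the upper half-plane -/

theorem fourierCoeffOn_zero_one (h : ℝ → ℂ) (n : ℤ) :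
    fourierCoeffOn zero_lt_one h n = ∫ x in (0 : ℝ)..1, h x * e (((-n : ℤ) : ℂ) * x) := by
  rw [fourierCoeffOn_eq_integral]
  simp only [sub_zero, div_one, one_smul]
  refine intervalIntegral.integral_congr fun x _ => ?_
  simp only [fourier_coe_apply, smul_eq_mul]
  rw [mul_comm, e]
  push_cast
  ring_nf

theorem norm_fourierCoeffOn_zero_one_le {h : ℝ → ℂ} {C : ℝ} (hC : ∀ x ∈ Icc (0 : ℝ) 1, ‖h x‖ ≤ C)
    (n : ℤ) : ‖fourierCoeffOn zero_lt_one h n‖ ≤ C := by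
  have hle : ∀ x ∈ uIoc (0 : ℝ) 1, ‖h x * e (((-n : ℤ) : ℂ) * x)‖ ≤ C := fun x hx => by
    rw [uIoc_of_le zero_le_one] at hx
    rw [norm_mul, norm_e]
    simpa using hC x ⟨hx.1.le, hx.2⟩
  simpa only [fourierCoeffOn_zero_one, sub_zero, abs_one, mul_one] using
    intervalIntegral.norm_integral_le_of_norm_le_const hle

theorem norm_fourierCoeffOn_le_of_hasDerivAt {h h' : ℝ → ℂ} (hh : ∀ x, HasDerivAt h (h' x) x)
    (hh' : Continuous h') (hends : h 1 = h 0) {n : ℤ} (hn : n ≠ 0) :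
    ‖fourierCoeffOn zero_lt_one h n‖ ≤ |(n : ℝ)|⁻¹ * ‖fourierCoeffOn zero_lt_one h' n‖ := by
  have hpos : 0 < |(n : ℝ)| := abs_pos.2 (Int.cast_ne_zero.2 hn)
  have hle : |(n : ℝ)| ≤ 2 * Real.pi * |(n : ℝ)| :=
    le_mul_of_one_le_left hpos.le (by linarith [Real.pi_gt_three])
  rw [fourierCoeffOn_of_hasDerivAt zero_lt_one hn (fun x _ => hh x)
    (hh'.intervalIntegrable _ _), hends]
  simp only [sub_self, mul_zero, zero_sub, Complex.ofReal_one, Complex.ofReal_zero, sub_zero,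
    one_mul, norm_mul, norm_neg, norm_div, norm_one, Complex.norm_intCast, Complex.norm_I,
    mul_one, Complex.norm_real, Complex.norm_ofNat, Real.norm_eq_abs, abs_of_pos Real.pi_pos]
  rw [one_div]
  gcongr

theorem summable_fourierCoeffOn_of_contDiff {h : ℝ → ℂ} (hh : ContDiff ℝ 2 h)
    (hper : Function.Periodic h 1) : Summable (fourierCoeffOn zero_lt_one h) := by
  have hh' : ContDiff ℝ 1 (deriv h) := ((contDiff_succ_iff_deriv (n := 1)).1 hh).2.2
  have hh'' : Continuous (deriv (deriv h)) :=
    ((contDiff_succ_iff_deriv (n := 0)).1 hh').2.2.continuous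
  have hper' : deriv h (0 + 1) = deriv h 0 := by
    rw [← deriv_comp_add_const]
    exact congrArg (deriv · 0) (funext hper)
  obtain ⟨C, hC⟩ := isCompact_Icc.exists_bound_of_continuousOn (hh''.continuousOn (s := Icc 0 1))
  have hdecay {n : ℤ} (hn : n ≠ 0) : ‖fourierCoeffOn zero_lt_one h n‖ ≤ C * (1 / (n : ℝ) ^ 2) :=
    calc ‖fourierCoeffOn zero_lt_one h n‖
        ≤ |(n : ℝ)|⁻¹ * ‖fourierCoeffOn zero_lt_one (deriv h) n‖ :=
          norm_fourierCoeffOn_le_of_hasDerivAt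
            (fun x => (hh.differentiable two_ne_zero x).hasDerivAt) hh'.continuous
            (by simpa only [zero_add] using hper 0) hn
      _ ≤ |(n : ℝ)|⁻¹ * (|(n : ℝ)|⁻¹ * ‖fourierCoeffOn zero_lt_one (deriv (deriv h)) n‖) := by
          gcongr
          exact norm_fourierCoeffOn_le_of_hasDerivAt
            (fun x => (hh'.differentiable one_ne_zero x).hasDerivAt) hh''
            (by simpa only [zero_add] using hper') hn
      _ ≤ |(n : ℝ)|⁻¹ * (|(n : ℝ)|⁻¹ * C) := by
          gcongr
          exact norm_fourierCoeffOn_zero_one_le hC n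
      _ = C * (1 / (n : ℝ) ^ 2) := by rw [← sq_abs]; ring
  refine Summable.of_norm_bounded_eventually
    ((Real.summable_one_div_int_pow.2 one_lt_two).mul_left C) ?_
  filter_upwards [(Set.finite_singleton (0 : ℤ)).compl_mem_cofinite] with n hn
  exact hdecay hn

theorem hasSum_fourier_of_contDiff {h : ℝ → ℂ} (hh : ContDiff ℝ 2 h)
    (hper : Function.Periodic h 1) (x : ℝ) :
    HasSum (fun n : ℤ => (∫ x in (0 : ℝ)..1, h x * e (((-n : ℤ) : ℂ) * x)) * e (n * x)) (h x) := by
  have : Fact ((0 : ℝ) < 1) := ⟨zero_lt_one⟩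
  let f : C(AddCircle (1 : ℝ), ℂ) := ⟨hper.lift, continuous_coinduced_dom.mpr hh.continuous⟩
  have hcoeff (n : ℤ) : fourierCoeff f n = fourierCoeffOn zero_lt_one h n := by
    rw [fourierCoeff_eq_intervalIntegral _ _ 0, fourierCoeffOn_zero_one]
    simp only [zero_add, div_one, one_smul]
    refine intervalIntegral.integral_congr fun x _ => ?_
    simp only [fourier_coe_apply, smul_eq_mul, f, ContinuousMap.coe_mk,
      Function.Periodic.lift_coe]
    rw [mul_comm, e]
    push_cast
    ring_nf
  have hsummable : Summable (fourierCoeff f) :=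
    (summable_fourierCoeffOn_of_contDiff hh hper).congr fun n => (hcoeff n).symm
  refine (has_pointwise_sum_fourier_series_of_summable hsummable
    (x : AddCircle (1 : ℝ))).congr_fun fun n => ?_
  rw [hcoeff, fourierCoeffOn_zero_one, smul_eq_mul, fourier_coe_apply, e]
  push_cast
  ring_nf

theorem isOpen_im_pos : IsOpen {z : ℂ | 0 < z.im} :=
  isOpen_lt continuous_const Complex.continuous_im

/-- The coefficient of `e(nz)` in the Fourier series of the function `H`, of period `1`, on the
horizontal line at height `t`. -/
noncomputable def heightCoeff (H : ℂ → ℂ) (n : ℤ) (t : ℝ) : ℂ :=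
  segInt t fun z => H z * e (-n * z)

theorem heightCoeff_mul_e (H : ℂ → ℂ) (n : ℤ) (z : ℂ) :
    heightCoeff H n z.im * e (n * z) =
      (∫ x in (0 : ℝ)..1, H (x + z.im * Complex.I) * e (((-n : ℤ) : ℂ) * x)) * e (n * z.re) := by
  rw [heightCoeff, segInt, ← intervalIntegral.integral_mul_const,
    ← intervalIntegral.integral_mul_const]
  refine intervalIntegral.integral_congr fun x _ => ?_
  simp only [mul_assoc, ← e_add]
  congr 2
  push_cast
  linear_combination -(n : ℂ) * Complex.re_add_im z

theorem hasSum_heightCoeff_mul_e {H : ℂ → ℂ} (hH : ContDiffOn ℝ 2 H {z | 0 < z.im})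
    (hper : ∀ z, 0 < z.im → H (z + 1) = H z) {z : ℂ} (hz : 0 < z.im) :
    HasSum (fun n : ℤ => heightCoeff H n z.im * e (n * z)) (H z) := by
  have him (x : ℝ) : 0 < ((x : ℂ) + z.im * Complex.I).im := by rwa [im_ofReal_add_mul_I]
  have hsmooth : ContDiff ℝ 2 (fun x : ℝ => H (x + z.im * Complex.I)) := by
    rw [← contDiffOn_univ]
    exact hH.comp (Complex.ofRealCLM.contDiff.add contDiff_const).contDiffOn fun x _ => him x
  have hperiodic : Function.Periodic (fun x : ℝ => H (x + z.im * Complex.I)) 1 := fun x => by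
    simp only [← hper _ (him x)]
    push_cast
    rw [add_right_comm]
  have hsum := hasSum_fourier_of_contDiff hsmooth hperiodic z.re
  simp only [Complex.re_add_im] at hsum
  exact hsum.congr_fun fun n => heightCoeff_mul_e H n z

/-! ### The Cauchy–Riemann operator -/

/-- The Cauchy–Riemann operator `∂/∂x + i ∂/∂y`, which is twice `∂/∂z̄`. -/
noncomputable def dbar (F : ℂ → ℂ) (z : ℂ) : ℂ := dX F z + Complex.I * dY F z

theorem dbar_eq_zero {F : ℂ → ℂ} {z : ℂ} (hF : DifferentiableAt ℂ F z) : dbar F z = 0 := by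
  have hlinear : fderiv ℂ F z Complex.I = Complex.I * fderiv ℂ F z 1 := by
    rw [← smul_eq_mul, ← map_smul, smul_eq_mul, mul_one]
  rw [dbar, dX, dY, hF.fderiv_restrictScalars ℝ, ContinuousLinearMap.coe_restrictScalars', hlinear]
  linear_combination fderiv ℂ F z 1 * Complex.I_sq

theorem dbar_mul_of_differentiableAt {F f : ℂ → ℂ} {z : ℂ} (hF : DifferentiableAt ℝ F z)
    (hf : DifferentiableAt ℂ f z) : dbar (fun z => F z * f z) z = dbar F z * f z := by
  have hzero := dbar_eq_zero hf
  simp only [dbar, dX, dY] at hzero ⊢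
  rw [fderiv_fun_mul hF (hf.restrictScalars ℝ)]
  simp only [add_apply, smul_apply, smul_eq_mul]
  linear_combination F z * hzero

theorem dbar_add_const {F : ℂ → ℂ} {a z : ℂ} (h : ∀ᶠ w in 𝓝 z, F (w + a) = F w) :
    dbar F (z + a) = dbar F z := by
  have hfderiv : fderiv ℝ F (z + a) = fderiv ℝ F z := by
    rw [← fderiv_comp_add_right]
    exact Filter.EventuallyEq.fderiv_eq h
  simp only [dbar, dX, dY, hfderiv]

theorem clm_apply_eq_re_mul_add_im_mul (L : ℂ →L[ℝ] ℂ) (w : ℂ) :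
    L w = w.re * L 1 + w.im * L Complex.I := by
  conv_lhs => rw [← Complex.re_add_im w, map_add, ← mul_one (w.re : ℂ), ← Complex.real_smul,
    ← Complex.real_smul, map_smul, map_smul, Complex.real_smul, Complex.real_smul]

theorem dbar_comp {F m : ℂ → ℂ} {m' z : ℂ} (hF : DifferentiableAt ℝ F (m z))
    (hm : HasDerivAt m m' z) :
    dbar (fun z => F (m z)) z = (starRingEnd ℂ) m' * dbar F (m z) := by
  have hfderiv : fderiv ℝ (fun z => F (m z)) z =
      (fderiv ℝ F (m z)).comp ((ContinuousLinearMap.toSpanSingleton ℂ m').restrictScalars ℝ) :=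
    (hF.hasFDerivAt.comp z (hm.hasFDerivAt.restrictScalars ℝ)).fderiv
  have hconj : (starRingEnd ℂ) m' = m'.re - m'.im * Complex.I := by
    apply Complex.ext <;> simp
  simp only [dbar, dX, dY, hfderiv, ContinuousLinearMap.comp_apply,
    ContinuousLinearMap.coe_restrictScalars', ContinuousLinearMap.toSpanSingleton_apply,
    smul_eq_mul, one_mul, hconj]
  rw [clm_apply_eq_re_mul_add_im_mul _ m', clm_apply_eq_re_mul_add_im_mul _ (Complex.I * m')]
  simp only [Complex.mul_re, Complex.mul_im, Complex.I_re, Complex.I_im]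
  push_cast
  linear_combination ((m'.im : ℂ) * fderiv ℝ F (m z) Complex.I) * Complex.I_sq

theorem continuous_comp_horizontal_of_pos {f : ℂ → ℂ} (hf : ContinuousOn f {z | 0 < z.im})
    {t : ℝ} (ht : 0 < t) : Continuous fun x : ℝ => f (x + t * Complex.I) :=
  continuous_comp_horizontal (hf.mono fun _ hz => ht.trans_eq hz.symm)

theorem hasFDerivAt_of_contDiffOn_im_pos {H : ℂ → ℂ} (hH : ContDiffOn ℝ 1 H {z | 0 < z.im}) (x : ℝ)
    {t : ℝ} (ht : 0 < t) :
    HasFDerivAt H (fderiv ℝ H (x + t * Complex.I)) (x + t * Complex.I) :=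
  ((hH.differentiableOn one_ne_zero).differentiableAt
    (isOpen_im_pos.mem_nhds (by rwa [mem_ofPred_eq, im_ofReal_add_mul_I]))).hasFDerivAt

theorem continuousOn_fderiv_apply {H : ℂ → ℂ} (hH : ContDiffOn ℝ 1 H {z | 0 < z.im}) (v : ℂ) :
    ContinuousOn (fun z => fderiv ℝ H z v) {z | 0 < z.im} :=
  (hH.continuousOn_fderiv_of_isOpen isOpen_im_pos le_rfl).clm_apply continuousOn_const

theorem segInt_dX_eq_zero {H : ℂ → ℂ} (hH : ContDiffOn ℝ 1 H {z | 0 < z.im})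
    (hper : ∀ z, 0 < z.im → H (z + 1) = H z) {t : ℝ} (ht : 0 < t) : segInt t (dX H) = 0 := by
  have hderiv (x : ℝ) : HasDerivAt (fun x : ℝ => H (x + t * Complex.I))
      (dX H (x + t * Complex.I)) x := by
    refine (hasFDerivAt_of_contDiffOn_im_pos hH x ht).comp_hasDerivAt x ?_
    simpa only [Complex.ofRealCLM_apply, Complex.ofReal_one] using
      (Complex.ofRealCLM.hasDerivAt (x := x)).add_const ((t : ℂ) * Complex.I)
  have hends := hper ((0 : ℝ) + t * Complex.I) (by rwa [im_ofReal_add_mul_I])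
  rw [segInt, intervalIntegral.integral_eq_sub_of_hasDerivAt (fun x _ => hderiv x)
    ((continuous_comp_horizontal_of_pos (continuousOn_fderiv_apply hH 1) ht).intervalIntegrable
      _ _), sub_eq_zero, ← hends, add_right_comm]
  push_cast
  rw [zero_add]

theorem hasDerivAt_segInt_dY {H : ℂ → ℂ} (hH : ContDiffOn ℝ 1 H {z | 0 < z.im}) {t : ℝ}
    (ht : 0 < t) : HasDerivAt (fun t => segInt t H) (segInt t (dY H)) t := by
  have hderiv (x : ℝ) {s : ℝ} (hs : 0 < s) : HasDerivAt (fun s : ℝ => H (x + s * Complex.I))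
      (dY H (x + s * Complex.I)) s := by
    refine (hasFDerivAt_of_contDiffOn_im_pos hH x hs).comp_hasDerivAt s ?_
    simpa only [Complex.ofRealCLM_apply, Complex.ofReal_one, one_mul] using
      ((Complex.ofRealCLM.hasDerivAt (x := s)).mul_const Complex.I).const_add (x : ℂ)
  have hY : ContinuousOn (dY H) {z | 0 < z.im} := continuousOn_fderiv_apply hH Complex.I
  have hcompact : IsCompact (uIcc (0 : ℝ) 1 ×ℂ Icc (t / 2) (2 * t)) :=
    isCompact_uIcc.reProdIm isCompact_Icc
  obtain ⟨C, hC⟩ := hcompact.exists_bound_of_continuousOn (hY.mono fun z hz =>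
    (half_pos ht).trans_le (Complex.mem_reProdIm.1 hz).2.1)
  have hnhds : Ioo (t / 2) (2 * t) ∈ 𝓝 t := Ioo_mem_nhds (by linarith) (by linarith)
  have hpos {s : ℝ} (hs : s ∈ Ioo (t / 2) (2 * t)) : 0 < s := (half_pos ht).trans hs.1
  refine (intervalIntegral.hasDerivAt_integral_of_dominated_loc_of_deriv_le
    (μ := volume) (a := (0 : ℝ)) (b := 1) (F := fun (s : ℝ) (x : ℝ) => H (x + s * Complex.I))
    (F' := fun (s : ℝ) (x : ℝ) => dY H (x + s * Complex.I)) (bound := fun _ => C) hnhds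
    ?_ ((continuous_comp_horizontal_of_pos hH.continuousOn ht).intervalIntegrable _ _)
    (continuous_comp_horizontal_of_pos hY ht).aestronglyMeasurable
    (Eventually.of_forall fun x hx s hs => hC _ (Complex.mem_reProdIm.2 ⟨?_, ?_⟩))
    intervalIntegrable_const
    (Eventually.of_forall fun x _ s hs => hderiv x (hpos hs))).2
  · filter_upwards [hnhds] with s hs
    exact (continuous_comp_horizontal_of_pos hH.continuousOn (hpos hs)).aestronglyMeasurable
  · rw [re_ofReal_add_mul_I]
    exact uIoc_subset_uIcc hx
  · rw [im_ofReal_add_mul_I]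
    exact Ioo_subset_Icc_self hs

theorem hasDerivAt_segInt {H : ℂ → ℂ} (hH : ContDiffOn ℝ 1 H {z | 0 < z.im})
    (hper : ∀ z, 0 < z.im → H (z + 1) = H z) {t : ℝ} (ht : 0 < t) :
    HasDerivAt (fun t => segInt t H) (-Complex.I * segInt t (dbar H)) t := by
  have hcont (v : ℂ) : ContinuousOn (fun z => fderiv ℝ H z v) {z | z.im = t} :=
    (continuousOn_fderiv_apply hH v).mono fun _ hz => ht.trans_eq hz.symm
  have hdbar : segInt t (dbar H) = segInt t (dX H) + Complex.I * segInt t (dY H) := by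
    rw [← segInt_const_mul]
    exact segInt_add (hcont 1) (continuousOn_const.mul (hcont Complex.I))
  refine (hasDerivAt_segInt_dY hH ht).congr_deriv ?_
  rw [hdbar, segInt_dX_eq_zero hH hper ht]
  linear_combination segInt t (dY H) * Complex.I_sq

theorem segInt_eq_of_differentiableOn {H : ℂ → ℂ} (hH : DifferentiableOn ℂ H {z | 0 < z.im})
    (hper : ∀ z, 0 < z.im → H (z + 1) = H z) {s t : ℝ} (hs : 0 < s) (ht : 0 < t) :
    segInt s H = segInt t H := by
  have hends : ∀ y ∈ uIcc s t, H (1 + y * Complex.I) - H (y * Complex.I) = 0 := fun y hy => by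
    have hy' : 0 < y := (lt_min hs ht).trans_le hy.1
    rw [add_comm, hper _ (by simpa using hy'), sub_self]
  rw [eq_comm, ← sub_eq_zero, segInt_sub_segInt hs ht hH, intervalIntegral.integral_congr hends]
  simp only [intervalIntegral.integral_zero, mul_zero]

theorem segInt_conj (t : ℝ) (F : ℂ → ℂ) :
    segInt t (fun z => (starRingEnd ℂ) (F z)) = (starRingEnd ℂ) (segInt t F) :=
  intervalIntegral.intervalIntegral_conj

/-! ### Fourier coefficients as functions of the height -/

/-- The function of the height which accompanies the coefficient `a⁻(n)`. -/
noncomputable def minusFun (k α : ℕ) (n : ℤ) (y : ℝ) : ℝ :=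
  if n = 0 then (y ^ (2 * k + 1))⁻¹ else calE (2 * k + 2) (2 * (angularFreq α n * y))

/-- The constant in the derivative of `minusFun`. -/
noncomputable def minusConst (k α : ℕ) (n : ℤ) : ℝ :=
  if n = 0 then -(2 * k + 1) else ((2 * angularFreq α n) ^ (2 * k + 1))⁻¹

theorem minusConst_ne_zero (k : ℕ) {α : ℕ} (hα : α ≠ 0) (n : ℤ) : minusConst k α n ≠ 0 := by
  rw [minusConst]
  split_ifs with hn
  · exact neg_ne_zero.2 (by positivity)
  · exact inv_ne_zero (pow_ne_zero _ (mul_ne_zero two_ne_zero (angularFreq_ne_zero hα hn)))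

theorem hasDerivAt_minusFun (k : ℕ) {α : ℕ} (hα : α ≠ 0) (n : ℤ) {y : ℝ} (hy : y ≠ 0) :
    HasDerivAt (minusFun k α n) (minusConst k α n *
      ((y ^ (2 * k + 2))⁻¹ * Real.exp (2 * (angularFreq α n * y)))) y := by
  rcases eq_or_ne n 0 with rfl | hn
  · have hpow : minusFun k α 0 = fun y => (y ^ (2 * k + 1))⁻¹ := funext fun y => if_pos rfl
    rw [hpow, minusConst, if_pos rfl, angularFreq]
    refine ((hasDerivAt_pow (2 * k + 1) y).fun_inv (pow_ne_zero _ hy)).congr_deriv ?_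
    simp only [Int.cast_zero, zero_div, mul_zero, zero_mul, Real.exp_zero, Nat.add_sub_cancel]
    push_cast
    field_simp
    ring
  · have hω : angularFreq α n ≠ 0 := angularFreq_ne_zero hα hn
    have hcalE : minusFun k α n = fun y => calE (2 * k + 2) (2 * (angularFreq α n * y)) :=
      funext fun y => if_neg hn
    rw [hcalE, minusConst, if_neg hn]
    refine ((hasDerivAt_calE (κ := 2 * k + 2) (by omega)
      (mul_ne_zero two_ne_zero (mul_ne_zero hω hy))).comp y
      (((hasDerivAt_id y).const_mul (angularFreq α n)).const_mul 2)).congr_deriv ?_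
    rw [Even.neg_pow ⟨k + 1, by ring⟩]
    field_simp
    ring

theorem hasDerivAt_minusFun_comp_mul (k : ℕ) {α : ℕ} (hα : α ≠ 0) (n : ℤ) (b : ℂ) {t : ℝ}
    (ht : t ≠ 0) :
    HasDerivAt (fun t : ℝ => b * minusFun k α n (α * t))
      (α * (((α * t) ^ (2 * k + 2))⁻¹ * Real.exp (2 * (angularFreq α n * (α * t))) : ℝ) *
        (b * minusConst k α n)) t := by
  have hαt : (α : ℝ) * t ≠ 0 := mul_ne_zero (Nat.cast_ne_zero.2 hα) ht
  refine (((hasDerivAt_minusFun k hα n hαt).comp t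
    ((hasDerivAt_id t).const_mul (α : ℝ))).ofReal_comp.const_mul b).congr_deriv ?_
  push_cast
  ring

theorem e_neg_mul_eq_conj (n : ℤ) (z : ℂ) :
    e (-n * z) = (starRingEnd ℂ) (e (n * z)) * (Real.exp (4 * Real.pi * n * z.im) : ℝ) := by
  have hexp : (Real.exp (4 * Real.pi * n * z.im) : ℂ) =
      e (((-2 * n : ℝ) : ℂ) * (z.im * Complex.I)) := by
    rw [e_mul_ofReal_mul_I]
    congr 2
    ring
  rw [hexp, conj_e, ← e_add, map_mul, map_intCast]
  congr 1
  have hconj : (starRingEnd ℂ) z = z - 2 * z.im * Complex.I := by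
    apply Complex.ext <;> simp
    ring
  rw [hconj]
  push_cast
  ring

/-- `H` and `X` stand for the rescalings `z ↦ G(αz)` and `z ↦ (ξ_{2k+2} G)(αz)` of a function `G`
of period `α` and of its image under `ξ_{2k+2}`, which is holomorphic. -/
structure IsRescaledXiPair (k α : ℕ) (H X : ℂ → ℂ) : Prop where
  contDiffOn : ContDiffOn ℝ 2 H {z | 0 < z.im}
  periodic : ∀ z, 0 < z.im → H (z + 1) = H z
  differentiableOn : DifferentiableOn ℂ X {z | 0 < z.im}
  dbar_eq : ∀ z, 0 < z.im → dbar H z =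
    Complex.I * α * (((α * z.im) ^ (2 * k + 2))⁻¹ : ℝ) * (starRingEnd ℂ) (X z)

namespace IsRescaledXiPair

variable {k α : ℕ} {H X : ℂ → ℂ}

theorem contDiffOn_one (h : IsRescaledXiPair k α H X) : ContDiffOn ℝ 1 H {z | 0 < z.im} :=
  h.contDiffOn.of_le one_le_two

theorem periodic_xi (h : IsRescaledXiPair k α H X) (hα : α ≠ 0) (z : ℂ) (hz : 0 < z.im) :
    X (z + 1) = X z := by
  have him : (z + 1).im = z.im := by rw [Complex.add_im, Complex.one_im, add_zero]
  have hdbar : dbar H (z + 1) = dbar H z := dbar_add_const <| by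
    filter_upwards [isOpen_im_pos.mem_nhds hz] with w hw using h.periodic w hw
  rw [h.dbar_eq z hz, h.dbar_eq (z + 1) (hz.trans_eq him.symm), him] at hdbar
  refine (starRingEnd ℂ).injective (mul_left_cancel₀ ?_ hdbar)
  exact mul_ne_zero (mul_ne_zero Complex.I_ne_zero (Nat.cast_ne_zero.2 hα)) (by
    have : (α : ℝ) ≠ 0 := Nat.cast_ne_zero.2 hα
    exact Complex.ofReal_ne_zero.2 (inv_ne_zero (pow_ne_zero _ (mul_ne_zero this hz.ne'))))

theorem hasDerivAt_heightCoeff (h : IsRescaledXiPair k α H X) (hα : α ≠ 0) (n : ℤ) {t : ℝ}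
    (ht : 0 < t) :
    HasDerivAt (heightCoeff H n)
      (α * (((α * t) ^ (2 * k + 2))⁻¹ * Real.exp (2 * (angularFreq α n * (α * t))) : ℝ) *
        (starRingEnd ℂ) (heightCoeff X (-n) t)) t := by
  have hsmooth : ContDiff ℝ 1 (fun z => e (-n * z)) := by
    unfold e
    fun_prop
  refine (hasDerivAt_segInt (h.contDiffOn_one.mul hsmooth.contDiffOn)
    (fun z hz => by rw [h.periodic z hz, e_neg_mul_add_one]) ht).congr_deriv ?_
  rw [segInt_congr (t := t) (g := fun z => Complex.I * α *
      (((α * t) ^ (2 * k + 2))⁻¹ * Real.exp (2 * (angularFreq α n * (α * t))) : ℝ) *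
        (starRingEnd ℂ) (X z * e (-(-n : ℤ) * z))), segInt_const_mul, segInt_conj, heightCoeff]
  · linear_combination -(α *
      (((α * t) ^ (2 * k + 2))⁻¹ * Real.exp (2 * (angularFreq α n * (α * t))) : ℝ) *
        (starRingEnd ℂ) (segInt t fun z => X z * e (-(-n : ℤ) * z))) * Complex.I_sq
  · intro z hz
    have hz' : 0 < z.im := ht.trans_eq hz.symm
    have : (α : ℝ) ≠ 0 := Nat.cast_ne_zero.2 hα
    rw [dbar_mul_of_differentiableAt ((h.contDiffOn_one.differentiableOn
        one_ne_zero).differentiableAt (isOpen_im_pos.mem_nhds hz'))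
      (hasDerivAt_e_mul _ z).differentiableAt, h.dbar_eq z hz', e_neg_mul_eq_conj, map_mul, hz,
      Int.cast_neg, neg_neg, angularFreq,
      show 2 * (2 * Real.pi * ((n : ℝ) / α) * (α * t)) = 4 * Real.pi * n * t by field_simp; ring]
    push_cast
    ring

theorem exists_heightCoeff_eq (h : IsRescaledXiPair k α H X) (hα : α ≠ 0) (n : ℤ) :
    ∃ a b : ℂ, ∀ t, 0 < t → heightCoeff H n t = a + b * minusFun k α n (α * t) := by
  have hconst : (minusConst k α n : ℂ) ≠ 0 := Complex.ofReal_ne_zero.2 (minusConst_ne_zero k hα n)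
  have hX {t : ℝ} (ht : 0 < t) : heightCoeff X (-n) t = heightCoeff X (-n) 1 :=
    segInt_eq_of_differentiableOn (h.differentiableOn.fun_mul fun z _ =>
      (hasDerivAt_e_mul _ z).differentiableAt.differentiableWithinAt)
      (fun z hz => by rw [h.periodic_xi hα z hz, e_neg_mul_add_one]) ht one_pos
  set b := (starRingEnd ℂ) (heightCoeff X (-n) 1) / minusConst k α n with hb
  have hderiv : ∀ t ∈ Ioi (0 : ℝ),
      HasDerivAt (fun t => heightCoeff H n t - b * minusFun k α n (α * t)) 0 t := fun t ht => by
    refine ((h.hasDerivAt_heightCoeff hα n ht).sub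
      (hasDerivAt_minusFun_comp_mul k hα n b (ne_of_gt ht))).congr_deriv ?_
    rw [hX ht, hb, div_mul_cancel₀ _ hconst, sub_self]
  refine ⟨heightCoeff H n 1 - b * minusFun k α n (α * 1), b, fun t ht => sub_eq_iff_eq_add.1 ?_⟩
  exact isOpen_Ioi.is_const_of_deriv_eq_zero isPreconnected_Ioi
    (fun t ht => (hderiv t ht).differentiableAt.differentiableWithinAt)
    (fun t ht => (hderiv t ht).deriv) ht (mem_Ioi.2 one_pos)

theorem mul_minusConst_eq (h : IsRescaledXiPair k α H X) (hα : α ≠ 0) {n : ℤ} {a b : ℂ}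
    (hab : ∀ t, 0 < t → heightCoeff H n t = a + b * minusFun k α n (α * t)) {t : ℝ} (ht : 0 < t) :
    b * minusConst k α n = (starRingEnd ℂ) (heightCoeff X (-n) t) := by
  have hαt : (α : ℝ) * t ≠ 0 := mul_ne_zero (Nat.cast_ne_zero.2 hα) ht.ne'
  have hderiv := ((hasDerivAt_minusFun_comp_mul k hα n b ht.ne').const_add a).congr_of_eventuallyEq
    (by filter_upwards [Ioi_mem_nhds ht] with s hs using hab s hs)
  refine mul_left_cancel₀ ?_ (hderiv.unique (h.hasDerivAt_heightCoeff hα n ht))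
  exact mul_ne_zero (Nat.cast_ne_zero.2 hα) (Complex.ofReal_ne_zero.2
    (mul_ne_zero (inv_ne_zero (pow_ne_zero _ hαt)) (Real.exp_ne_zero _)))

end IsRescaledXiPair

theorem norm_heightCoeff_le {H : ℂ → ℂ} {M t : ℝ} (hM : ∀ z : ℂ, z.im = t → ‖H z‖ ≤ M) (n : ℤ) :
    ‖heightCoeff H n t‖ ≤ M * Real.exp (2 * Real.pi * n * t) := by
  refine (intervalIntegral.norm_integral_le_of_norm_le_const
    (C := M * Real.exp (2 * Real.pi * n * t)) fun x _ => ?_).trans (by simp)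
  have hz := im_ofReal_add_mul_I x t
  have him : (-n * ((x : ℂ) + t * Complex.I)).im = -(n * t) := by simp
  rw [norm_mul, norm_e, him, mul_neg, neg_neg, ← mul_assoc]
  exact mul_le_mul_of_nonneg_right (hM _ hz) (Real.exp_pos _).le

theorem heightCoeff_isBigO {H : ℂ → ℂ} {A B C : ℝ}
    (hB : ∀ z : ℂ, A ≤ z.im → ‖H z‖ ≤ B * Real.exp (C * z.im)) (n : ℤ) :
    heightCoeff H n =O[atTop] fun t => Real.exp ((C + 2 * Real.pi * n) * t) := by
  refine Asymptotics.IsBigO.of_bound B ?_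
  filter_upwards [eventually_ge_atTop A] with t ht
  rw [Real.norm_eq_abs, Real.abs_exp, add_mul, Real.exp_add, ← mul_assoc]
  exact norm_heightCoeff_le (fun z hz => hz ▸ hB z (ht.trans_eq hz.symm)) n

theorem minusFun_mul_of_ne_zero (k : ℕ) {α : ℕ} (hα : α ≠ 0) {n : ℤ} (hn : n ≠ 0) (t : ℝ) :
    minusFun k α n (α * t) = calE (2 * k + 2) (4 * Real.pi * n * t) := by
  have : (α : ℝ) ≠ 0 := Nat.cast_ne_zero.2 hα
  rw [minusFun, if_neg hn, angularFreq]
  congr 1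
  field_simp
  ring

theorem plus_eq_zero_of_isBigO {k α : ℕ} (hα : α ≠ 0) {n : ℤ} (hn : n < 0) {a b : ℂ} {δ : ℝ}
    (hδ : δ < 0) (h : (fun t : ℝ => a + b * minusFun k α n (α * t)) =O[atTop]
      fun t => Real.exp (δ * t)) : a = 0 := by
  have hneg : 4 * Real.pi * n < 0 :=
    mul_neg_of_pos_of_neg (mul_pos four_pos Real.pi_pos) (Int.cast_lt_zero.2 hn)
  have hcalE : Tendsto (fun t : ℝ => minusFun k α n (α * t)) atTop (𝓝 0) :=
    ((tendsto_calE_atBot _).comp (tendsto_id.const_mul_atTop_of_neg hneg)).congr fun t =>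
      (minusFun_mul_of_ne_zero k hα hn.ne t).symm
  have hlim : Tendsto (fun t : ℝ => a + b * minusFun k α n (α * t)) atTop (𝓝 (a + b * (0 : ℝ))) :=
    (((Complex.continuous_ofReal.tendsto 0).comp hcalE).const_mul b).const_add a
  have hzero := h.trans_tendsto (Real.tendsto_exp_atBot.comp (tendsto_id.const_mul_atTop_of_neg hδ))
  simpa using tendsto_nhds_unique hlim hzero

theorem exp_mul_isLittleO_minusFun (k : ℕ) {α : ℕ} (hα : α ≠ 0) {n : ℤ} (hn : 0 < n) {δ : ℝ}
    (hδ : δ < 4 * Real.pi * n) :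
    (fun t => Real.exp (δ * t)) =o[atTop] fun t => minusFun k α n (α * t) := by
  have hpos : 0 < 4 * Real.pi * n := mul_pos (mul_pos four_pos Real.pi_pos) (Int.cast_pos.2 hn)
  refine ((exp_mul_isLittleO_calE (by omega) ((div_lt_one hpos).2 hδ)).comp_tendsto
    (tendsto_id.const_mul_atTop hpos)).congr (fun t => ?_) fun t =>
      (minusFun_mul_of_ne_zero k hα hn.ne' t).symm
  rw [Function.comp_apply, id, ← mul_assoc, div_mul_cancel₀ _ hpos.ne']

theorem minus_eq_zero_of_isBigO {k α : ℕ} (hα : α ≠ 0) {n : ℤ} (hn : 0 < n) {a b : ℂ} {δ : ℝ}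
    (hδ : δ < 4 * Real.pi * n) (h : (fun t : ℝ => a + b * minusFun k α n (α * t)) =O[atTop]
      fun t => Real.exp (δ * t)) : b = 0 := by
  have hpos : 0 < 4 * Real.pi * n := mul_pos (mul_pos four_pos Real.pi_pos) (Int.cast_pos.2 hn)
  have hone := exp_mul_isLittleO_minusFun k hα hn hpos
  simp only [zero_mul, Real.exp_zero] at hone
  by_contra hb
  have hlittle : (fun t : ℝ => b * (minusFun k α n (α * t) : ℂ)) =o[atTop]
      fun t => minusFun k α n (α * t) := by
    refine ((h.trans_isLittleO (exp_mul_isLittleO_minusFun k hα hn hδ)).sub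
      ((Asymptotics.isBigO_const_const a one_ne_zero atTop).trans_isLittleO hone)).congr_left ?_
    exact fun t => add_sub_cancel_left _ _
  refine Asymptotics.isLittleO_irrefl ?_
    (Complex.isLittleO_ofReal_left.1 ((Asymptotics.isLittleO_const_mul_left_iff hb).1 hlittle))
  refine (hone.isBigO.eq_zero_imp.mono fun t himp hzero => ?_).frequently
  exact one_ne_zero (himp hzero)

/-! ### Existence of the Fourier expansion -/

theorem ext_coe (G : ℍ → ℂ) (z : ℍ) : ext G z = G z := by
  rw [ext, UpperHalfPlane.ofComplex_apply]

theorem xi_eq (κ : ℤ) (G : ℍ → ℂ) (z : ℍ) :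
    xi κ G z = Complex.I * (z.im : ℂ) ^ κ * (starRingEnd ℂ) (dbar (ext G) z) := by
  rw [xi, dbar, map_div₀, map_ofNat]
  ring

theorem ext_xi (κ : ℤ) (G : ℍ → ℂ) {z : ℂ} (hz : 0 < z.im) :
    ext (xi κ G) z = Complex.I * (z.im : ℂ) ^ κ * (starRingEnd ℂ) (dbar (ext G) z) := by
  rw [ext_of_im_pos _ hz, xi_eq]
  rfl

theorem im_natCast_mul (α : ℕ) (z : ℂ) : ((α : ℂ) * z).im = α * z.im := by
  rw [← Complex.ofReal_natCast, Complex.im_ofReal_mul]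

theorem im_natCast_mul_pos {α : ℕ} (hα : 0 < α) {z : ℂ} (hz : 0 < z.im) :
    0 < ((α : ℂ) * z).im := by
  rw [im_natCast_mul]
  exact mul_pos (Nat.cast_pos.2 hα) hz

theorem dbar_ext_natCast_mul (k : ℕ) {α : ℕ} (hα : 0 < α) {g : ℍ → ℂ}
    (hg : DifferentiableOn ℝ (ext g) {z | 0 < z.im}) {z : ℂ} (hz : 0 < z.im) :
    dbar (fun z => ext g (α * z)) z = Complex.I * α * (((α * z.im) ^ (2 * k + 2))⁻¹ : ℝ) *
      (starRingEnd ℂ) (ext (xi (2 * k + 2) g) (α * z)) := by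
  have hz' := im_natCast_mul_pos hα hz
  have hy : (α : ℂ) * z.im ≠ 0 := by
    exact_mod_cast (mul_pos (Nat.cast_pos.2 hα) hz).ne'
  have hκ : 2 * (k : ℤ) + 2 = ((2 * k + 2 : ℕ) : ℤ) := by push_cast; rfl
  rw [dbar_comp (m := fun z => α * z) (hg.differentiableAt (isOpen_im_pos.mem_nhds hz'))
    ((hasDerivAt_id z).const_mul (α : ℂ)), ext_xi _ _ hz', im_natCast_mul, hκ, zpow_natCast]
  simp only [map_mul, mul_one, Complex.conj_natCast, Complex.conj_I, map_pow, Complex.conj_ofReal,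
    Complex.conj_conj]
  push_cast
  field_simp
  linear_combination (α * dbar (ext g) (α * z)) * Complex.I_sq

theorem isRescaledXiPair (k : ℕ) {α : ℕ} (hα : 0 < α) {g : ℍ → ℂ}
    (hg : ContDiffOn ℝ 2 (ext g) {z | 0 < z.im})
    (hper : ∀ z, 0 < z.im → ext g (z + α) = ext g z)
    (hξ : DifferentiableOn ℂ (ext (xi (2 * k + 2) g)) {z | 0 < z.im}) :
    IsRescaledXiPair k α (fun z => ext g (α * z)) (fun z => ext (xi (2 * k + 2) g) (α * z)) where
  contDiffOn := hg.comp (by fun_prop) fun _ hz => im_natCast_mul_pos hα hz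
  periodic z hz := by
    rw [mul_add, mul_one]
    exact hper _ (im_natCast_mul_pos hα hz)
  differentiableOn := hξ.comp (by fun_prop) fun _ hz => im_natCast_mul_pos hα hz
  dbar_eq z hz := dbar_ext_natCast_mul k hα (hg.differentiableOn two_ne_zero) hz

theorem segInt_e_mul_e_neg (n m : ℤ) (t : ℝ) :
    segInt t (fun z => e (n * z) * e (-m * z)) = if n = m then 1 else 0 := by
  have hmul (z : ℂ) : e (n * z) * e (-m * z) = e ((n - m : ℤ) * z) := by
    rw [← e_add]
    congr 1
    push_cast
    ring
  simp only [hmul]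
  split_ifs with hnm
  · simp [hnm, segInt, e_zero]
  · exact segInt_e_intCast_mul (sub_ne_zero.2 hnm) t

theorem minusFun_mul_e (k : ℕ) {α : ℕ} (hα : α ≠ 0) (n : ℤ) (a b z : ℂ) :
    (a + b * minusFun k α n (α * z.im)) * e (n * z) =
      (a + b * (if n = 0 then ((α * z : ℂ).im ^ (2 * k + 1))⁻¹
        else calE (2 * k + 2) (4 * Real.pi * (n / α) * (α * z : ℂ).im) : ℝ)) *
          e (n / α * (α * z)) := by
  have : (α : ℂ) ≠ 0 := Nat.cast_ne_zero.2 hα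
  rw [im_natCast_mul, minusFun, four_pi_mul_eq_two_mul_angularFreq]
  congr 2
  field_simp

theorem IsFourierExpansion.hasSum_minusFun {k α : ℕ} (hα : 0 < α) {g : ℍ → ℂ} {a b : ℤ → ℂ}
    (h : IsFourierExpansion k α g a b) {z : ℂ} (hz : 0 < z.im) :
    HasSum (fun n : ℤ => (a n + b n * minusFun k α n (α * z.im)) * e (n * z))
      (ext g (α * z)) := by
  have hz' := im_natCast_mul_pos hα hz
  rw [ext_of_im_pos _ hz']
  exact (h.hasSum ⟨_, hz'⟩).congr_fun fun n => minusFun_mul_e k hα.ne' n _ _ z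

theorem IsFourierExpansion.heightCoeff_eq {k α : ℕ} (hα : 0 < α) {g : ℍ → ℂ} {a b : ℤ → ℂ}
    (h : IsFourierExpansion k α g a b) (m : ℤ) {t : ℝ} (ht : 0 < t) :
    heightCoeff (fun z => ext g (α * z)) m t = a m + b m * minusFun k α m (α * t) := by
  have hsum := hasSum_segInt (φ := fun z => e (-m * z))
    (fun z (hz : z.im = t) => by simpa only [hz] using h.hasSum_minusFun hα (ht.trans_eq hz.symm))
    (continuous_e.comp (by fun_prop)).continuousOn
  simp only [segInt_e_mul_e_neg] at hsum
  refine hsum.unique ((hasSum_ite_eq m _).congr_fun fun n => ?_)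
  split_ifs with hnm
  · rw [hnm, mul_one]
  · rw [mul_zero]

theorem norm_ext_natCast_mul_le {α : ℕ} (hα : 0 < α) {g : ℍ → ℂ} {A B C : ℝ}
    (hgrowth : ∀ z : ℍ, A ≤ z.im → ‖g z‖ ≤ B * Real.exp (C * z.im)) {z : ℂ}
    (hz : max (A / α) 1 ≤ z.im) : ‖ext g (α * z)‖ ≤ B * Real.exp (C * α * z.im) := by
  have hz' := im_natCast_mul_pos hα (one_pos.trans_le ((le_max_right _ _).trans hz))
  have hA : A ≤ ((α : ℂ) * z).im := by
    rw [im_natCast_mul, mul_comm]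
    exact (div_le_iff₀ (Nat.cast_pos.2 hα)).1 ((le_max_left _ _).trans hz)
  rw [ext_of_im_pos _ hz', mul_assoc, ← im_natCast_mul]
  exact hgrowth ⟨_, hz'⟩ hA

theorem add_two_pi_mul_neg {C : ℝ} {n : ℤ} (hn : n < ⌊-C / (2 * Real.pi)⌋) :
    C + 2 * Real.pi * n < 0 := by
  have hlt := lt_of_lt_of_le (Int.cast_lt.2 hn) (Int.floor_le (-C / (2 * Real.pi)))
  rw [lt_div_iff₀ Real.two_pi_pos] at hlt
  linarith

theorem add_two_pi_mul_lt {C : ℝ} {n : ℤ} (hn : ⌈C / (2 * Real.pi)⌉ < n) :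
    C + 2 * Real.pi * n < 4 * Real.pi * n := by
  have hlt := lt_of_le_of_lt (Int.le_ceil (C / (2 * Real.pi))) (Int.cast_lt.2 hn)
  rw [div_lt_iff₀ Real.two_pi_pos] at hlt
  linarith

section Existence

variable {k α : ℕ} {g : ℍ → ℂ}

theorem exists_isFourierExpansion (hα : 0 < α)
    (hpair : IsRescaledXiPair k α (fun z => ext g (α * z))
      (fun z => ext (xi (2 * k + 2) g) (α * z)))
    (hgrowth : ∃ A B C : ℝ, ∀ z : ℍ, A ≤ z.im → ‖g z‖ ≤ B * Real.exp (C * z.im)) :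
    ∃ a b : ℤ → ℂ, IsFourierExpansion k α g a b := by
  choose a b hab using hpair.exists_heightCoeff_eq hα.ne'
  obtain ⟨A, B, C, hbound⟩ := hgrowth
  have hcoeff (n : ℤ) : (fun t : ℝ => a n + b n * minusFun k α n (α * t)) =O[atTop]
      fun t => Real.exp ((C * α + 2 * Real.pi * n) * t) :=
    (heightCoeff_isBigO (fun z hz => norm_ext_natCast_mul_le hα hbound hz) n).congr'
      (by filter_upwards [eventually_gt_atTop 0] with t ht using hab n t ht) EventuallyEq.rfl
  refine ⟨a, b, ⟨min 0 ⌊-(C * α) / (2 * Real.pi)⌋, fun n hn => ?_⟩,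
    ⟨max 0 ⌈C * α / (2 * Real.pi)⌉, fun n hn => ?_⟩, fun z => ?_⟩
  · exact plus_eq_zero_of_isBigO hα.ne' (hn.trans_le (min_le_left _ _))
      (add_two_pi_mul_neg (hn.trans_le (min_le_right _ _))) (hcoeff n)
  · exact minus_eq_zero_of_isBigO hα.ne' ((le_max_left _ _).trans_lt hn)
      (add_two_pi_mul_lt ((le_max_right _ _).trans_lt hn)) (hcoeff n)
  · have hαz : (α : ℂ) * (z / α) = z := mul_div_cancel₀ _ (Nat.cast_ne_zero.2 hα.ne')
    have hz : 0 < ((z : ℂ) / α).im := by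
      rw [Complex.div_natCast_im]
      exact div_pos z.im_pos (Nat.cast_pos.2 hα)
    have hsum := hasSum_heightCoeff_mul_e hpair.contDiffOn hpair.periodic hz
    simp only [hab _ _ hz, minusFun_mul_e k hα.ne', hαz, ext_coe] at hsum
    exact hsum

theorem isFourierExpansion_fourierCoeffs (h : ∃ a b : ℤ → ℂ, IsFourierExpansion k α g a b) :
    IsFourierExpansion k α g (fourierCoeffs k α g).1 (fourierCoeffs k α g).2 := by
  obtain ⟨a, b, hab⟩ := h
  have hpair : ∃ p : (ℤ → ℂ) × (ℤ → ℂ), IsFourierExpansion k α g p.1 p.2 := ⟨(a, b), hab⟩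
  rw [fourierCoeffs, dif_pos hpair]
  exact hpair.choose_spec

theorem constCoeff_eq_heightCoeff (hα : α ≠ 0) (F : ℍ → ℂ) :
    constCoeff α F = heightCoeff (fun z => ext F (α * z)) 0 (1 / α) := by
  have hαC : (α : ℂ) ≠ 0 := Nat.cast_ne_zero.2 hα
  have hscale := intervalIntegral.smul_integral_comp_mul_left (a := 0) (b := 1)
    (fun x : ℝ => ext F (x + Complex.I)) (α : ℝ)
  rw [mul_zero, mul_one] at hscale
  rw [constCoeff, ← hscale, Complex.real_smul, Complex.ofReal_natCast, inv_mul_cancel_left₀ hαC]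
  refine intervalIntegral.integral_congr fun x _ => ?_
  simp only [Int.cast_zero, neg_zero, zero_mul, e_zero, mul_one]
  congr 1
  push_cast
  field_simp

theorem conj_mul_minusConst (k α : ℕ) {n : ℤ} (hn : n ≠ 0) (b : ℤ → ℂ) :
    (starRingEnd ℂ) (b n * minusConst k α n) = xiCoeff k α b n := by
  rw [xiCoeff, if_neg hn, minusConst, if_neg hn, map_mul, Complex.conj_ofReal, mul_comm]

theorem IsFourierExpansion.isXiExpansion (hα : 0 < α) {a b : ℤ → ℂ}
    (h : IsFourierExpansion k α g a b)
    (hpair : IsRescaledXiPair k α (fun z => ext g (α * z))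
      (fun z => ext (xi (2 * k + 2) g) (α * z))) :
    IsXiExpansion k α b (constCoeff α (xi (2 * k + 2) g)) (xi (2 * k + 2) g) := by
  set X : ℂ → ℂ := fun z => ext (xi (2 * k + 2) g) (α * z)
  have hcoeff (n : ℤ) {t : ℝ} (ht : 0 < t) :
      heightCoeff X (-n) t = (starRingEnd ℂ) (b n * minusConst k α n) := by
    rw [hpair.mul_minusConst_eq hα.ne' (fun t ht => h.heightCoeff_eq hα n ht) ht,
      Complex.conj_conj]
  intro z
  have hαz : (α : ℂ) * (z / α) = z := mul_div_cancel₀ _ (Nat.cast_ne_zero.2 hα.ne')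
  have hz : 0 < ((z : ℂ) / α).im := by
    rw [Complex.div_natCast_im]
    exact div_pos z.im_pos (Nat.cast_pos.2 hα)
  have hconst : constCoeff α (xi (2 * k + 2) g) = heightCoeff X (-0) ((z : ℂ) / α).im := by
    have hzero := hcoeff 0 (one_div_pos.2 (Nat.cast_pos (α := ℝ).2 hα))
    rw [hcoeff 0 hz, ← hzero, neg_zero, constCoeff_eq_heightCoeff hα.ne']
  have hsum := (Equiv.neg ℤ).hasSum_iff.2 (hasSum_heightCoeff_mul_e
    ((hpair.differentiableOn.contDiffOn isOpen_im_pos).restrict_scalars ℝ)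
    (hpair.periodic_xi hα.ne') hz)
  have hvalue : X (z / α) = xi (2 * k + 2) g z := by
    simp only [X, hαz, ext_coe]
  rw [hvalue] at hsum
  refine (hsum.sub (hasSum_ite_eq (0 : ℤ) _)).congr_fun fun n => ?_
  rw [Function.comp_apply, Equiv.neg_apply]
  rcases eq_or_ne n 0 with rfl | hn
  · simp [xiCoeff, e_zero, hconst]
  · rw [if_neg hn, sub_zero, hcoeff n hz, conj_mul_minusConst k α hn]
    congr 2
    push_cast
    ring

end Existence

/-! ### Slash operators, `ξ`, and the cusps -/

section Slash

variable (σ : SL(2, ℤ))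

/-- The action of `σ` on the upper half-plane as a function `ℂ → ℂ`, so that it can be
differentiated. As for `ext`, its values outside of the upper half-plane are arbitrary. -/
noncomputable def moebius (w : ℂ) : ℂ := ((σ • UpperHalfPlane.ofComplex w : ℍ) : ℂ)

theorem im_moebius_pos (w : ℂ) : 0 < (moebius σ w).im :=
  (σ • UpperHalfPlane.ofComplex w).im_pos

theorem hasDerivAt_moebius (z : ℍ) :
    HasDerivAt (moebius σ) (UpperHalfPlane.denom σ z ^ 2)⁻¹ z := by
  have hdet : (σ : GL (Fin 2) ℝ).val.det = 1 :=
    (Matrix.SpecialLinearGroup.map (Int.castRingHom ℝ) σ).det_coe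
  have h := (UpperHalfPlane.hasStrictDerivAt_smul (hdet ▸ one_pos) z).hasDerivAt
  rwa [hdet, Complex.ofReal_one, one_div] at h

theorem differentiableOn_moebius : DifferentiableOn ℂ (moebius σ) {w | 0 < w.im} := fun w hw =>
  (hasDerivAt_moebius σ ⟨w, hw⟩).differentiableAt.differentiableWithinAt

theorem differentiableOn_denom_zpow (κ : ℤ) :
    DifferentiableOn ℂ (fun w => UpperHalfPlane.denom σ w ^ κ) {w | 0 < w.im} := fun w hw =>
  (UpperHalfPlane.hasDerivAt_denom_zpow σ κ ⟨w, hw⟩).differentiableAt.differentiableWithinAt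

theorem ext_slash (κ : ℤ) (G : ℍ → ℂ) {w : ℂ} (hw : 0 < w.im) :
    ext (G ∣[κ] σ) w = ext G (moebius σ w) * UpperHalfPlane.denom σ w ^ (-κ) := by
  lift w to ℍ using hw
  rw [ext_coe, ModularForm.SL_slash_apply, moebius, ext_coe, UpperHalfPlane.ofComplex_apply]

theorem contDiffOn_ext_slash (κ : ℤ) {G : ℍ → ℂ} {n : WithTop ℕ∞}
    (hG : ContDiffOn ℝ n (ext G) {z | 0 < z.im}) :
    ContDiffOn ℝ n (ext (G ∣[κ] σ)) {z | 0 < z.im} := by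
  have hmoebius : ContDiffOn ℝ n (moebius σ) {z | 0 < z.im} :=
    ((differentiableOn_moebius σ).contDiffOn isOpen_im_pos).restrict_scalars ℝ
  have hdenom : ContDiffOn ℝ n (fun w => UpperHalfPlane.denom σ w ^ (-κ)) {z | 0 < z.im} :=
    ((differentiableOn_denom_zpow σ (-κ)).contDiffOn isOpen_im_pos).restrict_scalars ℝ
  exact ((hG.comp hmoebius fun w _ => im_moebius_pos σ w).mul hdenom).congr
    fun w hw => ext_slash σ κ G hw

theorem differentiableOn_ext_slash (κ : ℤ) {G : ℍ → ℂ}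
    (hG : DifferentiableOn ℂ (ext G) {z | 0 < z.im}) :
    DifferentiableOn ℂ (ext (G ∣[κ] σ)) {z | 0 < z.im} :=
  ((hG.comp (differentiableOn_moebius σ) fun w _ => im_moebius_pos σ w).mul
    (differentiableOn_denom_zpow σ (-κ))).congr fun _ hw => ext_slash σ κ G hw

theorem dbar_congr {F H : ℂ → ℂ} {z : ℂ} (h : F =ᶠ[𝓝 z] H) : dbar F z = dbar H z := by
  rw [dbar, dbar, dX, dX, dY, dY, h.fderiv_eq]

theorem dbar_ext_slash (κ : ℤ) {G : ℍ → ℂ} (hG : DifferentiableOn ℝ (ext G) {z | 0 < z.im})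
    (z : ℍ) : dbar (ext (G ∣[κ] σ)) z = dbar (ext G) (σ • z : ℍ) *
      (starRingEnd ℂ) (UpperHalfPlane.denom σ z ^ 2)⁻¹ * UpperHalfPlane.denom σ z ^ (-κ) := by
  have hz : {w : ℂ | 0 < w.im} ∈ 𝓝 (z : ℂ) := isOpen_im_pos.mem_nhds z.im_pos
  have hmoebius := hasDerivAt_moebius σ z
  have hG' : DifferentiableAt ℝ (ext G) (moebius σ z) :=
    hG.differentiableAt (isOpen_im_pos.mem_nhds (im_moebius_pos σ z))
  rw [dbar_congr (eventually_of_mem hz fun w hw => ext_slash σ κ G hw),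
    dbar_mul_of_differentiableAt (F := fun w => ext G (moebius σ w))
      (hG'.comp _ (hmoebius.differentiableAt.restrictScalars ℝ))
      ((differentiableOn_denom_zpow σ (-κ)).differentiableAt hz),
    dbar_comp hG' hmoebius, moebius, UpperHalfPlane.ofComplex_apply,
    mul_comm (dbar (ext G) _)]

theorem xi_slash (κ : ℤ) {G : ℍ → ℂ} (hG : DifferentiableOn ℝ (ext G) {z | 0 < z.im}) :
    xi κ (G ∣[κ] σ) = (xi κ G) ∣[2 - κ] σ := by
  funext z
  have hd : UpperHalfPlane.denom σ z ≠ 0 := UpperHalfPlane.denom_ne_zero σ z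
  have hd' : (starRingEnd ℂ) (UpperHalfPlane.denom σ z) ≠ 0 := (map_ne_zero _).2 hd
  have hdκ := zpow_ne_zero κ hd
  have him : ((σ • z : ℍ).im : ℂ) =
      z.im / (UpperHalfPlane.denom σ z * (starRingEnd ℂ) (UpperHalfPlane.denom σ z)) := by
    rw [ModularGroup.im_smul_eq_div_normSq, Complex.mul_conj, Complex.ofReal_div]
  rw [ModularForm.SL_slash_apply, xi_eq, xi_eq, dbar_ext_slash σ κ hG, him, neg_sub,
    zpow_sub₀ hd, div_zpow, mul_zpow]
  simp only [map_mul, map_inv₀, map_zpow₀, map_pow, Complex.conj_conj, zpow_neg, zpow_ofNat]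
  field_simp

end Slash

section Harmonic

variable {F : ℂ → ℂ} {z : ℂ}

theorem hasFDerivAt_fderiv_apply (hF : ContDiffAt ℝ 2 F z) (v : ℂ) :
    HasFDerivAt (fun w => fderiv ℝ F w v) ((fderiv ℝ (fderiv ℝ F) z).flip v) z := by
  have hF' : DifferentiableAt ℝ (fderiv ℝ F) z :=
    (hF.fderiv_right (m := 1) one_add_one_eq_two.le).differentiableAt one_ne_zero
  refine (hF'.hasFDerivAt.clm_apply (hasFDerivAt_const v z)).congr_fderiv ?_
  ext w
  simp

theorem hasFDerivAt_dbar (hF : ContDiffAt ℝ 2 F z) :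
    HasFDerivAt (dbar F) ((fderiv ℝ (fderiv ℝ F) z).flip 1 +
      Complex.I • (fderiv ℝ (fderiv ℝ F) z).flip Complex.I) z :=
  (hasFDerivAt_fderiv_apply hF 1).add ((hasFDerivAt_fderiv_apply hF Complex.I).const_mul Complex.I)

theorem dX_dX_add_dY_dY (hF : ContDiffAt ℝ 2 F z) :
    dX (dX F) z + dY (dY F) z = dX (dbar F) z - Complex.I * dY (dbar F) z := by
  have hsymm : fderiv ℝ (fderiv ℝ F) z Complex.I 1 = fderiv ℝ (fderiv ℝ F) z 1 Complex.I :=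
    (hF.isSymmSndFDerivAt (by simp)).eq _ _
  rw [dX, dY, dX, dY, (hasFDerivAt_dbar hF).fderiv]
  unfold dX dY
  rw [(hasFDerivAt_fderiv_apply hF 1).fderiv, (hasFDerivAt_fderiv_apply hF Complex.I).fderiv]
  simp only [add_apply, smul_apply, ContinuousLinearMap.flip_apply, smul_eq_mul, hsymm]
  linear_combination fderiv ℝ (fderiv ℝ F) z Complex.I Complex.I * Complex.I_sq

theorem differentiableAt_im_zpow_mul_conj {D : ℂ → ℂ} (hD : DifferentiableAt ℝ D z)
    (hz : 0 < z.im) {κ : ℤ}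
    (h : z.im * (dX D z - Complex.I * dY D z) = Complex.I * κ * D z) :
    DifferentiableAt ℂ (fun w => (w.im : ℂ) ^ κ * (starRingEnd ℂ) (D w)) z := by
  have hy : (z.im : ℂ) ≠ 0 := Complex.ofReal_ne_zero.2 hz.ne'
  have hpow : HasFDerivAt (fun w : ℂ => (w.im : ℂ) ^ κ) _ z :=
    HasDerivAt.comp_hasFDerivAt (h₂ := fun u : ℂ => u ^ κ) z
      (hasDerivAt_zpow κ (z.im : ℂ) (.inl hy))
      (Complex.ofRealCLM.comp Complex.imCLM).hasFDerivAt
  have hconj : HasFDerivAt (fun w => (starRingEnd ℂ) (D w)) _ z :=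
    (Complex.conjCLE : ℂ →L[ℝ] ℂ).hasFDerivAt.comp z hD.hasFDerivAt
  have hmul := hpow.fun_mul hconj
  refine differentiableAt_complex_iff_differentiableAt_real.2 ⟨hmul.differentiableAt, ?_⟩
  have h' := congrArg (starRingEnd ℂ) h
  rw [hmul.fderiv]
  simp only [dX, dY, map_mul, Complex.conj_ofReal, map_sub, Complex.conj_I, neg_mul,
    sub_neg_eq_add, map_intCast, zpow_sub_one₀ hy, add_apply, smul_apply,
    ContinuousLinearMap.comp_apply, ContinuousLinearEquiv.coe_coe,
    ContinuousAlgEquiv.coeCLE_apply, Complex.conjCAE_apply, smul_eq_mul, Complex.imCLM_apply,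
    Complex.I_im, Complex.ofRealCLM_apply, Complex.ofReal_one, mul_one, Complex.one_im,
    Complex.ofReal_zero, mul_zero, add_zero] at h' ⊢
  refine mul_left_cancel₀ hy ?_
  linear_combination -Complex.I * (z.im : ℂ) ^ κ * h' +
    (z.im : ℂ) ^ κ * (z.im * (starRingEnd ℂ) (fderiv ℝ D z Complex.I) +
      κ * (starRingEnd ℂ) (D z)) * Complex.I_sq +
    κ * (starRingEnd ℂ) (D z) * (z.im : ℂ) ^ κ * mul_inv_cancel₀ hy

theorem differentiableOn_ext_xi {κ : ℤ} {G : ℍ → ℂ} (hG : ContDiffOn ℝ 2 (ext G) {z | 0 < z.im})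
    (hL : ∀ z, laplace κ G z = 0) : DifferentiableOn ℂ (ext (xi κ G)) {z | 0 < z.im} := by
  intro z hz
  have hnhds : {w : ℂ | 0 < w.im} ∈ 𝓝 z := isOpen_im_pos.mem_nhds hz
  have hGz : ContDiffAt ℝ 2 (ext G) z := hG.contDiffAt hnhds
  have hy : (z.im : ℂ) ≠ 0 := Complex.ofReal_ne_zero.2 (ne_of_gt hz)
  have hharmonic : (z.im : ℂ) * (dX (dbar (ext G)) z - Complex.I * dY (dbar (ext G)) z) =
      Complex.I * κ * dbar (ext G) z := by
    have hLz : -(z.im : ℂ) ^ 2 * (dX (dX (ext G)) z + dY (dY (ext G)) z) +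
        Complex.I * κ * z.im * dbar (ext G) z = 0 := hL ⟨z, hz⟩
    rw [dX_dX_add_dY_dY hGz] at hLz
    exact mul_left_cancel₀ hy (by linear_combination -hLz)
  refine (((differentiableAt_im_zpow_mul_conj (hasFDerivAt_dbar hGz).differentiableAt hz
    hharmonic).const_mul Complex.I).congr_of_eventuallyEq ?_).differentiableWithinAt
  filter_upwards [hnhds] with w hw
  rw [ext_xi κ G hw, mul_assoc]

end Harmonic

section Cusp

variable {Γ : Subgroup SL(2, ℤ)} {σ : SL(2, ℤ)}

theorem cuspWidth_pos (Γ : Subgroup SL(2, ℤ)) [Γ.FiniteIndex] (σ : SL(2, ℤ)) :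
    0 < cuspWidth Γ σ := by
  obtain ⟨n, hn, -, hmem⟩ :=
    Γ.exists_pow_mem_of_index_ne_zero Subgroup.FiniteIndex.index_ne_zero
      (σ * ModularGroup.T * σ⁻¹)
  rw [conj_pow] at hmem
  exact (Nat.sInf_mem (s := {n : ℕ | 0 < n ∧ (σ * ModularGroup.T ^ n * σ⁻¹ ∈ Γ ∨
    -(σ * ModularGroup.T ^ n * σ⁻¹) ∈ Γ)}) ⟨n, hn, .inl hmem⟩).1

theorem mem_or_neg_mem_of_cuspWidth_pos (hα : 0 < cuspWidth Γ σ) :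
    σ * ModularGroup.T ^ cuspWidth Γ σ * σ⁻¹ ∈ Γ ∨
      -(σ * ModularGroup.T ^ cuspWidth Γ σ * σ⁻¹) ∈ Γ :=
  (Nat.sInf_mem (Nat.nonempty_of_pos_sInf hα)).2

theorem slash_neg {κ : ℤ} (hκ : Even κ) (G : ℍ → ℂ) (γ : SL(2, ℤ)) : G ∣[κ] (-γ) = G ∣[κ] γ := by
  funext z
  have hdenom : UpperHalfPlane.denom (-γ : SL(2, ℤ)) z = -UpperHalfPlane.denom γ z := by
    rw [ModularGroup.denom_apply, ModularGroup.denom_apply]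
    simp [neg_add_rev, add_comm]
  rw [ModularForm.SL_slash_apply, ModularForm.SL_slash_apply, ModularGroup.SL_neg_smul, hdenom,
    hκ.neg.neg_zpow]

theorem ext_slash_T_pow (κ : ℤ) (G : ℍ → ℂ) (n : ℕ) {z : ℂ} (hz : 0 < z.im) :
    ext (G ∣[κ] (ModularGroup.T ^ n)) z = ext G (z + n) := by
  lift z to ℍ using hz
  have hT : (ModularGroup.T ^ n : SL(2, ℤ)).1 = !![1, (n : ℤ); 0, 1] := by
    rw [← ModularGroup.coe_T_zpow, zpow_natCast]
  have hdenom : UpperHalfPlane.denom (ModularGroup.T ^ n : SL(2, ℤ)) z = 1 := by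
    rw [ModularGroup.denom_apply, hT]
    simp
  rw [ext_slash _ κ G z.im_pos, hdenom, one_zpow, mul_one, moebius,
    UpperHalfPlane.ofComplex_apply, ← zpow_natCast, ModularGroup.coe_T_zpow_smul_eq,
    Int.cast_natCast]

theorem ext_slash_add_cuspWidth {κ : ℤ} (hκ : Even κ) {G : ℍ → ℂ}
    (hG : ∀ γ ∈ Γ, G ∣[κ] γ = G) (hα : 0 < cuspWidth Γ σ) {z : ℂ} (hz : 0 < z.im) :
    ext (G ∣[κ] σ) (z + cuspWidth Γ σ) = ext (G ∣[κ] σ) z := by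
  have hconj : G ∣[κ] (σ * ModularGroup.T ^ cuspWidth Γ σ * σ⁻¹) = G := by
    rcases mem_or_neg_mem_of_cuspWidth_pos hα with hmem | hmem
    · exact hG _ hmem
    · rw [← slash_neg hκ, hG _ hmem]
  have hT : (G ∣[κ] σ) ∣[κ] (ModularGroup.T ^ cuspWidth Γ σ) = G ∣[κ] σ := by
    rw [← SlashAction.slash_mul]
    conv_rhs => rw [← hconj, ← SlashAction.slash_mul, inv_mul_cancel_right]
  rw [← ext_slash_T_pow κ _ _ hz, hT]

end Cusp

theorem IsHarmonicMaassForm.regHalf_eq_altHalf {Γ : Subgroup SL(2, ℤ)} {k : ℕ} {G : ℍ → ℂ}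
    (hG : IsHarmonicMaassForm Γ (2 * k + 2) G) {σ : SL(2, ℤ)} (hα : 0 < cuspWidth Γ σ) (r : ℝ)
    {c S T : ℝ} (hc : 0 < c) (hS : 0 < S) (hT : 0 < T) :
    regHalf Γ k G σ r c S = altHalf Γ k G σ r c T := by
  have hsmooth : ContDiffOn ℝ 2 (ext G) {z | 0 < z.im} := contDiffOn_infty.1 hG.smooth 2
  have hslash := contDiffOn_ext_slash σ (2 * k + 2) hsmooth
  have hξ : xi (2 * k + 2) (G ∣[(2 * k + 2 : ℤ)] σ) = xi (2 * k + 2) G ∣[(-(2 * k) : ℤ)] σ := by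
    rw [xi_slash σ (2 * k + 2) (hsmooth.differentiableOn two_ne_zero)]
    congr 1
    ring
  have hpair := isRescaledXiPair k hα hslash
    (fun z hz => ext_slash_add_cuspWidth ⟨k + 1, by ring⟩ hG.slash_eq hα hz)
    (hξ ▸ differentiableOn_ext_slash σ _ (differentiableOn_ext_xi hsmooth hG.harmonic))
  have hexp := isFourierExpansion_fourierCoeffs (exists_isFourierExpansion hα hpair (hG.growth σ))
  exact ShintaniCycle.regHalf_eq_altHalf hα hexp (hξ ▸ hexp.isXiExpansion hα hpair)
    hslash.continuousOn r hc hS hT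

theorem normFactor_ne_zero {N : ℕ} (hN : 0 < N) (k : ℕ) {X : Matrix (Fin 2) (Fin 2) ℚ}
    (hX : Q N X < 0) : normFactor N k X ≠ 0 := by
  have habs : (0 : ℝ) < (|Q N X| : ℚ) := Rat.cast_pos.2 (abs_pos.2 hX.ne)
  have hsqrt : (Real.sqrt ((|Q N X| : ℚ) * N) : ℂ) ≠ 0 :=
    Complex.ofReal_ne_zero.2 (Real.sqrt_pos.2 (by positivity)).ne'
  exact mul_ne_zero (pow_ne_zero _ (mul_ne_zero (mul_ne_zero two_ne_zero hsqrt) Complex.I_ne_zero))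
    Complex.I_ne_zero

end ShintaniCycle

theorem mainTheorem9_general (N : ℕ) (hN : 0 < N) (Γ : Subgroup SL(2, ℤ)) [Γ.FiniteIndex]
    (k : ℕ) (G : ℍ → ℂ) (hG : ShintaniCycle.IsHarmonicMaassForm Γ (2 * k + 2) G)
    (X : Matrix (Fin 2) (Fin 2) ℚ) (hneg : ShintaniCycle.Q N X < 0) (σp σm : SL(2, ℤ))
    (c : ℝ) (hc : 0 < c) (Sp Sm : ℝ) (hSp : 0 < Sp) (hSm : 0 < Sm)
    (Tp Tm : ℝ) (hTp : 0 < Tp) (hTm : 0 < Tm) :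
    1 / ShintaniCycle.normFactor N k X *
        ShintaniCycle.regCycleIntegral N Γ k G X σp σm c Sp Sm
      = ShintaniCycle.altHalf Γ k G σp (ShintaniCycle.realPart N X σp) c Tp
        + (-1) ^ (k + 1) *
          ShintaniCycle.altHalf Γ k G σm (ShintaniCycle.realPart N (-X) σm)
            (ShintaniCycle.cMinus N X σp σm c) Tm := by
  have hcMinus : 0 < ShintaniCycle.cMinus N X σp σm c := UpperHalfPlane.im_pos _
  rw [ShintaniCycle.regCycleIntegral, one_div,
    inv_mul_cancel_left₀ (ShintaniCycle.normFactor_ne_zero hN k hneg),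
    hG.regHalf_eq_altHalf (ShintaniCycle.cuspWidth_pos Γ σp) _ hc hSp hTp,
    hG.regHalf_eq_altHalf (ShintaniCycle.cuspWidth_pos Γ σm) _ hcMinus hSm hTm]

theorem mainTheorem9 (N : ℕ) (hN : 0 < N)
    (Γ : Subgroup SL(2, ℤ)) (hΓ : CongruenceSubgroup.IsCongruenceSubgroup Γ)
    (k : ℕ) (G : ℍ → ℂ) (hG : ShintaniCycle.IsHarmonicMaassForm Γ (2 * k + 2) G)
    (X : Matrix (Fin 2) (Fin 2) ℚ) (hX : X.trace = 0)
    (hneg : ShintaniCycle.Q N X < 0) (hsq : IsSquare (|ShintaniCycle.Q N X| / (4 * N)))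
    (σp σm : SL(2, ℤ)) (hσ : ShintaniCycle.IsCuspPair N X σp σm)
    (c : ℝ) (hc : 0 < c)
    -- the auxiliary numbers in the definition of the regularized cycle integral
    (Sp Sm : ℝ) (hSp : 0 < Sp) (hSm : 0 < Sm)
    -- the auxiliary numbers in the formula
    (Tp Tm : ℝ) (hTp : 0 < Tp) (hTm : 0 < Tm) :
    1 / ShintaniCycle.normFactor N k X *
        ShintaniCycle.regCycleIntegral N Γ k G X σp σm c Sp Sm
      = ShintaniCycle.altHalf Γ k G σp (ShintaniCycle.realPart N X σp) c Tp
        + (-1) ^ (k + 1) *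
          ShintaniCycle.altHalf Γ k G σm (ShintaniCycle.realPart N (-X) σm)
            (ShintaniCycle.cMinus N X σp σm c) Tm := by
  have := hΓ.finiteIndex
  exact mainTheorem9_general N hN Γ k G hG X hneg σp σm c hc Sp Sm hSp hSm Tp Tm hTp hTm
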